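/- Let $\varphi_0=e^{123}+e^{145}+e^{167}+e^{246}-e^{257}-e^{347}-e^{356}$ be the standard $3$-form on $\mathbb R^7$. A $G_2$-structure on a smooth $7$-manifold $M$ (not necessarily compact) is a smooth $3$-form $\sigma$ such that at every $x\in M$ there is a linear isomorphism $u:T_xM\to\mathbb R^7$ with $u^*\varphi_0=\sigma_x$; its metric $g^\sigma$ is the pull-back of the Euclidean metric by $u$, and $\nabla^\sigma$ is the Levi-Civita connection of $g^\sigma$. Fix a smooth torsion-free affine connection $\nabla^0$ on $M$ and put $T=T(\sigma)=\nabla^\sigma-\nabla^0$, with components $T^i_{jk}=T^i_{kj}$ (so $\nabla^\sigma_{e_j}e_k-\nabla^0_{e_j}e_k=T^i_{jk}e_i$). On flat $\mathbb R^7$ with the $G_2$-structure $\varphi_0$, let $\Omega^3_{27}$ be the space of smooth $3$-forms $\gamma$ with $\gamma\wedge\varphi_0=0$ and $\gamma\wedge*\varphi_0=0$, let $\pi^3_{27}$ be the orthogonal projection onto $\Omega^3_{27}$, put $\mathbf j(\gamma)(v,w)=*\big((v\lrcorner\varphi_0)\wedge(w\lrcorner\varphi_0)\wedge\gamma\big)$,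 and let $d^{27}_7:\Omega^3_{27}\to\Omega^1$ be the formal adjoint of $\alpha\mapsto\pi^3_{27}\,d*(\alpha\wedge*\varphi_0)$. There is a nonzero constant $A$ with $(d^{27}_7\gamma)_\#=A\,\mathrm{div}\,\mathbf j(\gamma)$ for all $\gamma\in\Omega^3_{27}$. For every such constant $A$, define the vector fields $$V_1(\sigma)=\tfrac17\,g^{ij}T^k_{kj}\,e_i,\qquad V_2(\sigma)=2A\big(g^{pq}T^i_{pq}\,e_i+5V_1(\sigma)\big),\qquad V(\sigma)=-5V_1(\sigma)-V_2(\sigma),$$ where $g=g^\sigma$. Proposition. Let $\sigma_t$, $t\in J\subseteq\mathbb R$, be a family of $G_2$-structures on $M$. Then the evolution equation $$\frac{d}{dt}\phi=-V\big((\phi^{-1})^*\sigma_t\big)$$ for diffeomorphisms $\phi$ of $M$ is strictly parabolic. More precisely, let $t\in J$, let $\phi$ be a diffeomorphism of $M$, and put $\overline\sigma=(\phi^{-1})^*\sigma_t$. There is a linear differential operator $P$ of order at most $2$ with smooth coefficients, acting on vector fields on $M$, with the following properties. (1) $P$ is the linearization of the right-hand side at $\phi$: for every smooth one-parameter family $\phi_s$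 of diffeomorphisms with $\phi_0=\phi$ and $\frac{\partial}{\partial s}\big|_{s=0}\phi_s=X\circ\phi$, where $X$ is a smooth vector field on $M$, one has $-\frac{\partial}{\partial s}\big|_{s=0}V\big((\phi_s^{-1})^*\sigma_t\big)=P X$ pointwise on $M$. (2) $P$ is strictly elliptic: there is $c>0$ such that the principal symbol $s_P$, normalized by $s_P(df_x)X(x)=P(\tfrac12f^2X)(x)$ for $f(x)=0$, satisfies $\langle s_P(\xi)v,v\rangle\ge c|\xi|^2|v|^2$ for all $x\in M$, $\xi\in T_x^*M$, $v\in T_xM$, the inner product and norms being those of $g^{\overline\sigma}$. (3) $P$ has leading part $-\Delta$: $P X=-(\Delta_{\overline\sigma}X^\flat)_\#+R X$ for all smooth vector fields $X$, where $\Delta_{\overline\sigma}=dd^*+d^*d$ is the Hodge Laplacian of $g^{\overline\sigma}$ on $1$-forms, $\flat$ and $\#$ are taken with respect to $g^{\overline\sigma}$, and $R$ is a linear differential operator of order at most $1$ with smooth coefficients. -/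

import Mathlib

open scoped Manifold ContDiff
open MeasureTheory

noncomputable section

namespace G2Flow

/-! ### Linear algebra of the model space `ℝ⁷` -/

/-- The Euclidean space `ℝ⁷`. -/
abbrev R7 : Type := EuclideanSpace ℝ (Fin 7)

/-- Alternating 3-forms on `ℝ⁷`. -/
abbrev Form3 : Type := R7 [⋀^Fin 3]→L[ℝ] ℝ

/-- The standard basis vector `e_i` of `ℝ⁷` (indices run over `0, …, 6`). -/
def e (i : Fin 7) : R7 := EuclideanSpace.single i 1

/-- The elementary form `e^i ∧ e^j ∧ e^k`, i.e. `(v₀, v₁, v₂) ↦ det (coordinates i, j, k of v_a)`. -/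
def elem3 (i j k : Fin 7) : Form3 :=
  let A : R7 [⋀^Fin 3]→ₗ[ℝ] ℝ :=
    (Matrix.detRowAlternating (R := ℝ) (n := Fin 3)).compLinearMap
      (LinearMap.pi fun a : Fin 3 =>
        ((EuclideanSpace.proj (![i, j, k] a) : R7 →L[ℝ] ℝ) : R7 →ₗ[ℝ] ℝ))
  { toMultilinearMap := A.toMultilinearMap
    cont := by
      change Continuous fun v : Fin 3 → R7 =>
        Matrix.det (Matrix.of fun a b : Fin 3 => (v a) (![i, j, k] b))
      fun_prop
    map_eq_zero_of_eq' := A.map_eq_zero_of_eq' }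

/-- The model form
`φ = e¹²³ + e¹⁴⁵ + e¹⁶⁷ + e²⁴⁶ - e²⁵⁷ - e³⁴⁷ - e³⁵⁶` (here with indices shifted by one). -/
def phi0 : Form3 :=
  elem3 0 1 2 + elem3 0 3 4 + elem3 0 5 6 + elem3 1 3 5
    - elem3 1 4 6 - elem3 2 3 6 - elem3 2 4 5

/-- The Euclidean inner product on 3-forms, for which `e^{ijk}`, `i < j < k`, is orthonormal. -/
def inner3 (a b : Form3) : ℝ :=
  (1 / 6) * ∑ i, ∑ j, ∑ k, a ![e i, e j, e k] * b ![e i, e j, e k]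

/-- `γ ∈ Λ³₂₇`: both `γ ∧ φ = 0` and `γ ∧ *φ = ⟨γ, φ⟩ vol = 0`. -/
def IsLambda27 (γ : Form3) : Prop :=
  (∀ v : Fin 6 → R7,
    ∑ π : Equiv.Perm (Fin 6), ((Equiv.Perm.sign π : ℤ) : ℝ) *
      γ ![v (π 0), v (π 1), v (π 2)] * phi0 ![v (π 3), v (π 4), v (π 5)] = 0) ∧
  inner3 γ phi0 = 0

/-- `j(γ)(v, w) = *((v ⌟ φ) ∧ (w ⌟ φ) ∧ γ)`: the value of the 7-form on `(e_1, …, e_7)`. -/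
def jMap (γ : Form3) (v w : R7) : ℝ :=
  (1 / (2 * 2 * 6)) * ∑ π : Equiv.Perm (Fin 7), ((Equiv.Perm.sign π : ℤ) : ℝ) *
    phi0 ![v, e (π 0), e (π 1)] * phi0 ![w, e (π 2), e (π 3)] *
      γ ![e (π 4), e (π 5), e (π 6)]

/-- The pairing `⟨div j(γ), X⟩` at `x`, where
`div h = ∑_{i,l} ∂_i h(e_i, e_l) e_l`, for a field `γ` of 3-forms on flat `ℝ⁷`. -/
def divJ (γ : R7 → Form3) (x : R7) (X : R7) : ℝ :=
  ∑ i, ∑ l, fderiv ℝ (fun y => jMap (γ y) (e i) (e l)) x (e i) * X l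

/-- `A` is the constant with `(d²⁷₇ γ)_# = A · div j(γ)` for all `γ ∈ Ω³₂₇` on flat `ℝ⁷`.
Here `d²⁷₇` is the formal `L²`-adjoint of `d⁷₂₇ α = π³₂₇ d *(α ∧ *φ)`, and `*(α ∧ *φ) = X ⌟ φ`
if `X` is the vector field dual to `α`. The orthogonal projection `π³₂₇` is not needed in the
pairing with `γ ∈ Ω³₂₇`. -/
def IsDivConstant (A : ℝ) : Prop :=
  ∀ γ : R7 → Form3, ContDiff ℝ ∞ γ → (∀ x, IsLambda27 (γ x)) →
    ∀ X : R7 → R7, ContDiff ℝ ∞ X → HasCompactSupport X →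
      ∫ x, inner3 (γ x) (extDeriv (fun y => phi0.curryLeft (X y)) x) =
        ∫ x, A * divJ γ x (X x)

/-! ### Geometry of a 7-manifold with a 3-form -/

variable {M : Type*} [TopologicalSpace M] [ChartedSpace R7 M]

/-- The tangent space of a 7-manifold. -/
abbrev T (x : M) : Type := TangentSpace (𝓡 7) x

variable (M) in
/-- (Not necessarily continuous) fields of 3-forms. -/
abbrev ThreeFormField : Type _ := Π x : M, T x [⋀^Fin 3]→L[ℝ] ℝ

variable (M) in
/-- (Not necessarily continuous) vector fields. -/
abbrev Field : Type _ := Π x : M, T x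

variable (M) in
/-- Affine connections on `M`, i.e. covariant derivatives on `TM`; `D Y x v` is `(∇_v Y)(x)`. -/
abbrev AffineConnection [IsManifold (𝓡 7) ∞ M] : Type _ :=
  CovariantDerivative (𝓡 7) R7 (TangentSpace (𝓡 7) : M → Type _)

variable (M) in
/-- Smooth vector fields. -/
abbrev SmoothField [IsManifold (𝓡 7) ∞ M] : Type _ :=
  ContMDiffSection (𝓡 7) R7 ∞ (TangentSpace (𝓡 7) : M → Type _)

variable (M) in
/-- Smooth functions. -/
abbrev SmoothFunction : Type _ := C^∞⟮𝓡 7, M; 𝓘(ℝ, ℝ), ℝ⟯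

variable (M) in
/-- Smooth self-diffeomorphisms. -/
abbrev Diffeo : Type _ := M ≃ₘ^∞⟮𝓡 7, 𝓡 7⟯ M

/-- `u` is a coframe at `x` adapted to the 3-form `τ`: an isomorphism `u : T_xM → ℝ⁷` with
`u^*φ = τ`. -/
def IsAdapted {x : M} (τ : T x [⋀^Fin 3]→L[ℝ] ℝ) (u : T x ≃L[ℝ] R7) : Prop :=
  phi0.compContinuousLinearMap (u : T x →L[ℝ] R7) = τ

/-- A `G₂`-structure: a smooth 3-form that is definite at every point. -/
structure IsG2Structure [IsManifold (𝓡 7) ∞ M] (σ : ThreeFormField M) : Prop where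
  smooth : ∀ X Y Z : SmoothField M,
    ContMDiff (𝓡 7) 𝓘(ℝ, ℝ) ∞ (fun x => σ x ![X x, Y x, Z x])
  definite : ∀ x, ∃ u : T x ≃L[ℝ] R7, IsAdapted (σ x) u

open Classical in
/-- An adapted coframe of a definite 3-form (junk value if the form is not definite). -/
def coframe {x : M} (τ : T x [⋀^Fin 3]→L[ℝ] ℝ) : T x ≃L[ℝ] R7 :=
  if h : ∃ u : T x ≃L[ℝ] R7, IsAdapted τ u then h.choose else ContinuousLinearEquiv.refl ℝ R7

/-- The metric `g^σ`: the pull-back of the Euclidean metric by an adapted coframe. -/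
def metric (σ : ThreeFormField M) (x : M) (v w : T x) : ℝ :=
  inner ℝ (coframe (σ x) v) (coframe (σ x) w)

/-- The `g^σ`-orthonormal frame of `T_xM` dual to the adapted coframe. -/
def frame (σ : ThreeFormField M) (x : M) (i : Fin 7) : T x :=
  (coframe (σ x)).symm (e i)

/-- A vector field near `x` extending the tangent vector `v` at `x`, smooth near `x`. -/
def ext [IsManifold (𝓡 7) ∞ M] {x : M} (v : T x) : Field M :=
  FiberBundle.extend (E := (TangentSpace (𝓡 7) : M → Type _)) R7 v

/-- `D` is the Levi-Civita connection of `g^σ`: it is torsion free and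
`v(g(Y, Z)) = g(∇_v Y, Z) + g(Y, ∇_v Z)`. -/
structure IsLeviCivita [IsManifold (𝓡 7) ∞ M] (σ : ThreeFormField M)
    (D : AffineConnection M) : Prop where
  torsion_free : D.torsion = 0
  metric_compatible : ∀ (x : M) (Y Z : Field M),
    MDifferentiableAt (𝓡 7) ((𝓡 7).prod 𝓘(ℝ, R7))
      (fun y => (⟨y, Y y⟩ : TangentBundle (𝓡 7) M)) x →
    MDifferentiableAt (𝓡 7) ((𝓡 7).prod 𝓘(ℝ, R7))
      (fun y => (⟨y, Z y⟩ : TangentBundle (𝓡 7) M)) x →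
    ∀ v : T x, mvfderiv (𝓡 7) (fun y => metric σ y (Y y) (Z y)) x v =
      metric σ x (D Y x v) (Z x) + metric σ x (Y x) (D Z x v)

open Classical in
/-- The Levi-Civita connection `∇^σ` of `g^σ`. The background connection `D0` serves only as
junk value in case that there is no Levi-Civita connection (which happens only if `σ` is not a
`G₂`-structure). -/
def leviCivita [IsManifold (𝓡 7) ∞ M] (D0 : AffineConnection M) (σ : ThreeFormField M) :
    AffineConnection M :=
  if h : ∃ D : AffineConnection M, IsLeviCivita σ D then h.choose else D0

/-! ### The vector field `V(σ)` -/

/-- The tensor `T(v, w) = ∇^σ_v W - ∇⁰_v W`, with `W x = w`; it is symmetric in `v` and `w` if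
`∇⁰` is torsion free. -/
def diffTensor [IsManifold (𝓡 7) ∞ M] (D0 : AffineConnection M) (σ : ThreeFormField M)
    (x : M) (v w : T x) : T x :=
  (leviCivita D0 σ).difference D0 x w v

/-- `V₁ = (1/7) g^{ij} T^k_{kj} e_i`, computed in an orthonormal frame. -/
def V1 [IsManifold (𝓡 7) ∞ M] (D0 : AffineConnection M) (σ : ThreeFormField M) : Field M :=
  fun x => (1 / 7 : ℝ) • ∑ i, (∑ k, metric σ x (frame σ x k)
    (diffTensor D0 σ x (frame σ x k) (frame σ x i))) • frame σ x i

/-- `V₂ = 2A (g^{pq} T^i_{pq} e_i + 5 V₁)`, computed in an orthonormal frame. -/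
def V2 [IsManifold (𝓡 7) ∞ M] (A : ℝ) (D0 : AffineConnection M) (σ : ThreeFormField M) :
    Field M :=
  fun x => (2 * A) • (∑ p, diffTensor D0 σ x (frame σ x p) (frame σ x p) + (5 : ℝ) • V1 D0 σ x)

/-- `V(σ) = -5 V₁ - V₂`. -/
def V [IsManifold (𝓡 7) ∞ M] (A : ℝ) (D0 : AffineConnection M) (σ : ThreeFormField M) :
    Field M :=
  fun x => (-5 : ℝ) • V1 D0 σ x - V2 A D0 σ x

/-- The push-forward `(f⁻¹)^*σ` of a field of 3-forms under a diffeomorphism. -/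
def pushForm (f : Diffeo M) (σ : ThreeFormField M) : ThreeFormField M :=
  fun y => (σ (f.symm y)).compContinuousLinearMap (mfderiv (𝓡 7) (𝓡 7) f.symm y)

/-- The velocity field of the flow `∂f/∂t = -V((f⁻¹)^*σ)`: the diffeomorphisms `f_t` solve the
flow if `∂f_t(x)/∂t = flowField A D0 σ_t f_t (f_t x)`. -/
def flowField [IsManifold (𝓡 7) ∞ M] (A : ℝ) (D0 : AffineConnection M)
    (σ : ThreeFormField M) (f : Diffeo M) : Field M :=
  fun y => -V A D0 (pushForm f σ) y

/-! ### The Hodge Laplacian on 1-forms -/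

variable (M) in
/-- 1-forms, evaluated on vectors. -/
abbrev OneForm : Type _ := Π x : M, T x → ℝ

variable (M) in
/-- 2-forms, evaluated on vectors. -/
abbrev TwoForm : Type _ := Π x : M, T x → T x → ℝ

/-- `(∇_v α)(w) = v(α(W)) - α(∇_v W)`. -/
def nabla1 [IsManifold (𝓡 7) ∞ M] (D : AffineConnection M) (α : OneForm M)
    (x : M) (v w : T x) : ℝ :=
  mvfderiv (𝓡 7) (fun y => α y (ext w y)) x v - α x (D (ext w) x v)

/-- `(∇_v β)(a, b) = v(β(A, B)) - β(∇_v A, b) - β(a, ∇_v B)`. -/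
def nabla2 [IsManifold (𝓡 7) ∞ M] (D : AffineConnection M) (β : TwoForm M)
    (x : M) (v a b : T x) : ℝ :=
  mvfderiv (𝓡 7) (fun y => β y (ext a y) (ext b y)) x v
    - β x (D (ext a) x v) b - β x a (D (ext b) x v)

/-- `dα(v, w) = V(α(W)) - W(α(V)) - α([V, W])`. -/
def dOne [IsManifold (𝓡 7) ∞ M] (α : OneForm M) : TwoForm M := fun x v w =>
  mvfderiv (𝓡 7) (fun y => α y (ext w y)) x v - mvfderiv (𝓡 7) (fun y => α y (ext v y)) x w
    - α x (VectorField.mlieBracket (𝓡 7) (ext v) (ext w) x)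

/-- The codifferential of a 1-form, `d^*α = -∑ (∇_{e_i} α)(e_i)`. -/
def coDiff1 [IsManifold (𝓡 7) ∞ M] (σ : ThreeFormField M) (D : AffineConnection M)
    (α : OneForm M) (x : M) : ℝ :=
  -∑ i, nabla1 D α x (frame σ x i) (frame σ x i)

/-- The codifferential of a 2-form, `(d^*β)(w) = -∑ (∇_{e_i} β)(e_i, w)`. -/
def coDiff2 [IsManifold (𝓡 7) ∞ M] (σ : ThreeFormField M) (D : AffineConnection M)
    (β : TwoForm M) : OneForm M :=
  fun x w => -∑ i, nabla2 D β x (frame σ x i) (frame σ x i) w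

/-- The (nonnegative) Hodge Laplacian `Δα = d d^*α + d^*d α` of `g^σ` on 1-forms. -/
def hodgeLaplacian [IsManifold (𝓡 7) ∞ M] (D0 : AffineConnection M) (σ : ThreeFormField M)
    (α : OneForm M) : OneForm M :=
  fun x w => mvfderiv (𝓡 7) (coDiff1 σ (leviCivita D0 σ) α) x w
    + coDiff2 σ (leviCivita D0 σ) (dOne α) x w

/-- `X^♭ = g^σ(X, ·)`. -/
def flat (σ : ThreeFormField M) (X : Field M) : OneForm M :=
  fun x w => metric σ x (X x) w

/-- The vector field `α_#` dual to a 1-form `α`. -/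
def sharp (σ : ThreeFormField M) (α : OneForm M) : Field M :=
  fun x => ∑ i, α x (frame σ x i) • frame σ x i

/-! ### Linearization, differential operators, strict parabolicity -/

/-- The product of a smooth function and a smooth vector field. -/
def smulField [IsManifold (𝓡 7) ∞ M] (f : SmoothFunction M) (X : SmoothField M) :
    SmoothField M where
  toFun := fun x => f x • X x
  contMDiff_toFun := f.contMDiff.smul_section X.contMDiff

/-- Linear differential operators of order `≤ k` with smooth coefficients acting on vector fields:
linear maps `P : Γ(TM) → Γ(TM)` such that `(P X)(x)` vanishes as soon as `X` vanishes at `x`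
to order `k + 1`. -/
def IsDiffOp [IsManifold (𝓡 7) ∞ M] (k : ℕ) (P : SmoothField M →ₗ[ℝ] SmoothField M) : Prop :=
  ∀ (x : M) (f : Fin (k + 1) → SmoothFunction M), (∀ i, f i x = 0) →
    ∀ X : SmoothField M, P (smulField (∏ i, f i) X) x = 0

/-- `P` is the linearization at `f` of the operator `W` from diffeomorphisms to vector fields: for
every smooth family `F s` of diffeomorphisms with `F 0 = f` and `∂F/∂s = X ∘ f` at `s = 0`, the
vector `W(F s)(y)` has the derivative `(P X)(y)` at `s = 0`, for all `y`. -/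
def IsLinearizationAt [IsManifold (𝓡 7) ∞ M] (W : Diffeo M → Field M) (f : Diffeo M)
    (P : SmoothField M →ₗ[ℝ] SmoothField M) : Prop :=
  ∀ F : ℝ → Diffeo M,
    ContMDiff (𝓘(ℝ, ℝ).prod (𝓡 7)) (𝓡 7) ∞ (fun p : ℝ × M => F p.1 p.2) →
    F 0 = f →
    ∀ X : SmoothField M,
      (∀ x, mfderiv 𝓘(ℝ, ℝ) (𝓡 7) (fun s : ℝ => F s x) 0 (1 : ℝ) = X (F 0 x)) →
      ∀ y, HasDerivAt (fun s : ℝ => W (F s) y) (P X y) 0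

/-- The equation `∂X/∂t = P X` is strictly parabolic: `P` is a linear differential operator of
order `≤ 2` whose principal symbol, `s(df_x) X(x) = P(½ f² X)(x)` for `f(x) = 0`, satisfies
`⟨s(ξ) v, v⟩ ≥ c |ξ|² |v|²` for some `c > 0`; the norms are those of `g^σ`. -/
def IsStrictlyParabolic [IsManifold (𝓡 7) ∞ M] (σ : ThreeFormField M)
    (P : SmoothField M →ₗ[ℝ] SmoothField M) : Prop :=
  IsDiffOp 2 P ∧
  ∃ c : ℝ, 0 < c ∧ ∀ (x : M) (f : SmoothFunction M) (X : SmoothField M), f x = 0 →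
    c * (∑ i, (mvfderiv (𝓡 7) f x (frame σ x i)) ^ 2) * metric σ x (X x) (X x) ≤
      metric σ x ((1 / 2 : ℝ) • P (smulField (f * f) X) x) (X x)

end G2Flow

end

noncomputable section

namespace G2Flow

open Equiv Finset

/-! ### Signed sums over permutations -/

/-! The constant `A` is forced to be -1/2, and for this value the terms in `V₁` cancel: `V(σ) =
g^{pq} T^i_{pq} e_i`, the metric trace of the difference of the Levi-Civita connection and the
background connection. The equation is therefore of DeTurck (harmonic map) type and depends on `σ`
only through its metric.

For the constant, `d(X ⌟ φ)` equals `∑ ∂_k X^l e^k ∧ (e_l ⌟ φ)`, and on `Λ³₂₇` the inner product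
with `e^k ∧ (e_l ⌟ φ)` is half of `j(γ)(e_k, e_l)` (`lambda27_pairing`). Integration by parts gives
`isDivConstant_neg_half`; one test form with nonzero divergence gives `isDivConstant_unique`. The
algebra is reduced to integer identities between components of `φ`.

The metric is an explicit smooth function of the 3-form, through the cubic expression `(v ⌟ σ) ∧ (w
⌟ σ) ∧ σ` (`formMetric_adapted`). Hence it does not depend on the chosen coframe, is smooth in
charts, and is natural under diffeomorphisms. Its Christoffel symbols are given by the Koszul
formula (`christoffel_eq_koszulMap`).

For the linearization, write `F s = Ψ_s ∘ f` and let `g` be the metric of `(f⁻¹)^*σ`. The metric at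
parameter `s` is the push-forward of `g` by `Ψ_s`, so its Christoffel symbols at a fixed point `y`
are those of `g` at the preimage `p(s)`, corrected by the second derivative of `Ψ_s`
(`koszulMap_transform`). Differentiation at `s = 0` (`hasDerivAt_transported`) gives `P X = [X, V] +
tr_g (L_X ∇⁰)`, an expression without coordinates (`linE_eq`, `toE_lieConnection`).

At a point where `X` and its first derivatives vanish, `P X` is `g^{jk} ∂_j ∂_k X` (`linE_of_jet`),
while the Hodge Laplacian gives the negative of this (`laplE_of_jet`). So the symbol of `P` is
`|ξ|²` times the identity and `P + Δ` has order at most one. -/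

/-- The sign of the transposition `(0 p)`, for `p` possibly zero. -/
def swapSign {n : ℕ} (p : Fin (n + 1)) : ℤ := if p = 0 then 1 else -1

/-- The family `x` with the entry at `p` removed (the entry at `0` takes its place). -/
def removeSwap {α : Type*} {n : ℕ} (x : Fin (n + 1) → α) (p : Fin (n + 1)) : Fin n → α :=
  fun i => x (swap 0 p i.succ)

/-- Every permutation of `Fin (n + 1)` is uniquely a permutation fixing 0 followed by some `swap 0
p`; this is expansion along the first argument. Iterated, it turns sums over 5040 permutations into
short nested sums that the kernel can evaluate. -/
theorem sum_perm_succ {α : Type*} {n : ℕ} (x : Fin (n + 1) → α) (F : (Fin (n + 1) → α) → ℝ) :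
    ∑ π : Perm (Fin (n + 1)), ((Perm.sign π : ℤ) : ℝ) * F (x ∘ π) =
      ∑ p, (swapSign p : ℝ) * ∑ π : Perm (Fin n), ((Perm.sign π : ℤ) : ℝ) *
        F (Fin.cons (x p) (removeSwap x p ∘ π)) := by
  rw [← Equiv.sum_comp Perm.decomposeFin.symm, Fintype.sum_prod_type]
  refine Finset.sum_congr rfl fun p _ => ?_
  rw [Finset.mul_sum]
  refine Finset.sum_congr rfl fun π _ => ?_
  have h : x ∘ Perm.decomposeFin.symm (p, π) = Fin.cons (x p) (removeSwap x p ∘ π) := by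
    funext i
    refine Fin.cases ?_ (fun i => ?_) i
    · simp
    · simp [removeSwap]
  rw [h, Perm.decomposeFin.symm_sign]
  by_cases hp : p = 0 <;> simp [hp, swapSign]

/-- Coefficient of `γ a b c` in a signed sum over permutations. -/
def tripleCoeff {n : ℕ} (x : Fin (n + 3) → Fin 7) (K : (Fin n → Fin 7) → ℤ) (a b c : Fin 7) : ℤ :=
  ∑ p, if x p = a then swapSign p * ∑ q, if removeSwap x p q = b then swapSign q *
    ∑ r, if removeSwap (removeSwap x p) q r = c then
      swapSign r * K (removeSwap (removeSwap (removeSwap x p) q) r) else 0 else 0 else 0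

/-- Three expansions sort the terms by the value of `γ`. The function `γ` is real and arbitrary, but
by `hK` its coefficients are integers, so identities between such sums become decidable. -/
theorem sum_perm_triple {n : ℕ} (x : Fin (n + 3) → Fin 7) (γ : Fin 7 → Fin 7 → Fin 7 → ℝ)
    (H : (Fin n → Fin 7) → ℝ) (K : (Fin n → Fin 7) → ℤ)
    (hK : ∀ y, ∑ π : Perm (Fin n), ((Perm.sign π : ℤ) : ℝ) * H (y ∘ π) = K y) :
    ∑ π : Perm (Fin (n + 3)), ((Perm.sign π : ℤ) : ℝ) *
      (γ (x (π 0)) (x (π 1)) (x (π 2)) * H (fun i => x (π i.succ.succ.succ))) =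
    ∑ a, ∑ b, ∑ c, γ a b c * (tripleCoeff x K a b c : ℝ) := by
  have h1 := sum_perm_succ x (fun y => γ (y 0) (y 1) (y 2) * H (fun i => y i.succ.succ.succ))
  have e1 : (1 : Fin (n + 3)) = Fin.succ 0 := rfl
  have e2 : (2 : Fin (n + 3)) = Fin.succ (Fin.succ 0) := rfl
  simp only [Function.comp_apply] at h1
  rw [h1]
  have h2 : ∀ p : Fin (n + 3), ∑ π : Perm (Fin (n + 2)), ((Perm.sign π : ℤ) : ℝ) *
      (γ (x p) (removeSwap x p (π 0)) (removeSwap x p (π 1)) *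
        H (fun i => removeSwap x p (π i.succ.succ))) =
      ∑ q, (swapSign q : ℝ) * ∑ r, (swapSign r : ℝ) *
        (γ (x p) (removeSwap x p q) (removeSwap (removeSwap x p) q r) *
          (K (removeSwap (removeSwap (removeSwap x p) q) r) : ℝ)) := by
    intro p
    have h3 := sum_perm_succ (removeSwap x p)
      (fun y => γ (x p) (y 0) (y 1) * H (fun i => y i.succ.succ))
    simp only [Function.comp_apply] at h3
    rw [h3]
    refine Finset.sum_congr rfl fun q _ => ?_
    congr 1
    have h4 := sum_perm_succ (removeSwap (removeSwap x p) q)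
      (fun y => γ (x p) (removeSwap x p q) (y 0) * H (fun i => y i.succ))
    have e1' : (1 : Fin (n + 2)) = Fin.succ 0 := rfl
    simp only [Function.comp_apply] at h4
    simp only [e1', Fin.cons_zero, Fin.cons_succ, Function.comp_apply]
    rw [h4]
    refine Finset.sum_congr rfl fun r _ => ?_
    congr 1
    rw [← hK, Finset.mul_sum]
    refine Finset.sum_congr rfl fun π _ => ?_
    simp only [Fin.cons_zero, Fin.cons_succ]
    rw [show (fun i => (removeSwap (removeSwap (removeSwap x p) q) r ∘ ⇑π) i) =
      removeSwap (removeSwap (removeSwap x p) q) r ∘ ⇑π from rfl]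
    ring
  simp only [e1, e2, Fin.cons_zero, Fin.cons_succ, Function.comp_apply]
  have e1' : (Fin.succ 0 : Fin (n + 2)) = 1 := rfl
  simp only [e1', h2]
  have cast_ite : ∀ (p : Prop) [Decidable p] (m : ℤ),
      ((if p then m else 0 : ℤ) : ℝ) = if p then (m : ℝ) else 0 := by
    intro p _ m; split_ifs <;> simp
  simp only [tripleCoeff, Int.cast_sum, cast_ite, Int.cast_mul, Finset.mul_sum, mul_ite, mul_zero]
  have coll : ∀ {m : ℕ} (y : Fin m → Fin 7) (f : Fin m → Fin 7 → ℝ),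
      ∑ a, ∑ p, (if y p = a then f p a else 0) = ∑ p, f p (y p) := by
    intro m y f
    rw [Finset.sum_comm]
    simp
  have pull : ∀ {m : ℕ} (P : Prop) [Decidable P] (f : Fin m → ℝ),
      ∑ i, (if P then f i else 0) = if P then ∑ i, f i else 0 := by
    intro m P _ f; split_ifs <;> simp
  have step : ∀ a, ∑ b, ∑ c, ∑ p, (if x p = a then ∑ q, if removeSwap x p q = b then
      ∑ r, if removeSwap (removeSwap x p) q r = c then
        γ a b c * ((swapSign p : ℝ) * ((swapSign q : ℝ) * ((swapSign r : ℝ) *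
          (K (removeSwap (removeSwap (removeSwap x p) q) r) : ℝ)))) else 0 else 0 else 0) =
      ∑ p, if x p = a then ∑ q, ∑ r, (swapSign p : ℝ) * ((swapSign q : ℝ) * ((swapSign r : ℝ) *
        (γ a (removeSwap x p q) (removeSwap (removeSwap x p) q r) *
          (K (removeSwap (removeSwap (removeSwap x p) q) r) : ℝ)))) else 0 := by
    intro a
    calc _ = ∑ b, ∑ p, ∑ c, _ := Finset.sum_congr rfl fun b _ => Finset.sum_comm
      _ = ∑ p, ∑ b, ∑ c, _ := Finset.sum_comm
      _ = _ := by
        refine Finset.sum_congr rfl fun p _ => ?_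
        simp only [pull]
        congr 1
        calc _ = ∑ b, ∑ q, (if removeSwap x p q = b then
              ∑ c, ∑ r, if removeSwap (removeSwap x p) q r = c then
              γ a b c * ((swapSign p : ℝ) * ((swapSign q : ℝ) * ((swapSign r : ℝ) *
                (K (removeSwap (removeSwap (removeSwap x p) q) r) : ℝ)))) else 0 else 0) := by
              refine Finset.sum_congr rfl fun b _ => ?_
              rw [Finset.sum_comm]
              refine Finset.sum_congr rfl fun q _ => ?_
              rw [pull]
          _ = _ := by
              rw [coll]
              refine Finset.sum_congr rfl fun q _ => ?_
              rw [coll]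
              refine Finset.sum_congr rfl fun r _ => ?_
              ring
  simp only [step, coll]

/-! ### Components of `φ`, and the finite identities behind the pairing with `Λ³₂₇`. -/

/-- The elementary form `e^{ijk}` on basis vectors, as an integer. -/
def elemZ (i j k a b c : Fin 7) : ℤ :=
  let d : Fin 7 → Fin 7 → ℤ := fun a b => if a = b then 1 else 0
  d i a * d j b * d k c - d i a * d k b * d j c - d j a * d i b * d k c +
    d j a * d k b * d i c + d k a * d i b * d j c - d k a * d j b * d i c

/-- The components of `φ`, as integers. -/
def phiZ (a b c : Fin 7) : ℤ :=
  elemZ 0 1 2 a b c + elemZ 0 3 4 a b c + elemZ 0 5 6 a b c + elemZ 1 3 5 a b c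
    - elemZ 1 4 6 a b c - elemZ 2 3 6 a b c - elemZ 2 4 5 a b c

theorem elem3_apply (i j k : Fin 7) (v : Fin 3 → R7) :
    elem3 i j k v = Matrix.det (Matrix.of fun a b : Fin 3 => (v a) (![i, j, k] b)) := rfl

theorem elem3_basis (i j k a b c : Fin 7) : elem3 i j k ![e a, e b, e c] = elemZ i j k a b c := by
  rw [elem3_apply, Matrix.det_fin_three]
  simp [e, elemZ]

theorem phi0_basis (a b c : Fin 7) : phi0 ![e a, e b, e c] = phiZ a b c := by
  simp [phi0, phiZ, elem3_basis]

/-- A table lookup for `phiZ`. -/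
def phiTable (a b c : Fin 7) : ℤ :=
  -- The base-3 digit at place `49a + 7b + c` is the component plus one; a lookup costs one division
  -- instead of the expansion of seven determinants.
  (((22467781506953686921882136737159915861540419133546247639680328892294283780819291789826897006851729865670084814326742136520956851672919134517942097771795146900816293 : ℕ) / 3 ^ (49 * a.1 + 7 * b.1 + c.1) % 3 : ℕ) : ℤ) - 1

/-- The 24 permutations split into six classes, according to which two places go to `A`; by
antisymmetry the four terms of a class agree. -/
theorem sum_perm_four (A B : Fin 7 → Fin 7 → ℝ) (hA : ∀ i j, A i j = -A j i)
    (hB : ∀ i j, B i j = -B j i) (y : Fin 4 → Fin 7) :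
    ∑ π : Perm (Fin 4), ((Perm.sign π : ℤ) : ℝ) *
      (A (y (π 0)) (y (π 1)) * B (y (π 2)) (y (π 3))) =
    4 * (A (y 0) (y 1) * B (y 2) (y 3) - A (y 0) (y 2) * B (y 1) (y 3)
      + A (y 0) (y 3) * B (y 1) (y 2) + A (y 1) (y 2) * B (y 0) (y 3)
      - A (y 1) (y 3) * B (y 0) (y 2) + A (y 2) (y 3) * B (y 0) (y 1)) := by
  have h0 := sum_perm_succ y (fun z => A (z 0) (z 1) * B (z 2) (z 3))
  simp only [Function.comp_apply] at h0
  rw [h0]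
  have h1 : ∀ (x : Fin 7) (y : Fin 3 → Fin 7), ∑ π : Perm (Fin 3), ((Perm.sign π : ℤ) : ℝ) *
      (A x (y (π 0)) * B (y (π 1)) (y (π 2))) = 2 * (A x (y 0) * B (y 1) (y 2)
        - A x (y 1) * B (y 0) (y 2) + A x (y 2) * B (y 0) (y 1)) := by
    intro x y
    have h0 := sum_perm_succ y (fun z => A x (z 0) * B (z 1) (z 2))
    simp only [Function.comp_apply] at h0
    rw [h0]
    have h1 : ∀ (u : Fin 7) (y : Fin 2 → Fin 7), ∑ π : Perm (Fin 2), ((Perm.sign π : ℤ) : ℝ) *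
      (A x u * B (y (π 0)) (y (π 1))) = 2 * (A x u * B (y 0) (y 1)) := by
      intro u y
      have h0 := sum_perm_succ y (fun z => A x u * B (z 0) (z 1))
      simp only [Function.comp_apply] at h0
      rw [h0]
      simp [Fin.sum_univ_succ, swapSign, removeSwap]
      rw [hB (y 1) (y 0)]
      ring
    have e1 : (1 : Fin 3) = Fin.succ 0 := rfl
    have e2 : (2 : Fin 3) = Fin.succ 1 := rfl
    simp only [e1, e2, Fin.cons_zero, Fin.cons_succ, Function.comp_apply, h1]
    simp [Fin.sum_univ_succ, swapSign, removeSwap, Equiv.swap_apply_def]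
    rw [hB (y 1) (y 0)]
    ring
  have e1 : (1 : Fin 4) = Fin.succ 0 := rfl
  have e2 : (2 : Fin 4) = Fin.succ 1 := rfl
  have e3 : (3 : Fin 4) = Fin.succ 2 := rfl
  simp only [e1, e2, e3, Fin.cons_zero, Fin.cons_succ, Function.comp_apply, h1]
  simp [Fin.sum_univ_succ, swapSign, removeSwap, Equiv.swap_apply_def]
  rw [hA (y 3) (y 1), hA (y 3) (y 2), hA (y 3) (y 0), hA (y 2) (y 1), hA (y 2) (y 0),
    hA (y 1) (y 0), hB (y 2) (y 0), hB (y 1) (y 0)]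
  ring

theorem phiZ_eq_table : ∀ a b c : Fin 7, phiZ a b c = phiTable a b c := by
  decide +kernel

theorem phi0_basis' (a b c : Fin 7) : phi0 ![e a, e b, e c] = phiTable a b c := by
  rw [phi0_basis, phiZ_eq_table]

/-- Coefficients of the 4-form `(e_k ⌟ φ) ∧ (e_l ⌟ φ)`. -/
def fourZ (k l : Fin 7) (y : Fin 4 → Fin 7) : ℤ :=
  phiTable k (y 0) (y 1) * phiTable l (y 2) (y 3) - phiTable k (y 0) (y 2) * phiTable l (y 1) (y 3)
    + phiTable k (y 0) (y 3) * phiTable l (y 1) (y 2)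
    + phiTable k (y 1) (y 2) * phiTable l (y 0) (y 3)
    - phiTable k (y 1) (y 3) * phiTable l (y 0) (y 2)
    + phiTable k (y 2) (y 3) * phiTable l (y 0) (y 1)

theorem phiTable_swap : ∀ k i j : Fin 7, phiTable k i j = -phiTable k j i := by
  decide +kernel

theorem four_sum (k l : Fin 7) (y : Fin 4 → Fin 7) :
    ∑ π : Perm (Fin 4), ((Perm.sign π : ℤ) : ℝ) *
      ((phiTable k (y (π 0)) (y (π 1)) * phiTable l (y (π 2)) (y (π 3)) : ℝ) / 4) =
      fourZ k l y := by
  have hs : ∀ k i j : Fin 7, (phiTable k i j : ℝ) = -phiTable k j i := fun k i j => by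
    exact_mod_cast phiTable_swap k i j
  have h := sum_perm_four (fun i j => (phiTable k i j : ℝ)) (fun i j => (phiTable l i j : ℝ))
    (hs k) (hs l) y
  simp only [fourZ, ← mul_div_assoc, ← Finset.sum_div]
  rw [h]
  push_cast
  ring

theorem jMap_basis (γ : Form3) (k l : Fin 7) : jMap γ (e k) (e l) =
    (1 / 6) * ∑ a, ∑ b, ∑ c, γ ![e a, e b, e c] * (tripleCoeff id (fourZ k l) a b c : ℝ) := by
  have h1 := sum_perm_triple id (fun a b c => γ ![e a, e b, e c])
    (fun y : Fin 4 → Fin 7 => (phiTable k (y 0) (y 1) * phiTable l (y 2) (y 3) : ℝ) / 4) (fourZ k l)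
    (four_sum k l)
  -- In `jMap` the form `γ` occupies the last three places, in `sum_perm_triple` the first three. A
  -- rotation of seven places is even, so moving `γ` costs no sign. The factor 1/24 is 1/6 times the
  -- 1/4 contained in `four_sum`.
  rw [← h1, jMap, ← Equiv.sum_comp (Equiv.mulRight (finRotate 7 ^ 3)), Finset.mul_sum,
    Finset.mul_sum]
  refine Finset.sum_congr rfl fun π _ => ?_
  have e0 : (finRotate 7 ^ 3) 0 = 3 := by decide
  have e1 : (finRotate 7 ^ 3) 1 = 4 := by decide
  have e2 : (finRotate 7 ^ 3) 2 = 5 := by decide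
  have e3 : (finRotate 7 ^ 3) 3 = 6 := by decide
  have e4 : (finRotate 7 ^ 3) 4 = 0 := by decide
  have e5 : (finRotate 7 ^ 3) 5 = 1 := by decide
  have e6 : (finRotate 7 ^ 3) 6 = 2 := by decide
  have hsg : Perm.sign (finRotate 7 ^ 3) = 1 := by rw [map_pow, sign_finRotate]; decide
  simp only [coe_mulRight, Perm.sign_mul, hsg, mul_one, Perm.mul_apply, e0, e1, e2, e3, e4, e5, e6,
    phi0_basis', id]
  simp only [show (Fin.succ (Fin.succ (Fin.succ (0 : Fin 4)))) = 3 from rfl,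
    show (Fin.succ (Fin.succ (Fin.succ (1 : Fin 4)))) = 4 from rfl,
    show (Fin.succ (Fin.succ (Fin.succ (2 : Fin 4)))) = 5 from rfl,
    show (Fin.succ (Fin.succ (Fin.succ (3 : Fin 4)))) = 6 from rfl]
  ring

theorem form3_swap (γ : Form3) (v : Fin 3 → R7) (π : Perm (Fin 3)) :
    γ (v ∘ π) = ((Perm.sign π : ℤ) : ℝ) * γ v := by
  have := γ.toAlternatingMap.map_perm v π
  simpa [Units.smul_def, zsmul_eq_mul] using this

/-- The coefficients of `φ` on a triple of indices. -/
def threeZ (y : Fin 3 → Fin 7) : ℤ := phiTable (y 0) (y 1) (y 2)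

theorem three_sum (y : Fin 3 → Fin 7) : ∑ π : Perm (Fin 3), ((Perm.sign π : ℤ) : ℝ) *
    (phi0 ![e (y (π 0)), e (y (π 1)), e (y (π 2))] / 6) = threeZ y := by
  have h : ∀ π : Perm (Fin 3), phi0 ![e (y (π 0)), e (y (π 1)), e (y (π 2))] =
      ((Perm.sign π : ℤ) : ℝ) * phiTable (y 0) (y 1) (y 2) := by
    intro π
    rw [← phi0_basis', ← form3_swap]
    congr 1
    funext i
    simp only [Function.comp_apply]
    have : ∀ j : Fin 3, ![e (y 0), e (y 1), e (y 2)] j = e (y j) := by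
      intro j; fin_cases j <;> rfl
    rw [this]
    fin_cases i <;> rfl
  simp only [h, threeZ]
  have h2 : ∀ π : Perm (Fin 3), ((Perm.sign π : ℤ) : ℝ) * (((Perm.sign π : ℤ) : ℝ) *
      (phiTable (y 0) (y 1) (y 2) : ℝ) / 6) = (phiTable (y 0) (y 1) (y 2) : ℝ) / 6 := by
    intro π
    rcases Int.units_eq_one_or (Perm.sign π) with h | h <;> simp [h, neg_div]
  simp only [h2, Finset.sum_const, Finset.card_univ, Fintype.card_perm, Fintype.card_fin]
  norm_num [Nat.factorial]
  ring

/-- The 6-form `γ ∧ φ` has seven components, one for each omitted index `m`; `m.succAbove` lists the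
other six indices in order. -/
theorem lambda27_eq (γ : Form3) (hγ : IsLambda27 γ) (m : Fin 7) :
    ∑ a, ∑ b, ∑ c, γ ![e a, e b, e c] *
      (tripleCoeff m.succAbove threeZ a b c : ℝ) = 0 := by
  have h1 := sum_perm_triple m.succAbove (fun a b c => γ ![e a, e b, e c])
    (fun y : Fin 3 → Fin 7 => phi0 ![e (y 0), e (y 1), e (y 2)] / 6)
    threeZ three_sum
  rw [← h1]
  have h2 := hγ.1 (fun i => e (m.succAbove i))
  have h3 := congrArg (fun t : ℝ => t / 6) h2
  simp only [zero_div, Finset.sum_div] at h3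
  rw [← h3]
  refine Finset.sum_congr rfl fun π _ => ?_
  simp only [show (Fin.succ (Fin.succ (Fin.succ (0 : Fin 3)))) = 3 from rfl,
    show (Fin.succ (Fin.succ (Fin.succ (1 : Fin 3)))) = 4 from rfl,
    show (Fin.succ (Fin.succ (Fin.succ (2 : Fin 3)))) = 5 from rfl]
  ring

/-- Taking for `γ` the indicator of a single triple isolates its coefficient, which makes the
symmetry of the coefficients visible. -/
theorem tripleCoeff_eq_sum {n : ℕ} (x : Fin (n + 3) → Fin 7) (H : (Fin n → Fin 7) → ℝ)
    (K : (Fin n → Fin 7) → ℤ)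
    (hK : ∀ y, ∑ π : Perm (Fin n), ((Perm.sign π : ℤ) : ℝ) * H (y ∘ π) = K y) (a b c : Fin 7) :
    (tripleCoeff x K a b c : ℝ) = ∑ π : Perm (Fin (n + 3)), ((Perm.sign π : ℤ) : ℝ) *
      ((if x (π 0) = a ∧ x (π 1) = b ∧ x (π 2) = c then 1 else 0) *
        H (fun i => x (π i.succ.succ.succ))) := by
  rw [sum_perm_triple x (fun a' b' c' => if a' = a ∧ b' = b ∧ c' = c then 1 else 0) H K hK]
  rw [Finset.sum_eq_single a, Finset.sum_eq_single b, Finset.sum_eq_single c] <;>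
    simp +contextual

/-- Reindexing the sum by a transposition of two of the first three places changes only the sign. -/
theorem tripleCoeff_swap {n : ℕ} (x : Fin (n + 3) → Fin 7) (H : (Fin n → Fin 7) → ℝ)
    (K : (Fin n → Fin 7) → ℤ)
    (hK : ∀ y, ∑ π : Perm (Fin n), ((Perm.sign π : ℤ) : ℝ) * H (y ∘ π) = K y) (a b c : Fin 7) :
    tripleCoeff x K b a c = -tripleCoeff x K a b c ∧
      tripleCoeff x K a c b = -tripleCoeff x K a b c := by
  have h01 : (0 : Fin (n + 3)) ≠ 1 := by simp
  have v2 : 2 % (n + 3) = 2 := Nat.mod_eq_of_lt (by omega)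
  have h12 : (1 : Fin (n + 3)) ≠ 2 := by simp [Fin.ext_iff, v2]
  have h02 : (0 : Fin (n + 3)) ≠ 2 := by simp [Fin.ext_iff, v2]
  have hs : ∀ i : Fin n, i.succ.succ.succ ≠ (0 : Fin (n + 3)) ∧ i.succ.succ.succ ≠ (1 : Fin (n + 3))
      ∧ i.succ.succ.succ ≠ (2 : Fin (n + 3)) := by
    intro i; simp [Fin.ext_iff, show 2 % (n + 1 + 1 + 1) = 2 from v2]
  constructor
  · have : (tripleCoeff x K b a c : ℝ) = -tripleCoeff x K a b c := by
      rw [tripleCoeff_eq_sum x H K hK, tripleCoeff_eq_sum x H K hK,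
        ← Equiv.sum_comp (Equiv.mulRight (swap 0 1)), ← Finset.sum_neg_distrib]
      refine Finset.sum_congr rfl fun π _ => ?_
      simp [Perm.sign_swap h01, swap_apply_of_ne_of_ne h02.symm h12.symm,
        fun i => swap_apply_of_ne_of_ne (hs i).1 (hs i).2.1, and_left_comm]
      split_ifs <;> simp
    exact_mod_cast this
  · have : (tripleCoeff x K a c b : ℝ) = -tripleCoeff x K a b c := by
      rw [tripleCoeff_eq_sum x H K hK, tripleCoeff_eq_sum x H K hK,
        ← Equiv.sum_comp (Equiv.mulRight (swap 1 2)), ← Finset.sum_neg_distrib]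
      refine Finset.sum_congr rfl fun π _ => ?_
      simp [Perm.sign_swap h12, swap_apply_of_ne_of_ne h01 h02,
        fun i => swap_apply_of_ne_of_ne (hs i).2.1 (hs i).2.2, and_comm]
      split_ifs <;> simp
    exact_mod_cast this

/-- This cuts the finite checks from 343 triples to the 35 increasing ones. -/
theorem eq_zero_of_sorted (T : Fin 7 → Fin 7 → Fin 7 → ℤ) (h1 : ∀ a b c, T b a c = -T a b c)
    (h2 : ∀ a b c, T a c b = -T a b c) (h0 : ∀ a b c, a < b → b < c → T a b c = 0)
    (a b c : Fin 7) : T a b c = 0 := by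
  have e1 : ∀ a c, T a a c = 0 := fun a c => by have := h1 a a c; omega
  have e2 : ∀ a c, T a c c = 0 := fun a c => by have := h2 a c c; omega
  have s1 : ∀ a b c, a < b → T a b c = 0 := by
    intro a b c hab
    rcases lt_trichotomy b c with h | h | h
    · exact h0 a b c hab h
    · subst h; exact e2 a b
    · have := h2 a b c
      rcases lt_trichotomy a c with h' | h' | h'
      · have := h0 a c b h' h; omega
      · subst h'; have := e1 a b; omega
      · have := h0 c a b h' hab; have := h1 a c b; omega
  rcases lt_trichotomy a b with h | h | h
  · exact s1 a b c h
  · subst h; exact e1 a c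
  · have := s1 b a c h; have := h1 a b c; omega

/-- The components of `e^k ∧ (e_l ⌟ φ)`. -/
def wedgeZ (k l a b c : Fin 7) : ℤ :=
  (if a = k then phiTable l b c else 0) - (if b = k then phiTable l a c else 0)
    + (if c = k then phiTable l a b else 0)

theorem wedgeZ_swap (k l a b c : Fin 7) :
    wedgeZ k l b a c = -wedgeZ k l a b c ∧ wedgeZ k l a c b = -wedgeZ k l a b c := by
  constructor
  · have := phiTable_swap l a b
    simp only [wedgeZ]; split_ifs <;> omega
  · have := phiTable_swap l b c
    simp only [wedgeZ]; split_ifs <;> omega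

/-- Computable form of a consequence of `Λ³ = Λ³₁ ⊕ Λ³₇ ⊕ Λ³₂₇`: twice the pairing with `e^k ∧ (e_l
⌟ φ)` and the pairing defining `j` differ only on `Λ³₇`, hence by a combination of the seven
components of `γ ∧ φ`. The weight of the component omitting `m` is the component of `φ` at `k`, `l`,
`m`, with the sign of moving `m` to the front. -/
theorem wedgeZ_eq_sorted : ∀ a b c : Fin 7, a < b → b < c → ∀ k l,
    2 * wedgeZ k l a b c - tripleCoeff id (fourZ k l) a b c =
    ∑ m : Fin 7, phiTable k l m * ((-1) ^ m.1 *
      tripleCoeff m.succAbove threeZ a b c) := by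
  decide +kernel


theorem wedgeZ_eq (k l a b c : Fin 7) :
    2 * wedgeZ k l a b c - tripleCoeff id (fourZ k l) a b c =
    ∑ m : Fin 7, phiTable k l m * ((-1) ^ m.1 * tripleCoeff m.succAbove threeZ a b c) := by
  have h4 := tripleCoeff_swap id
    (fun y : Fin 4 → Fin 7 => (phiTable k (y 0) (y 1) * phiTable l (y 2) (y 3) : ℝ) / 4) (fourZ k l) (four_sum k l)
  have h3 := fun m : Fin 7 => tripleCoeff_swap m.succAbove
    (fun y : Fin 3 → Fin 7 => phi0 ![e (y 0), e (y 1), e (y 2)] / 6) threeZ three_sum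
  refine sub_eq_zero.1 (eq_zero_of_sorted (fun a b c =>
    (2 * wedgeZ k l a b c - tripleCoeff id (fourZ k l) a b c) - ∑ m : Fin 7, phiTable k l m *
      ((-1) ^ m.1 * tripleCoeff m.succAbove threeZ a b c)) ?_ ?_ ?_ a b c)
  · intro a b c
    simp only [(wedgeZ_swap k l a b c).1, (h4 a b c).1, fun m => (h3 m a b c).1, mul_neg,
      Finset.sum_neg_distrib]
    ring
  · intro a b c
    simp only [(wedgeZ_swap k l a b c).2, (h4 a b c).2, fun m => (h3 m a b c).2, mul_neg,
      Finset.sum_neg_distrib]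
    ring
  · intro a b c hab hbc
    exact sub_eq_zero.2 (wedgeZ_eq_sorted a b c hab hbc k l)

/-- Only the vanishing of `γ ∧ φ` enters, not orthogonality to `φ`. The lemma thus also applies to
`γ = φ`, where it yields the normalization of the metric. -/
theorem sum_wedgeZ (γ : Fin 7 → Fin 7 → Fin 7 → ℝ) (k l : Fin 7)
    (h : ∀ m : Fin 7, ∑ a, ∑ b, ∑ c, γ a b c * (tripleCoeff m.succAbove threeZ a b c : ℝ) = 0) :
    2 * ∑ a, ∑ b, ∑ c, γ a b c * (wedgeZ k l a b c : ℝ) =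
      ∑ a, ∑ b, ∑ c, γ a b c * (tripleCoeff id (fourZ k l) a b c : ℝ) := by
  rw [← sub_eq_zero, Finset.mul_sum, ← Finset.sum_sub_distrib]
  simp only [Finset.mul_sum, ← Finset.sum_sub_distrib]
  have h2 : ∀ a b c, 2 * (γ a b c * (wedgeZ k l a b c : ℝ)) -
      γ a b c * (tripleCoeff id (fourZ k l) a b c : ℝ) = ∑ m : Fin 7, (phiTable k l m * (-1) ^ m.1) *
        (γ a b c * (tripleCoeff m.succAbove threeZ a b c : ℝ)) := by
    intro a b c
    have := congrArg (Int.cast : ℤ → ℝ) (wedgeZ_eq k l a b c)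
    push_cast at this
    calc _ = γ a b c * (2 * (wedgeZ k l a b c : ℝ) - (tripleCoeff id (fourZ k l) a b c : ℝ)) := by
          ring
      _ = _ := by
          rw [this, Finset.mul_sum]
          exact Finset.sum_congr rfl fun m _ => by ring
  simp only [h2]
  have h3 : ∀ F : Fin 7 → Fin 7 → Fin 7 → Fin 7 → ℝ, ∑ a, ∑ b, ∑ c, ∑ m, F a b c m =
      ∑ m, ∑ a, ∑ b, ∑ c, F a b c m := by
    intro F
    calc _ = ∑ a, ∑ b, ∑ m, ∑ c, F a b c m :=
          Finset.sum_congr rfl fun a _ => Finset.sum_congr rfl fun b _ => Finset.sum_comm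
      _ = ∑ a, ∑ m, ∑ b, ∑ c, F a b c m := Finset.sum_congr rfl fun a _ => Finset.sum_comm
      _ = _ := Finset.sum_comm
  rw [h3]
  refine Finset.sum_eq_zero fun m _ => ?_
  simp only [← Finset.mul_sum, h m, mul_zero]

/-- On `Λ³₂₇` the pairing with `e^k ∧ (e_l ⌟ φ)` is `½ j(γ)(e_k, e_l)`. -/
theorem lambda27_pairing (γ : Form3) (hγ : IsLambda27 γ) (k l : Fin 7) :
    ∑ a, ∑ b, ∑ c, γ ![e a, e b, e c] * (wedgeZ k l a b c : ℝ) = 3 * jMap γ (e k) (e l) := by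
  have := sum_wedgeZ (fun a b c => γ ![e a, e b, e c]) k l (lambda27_eq γ hγ)
  rw [jMap_basis, ← this]
  ring

theorem phi_wedge_phi : ∀ m : Fin 7, ∑ a, ∑ b, ∑ c, phiTable a b c *
    tripleCoeff m.succAbove threeZ a b c = 0 := by
  decide +kernel

theorem phi_wedgeZ : ∀ k l : Fin 7, ∑ a, ∑ b, ∑ c, phiTable a b c * wedgeZ k l a b c =
    if k = l then 18 else 0 := by
  decide +kernel

/-- For `γ = φ` the hypothesis of `sum_wedgeZ` is `φ ∧ φ = 0`, true in odd degree. The value is `2 ·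
18 / 6`. -/
theorem jMap_phi0_basis (k l : Fin 7) : jMap phi0 (e k) (e l) = if k = l then 6 else 0 := by
  have h1 : ∀ m : Fin 7, ∑ a, ∑ b, ∑ c, (phiTable a b c : ℝ) *
      (tripleCoeff m.succAbove threeZ a b c : ℝ) = 0 := by
    intro m; exact_mod_cast phi_wedge_phi m
  have h2 := sum_wedgeZ (fun a b c => (phiTable a b c : ℝ)) k l h1
  have h3 := congrArg (Int.cast : ℤ → ℝ) (phi_wedgeZ k l)
  push_cast at h3
  simp only [jMap_basis, phi0_basis']
  rw [← h2, h3]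
  split_ifs <;> norm_num

end G2Flow

end

noncomputable section
namespace G2Flow
open Equiv Finset

/-! ### The metric of a definite 3-form -/

theorem sum_smul_e (v : R7) : ∑ i, v i • e i = v := by
  have := (EuclideanSpace.basisFun (Fin 7) ℝ).sum_repr v
  simpa [e] using this

theorem inner_e_left (i : Fin 7) (v : R7) : inner ℝ (e i) v = v i := by
  simp [e, EuclideanSpace.inner_single_left]

theorem inner_e_e (i j : Fin 7) : inner ℝ (e i) (e j) = if i = j then (1 : ℝ) else 0 := by
  rw [inner_e_left]
  simp [e]

theorem form3_cons (η : Form3) (v x y : R7) : η ![v, x, y] = η.curryLeft v ![x, y] := rfl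

theorem form3_add_left (η : Form3) (v v' x y : R7) :
    η ![v + v', x, y] = η ![v, x, y] + η ![v', x, y] := by
  rw [form3_cons, form3_cons, form3_cons, map_add, ContinuousAlternatingMap.add_apply]

theorem form3_smul_left (η : Form3) (a : ℝ) (v x y : R7) :
    η ![a • v, x, y] = a * η ![v, x, y] := by
  rw [form3_cons, form3_cons, map_smul, ContinuousAlternatingMap.smul_apply, smul_eq_mul]

theorem form3_rotate (η : Form3) (x y z : R7) : η ![x, y, z] = η ![y, z, x] := by
  have h := form3_swap η ![x, y, z] (finRotate 3)
  rw [show Perm.sign (finRotate 3) = 1 by decide] at h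
  simp only [Units.val_one, Int.cast_one, one_mul] at h
  rw [← h]
  congr 1
  funext i
  fin_cases i <;> rfl

theorem form3_add_mid (η : Form3) (v x x' y : R7) :
    η ![v, x + x', y] = η ![v, x, y] + η ![v, x', y] := by
  rw [form3_rotate η v, form3_add_left, ← form3_rotate η v x, ← form3_rotate η v x']

theorem form3_smul_mid (η : Form3) (a : ℝ) (v x y : R7) :
    η ![v, a • x, y] = a * η ![v, x, y] := by
  rw [form3_rotate η v, form3_smul_left, ← form3_rotate]

theorem form3_add_right (η : Form3) (v x y y' : R7) :
    η ![v, x, y + y'] = η ![v, x, y] + η ![v, x, y'] := by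
  rw [form3_rotate η v, form3_add_mid, ← form3_rotate η v x y, ← form3_rotate η v x y']

theorem form3_smul_right (η : Form3) (a : ℝ) (v x y : R7) :
    η ![v, x, a • y] = a * η ![v, x, y] := by
  rw [form3_rotate η v, form3_smul_mid, ← form3_rotate]

/-- The 7-linear map whose alternatization is `(v ⌟ η) ∧ (w ⌟ η) ∧ η`, up to a factor. -/
def septMap (η : Form3) (v w : R7) : MultilinearMap ℝ (fun _ : Fin 7 => R7) ℝ where
  toFun x := η ![v, x 0, x 1] * η ![w, x 2, x 3] * η ![x 4, x 5, x 6]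
  map_update_add' := by
    intro inst x i a b
    obtain rfl : inst = instDecidableEqFin 7 := Subsingleton.elim _ _
    fin_cases i <;>
      simp [Function.update, form3_add_left, form3_add_mid, form3_add_right] <;> ring
  map_update_smul' := by
    intro inst x i a b
    obtain rfl : inst = instDecidableEqFin 7 := Subsingleton.elim _ _
    fin_cases i <;>
      simp [Function.update, form3_smul_left, form3_smul_mid, form3_smul_right] <;> ring

/-- The cubic form `(v ⌟ η) ∧ (w ⌟ η) ∧ η`, evaluated on `(e_1, …, e_7)`. -/
def cubic (η : Form3) (v w : R7) : ℝ :=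
  (1 / 24) * ∑ π : Perm (Fin 7), ((Perm.sign π : ℤ) : ℝ) *
    (η ![v, e (π 0), e (π 1)] * η ![w, e (π 2), e (π 3)] * η ![e (π 4), e (π 5), e (π 6)])

theorem alternatization_septMap (η : Form3) (v w : R7) (x : Fin 7 → R7) :
    MultilinearMap.alternatization (septMap η v w) x =
      ∑ π : Perm (Fin 7), ((Perm.sign π : ℤ) : ℝ) * (η ![v, x (π 0), x (π 1)] *
        η ![w, x (π 2), x (π 3)] * η ![x (π 4), x (π 5), x (π 6)]) := by
  rw [MultilinearMap.alternatization_apply]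
  refine Finset.sum_congr rfl fun π _ => ?_
  simp [septMap, Units.smul_def, zsmul_eq_mul]

theorem alternating_eq_det (A : R7 [⋀^Fin 7]→ₗ[ℝ] ℝ) (x : Fin 7 → R7) :
    A x = A e * (EuclideanSpace.basisFun (Fin 7) ℝ).toBasis.det x := by
  have hb : ⇑(EuclideanSpace.basisFun (Fin 7) ℝ).toBasis = e := by funext i; simp [e]
  have := DFunLike.congr_fun
    (AlternatingMap.eq_smul_basis_det (EuclideanSpace.basisFun (Fin 7) ℝ).toBasis A) x
  rw [AlternatingMap.smul_apply, hb, smul_eq_mul] at this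
  exact this

/-- For fixed `v` and `w` the sum is an alternating 7-linear map evaluated on the basis; moving the
basis by `c` multiplies it by `det c`. -/
theorem cubic_comp (η : Form3) (c : R7 →L[ℝ] R7) (v w : R7) :
    cubic (η.compContinuousLinearMap c) v w =
      LinearMap.det (c : R7 →ₗ[ℝ] R7) * cubic η (c v) (c w) := by
  have h1 : ∀ x y z : R7, η.compContinuousLinearMap c ![x, y, z] = η ![c x, c y, c z] := by
    intro x y z
    rw [ContinuousAlternatingMap.compContinuousLinearMap_apply]
    congr 1
    funext i
    fin_cases i <;> rfl
  set b := (EuclideanSpace.basisFun (Fin 7) ℝ).toBasis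
  have hb : ⇑b = e := by funext i; simp [b, e]
  have h3 := alternating_eq_det (MultilinearMap.alternatization (septMap η (c v) (c w)))
    (fun i => c (e i))
  have h4 : b.det (fun i => c (e i)) = LinearMap.det (c : R7 →ₗ[ℝ] R7) := by
    have := Module.Basis.det_comp b (c : R7 →ₗ[ℝ] R7) b
    rw [Module.Basis.det_self, mul_one] at this
    rw [← this, hb]
    rfl
  rw [h4, alternatization_septMap, alternatization_septMap] at h3
  simp only [cubic, h1]
  rw [h3]
  ring

theorem cubic_phi0_eq_jMap (v w : R7) : cubic phi0 v w = jMap phi0 v w := by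
  simp only [cubic, jMap]
  norm_num [mul_assoc]

theorem jMap_add_left (γ : Form3) (v v' w : R7) : jMap γ (v + v') w = jMap γ v w + jMap γ v' w := by
  simp only [jMap, form3_add_left, ← mul_add, ← Finset.sum_add_distrib]
  congr 1
  exact Finset.sum_congr rfl fun _ _ => by ring

theorem jMap_smul_left (γ : Form3) (a : ℝ) (v w : R7) : jMap γ (a • v) w = a * jMap γ v w := by
  simp only [jMap, form3_smul_left, Finset.mul_sum]
  exact Finset.sum_congr rfl fun _ _ => by ring

theorem jMap_add_right (γ : Form3) (v w w' : R7) : jMap γ v (w + w') = jMap γ v w + jMap γ v w' := by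
  simp only [jMap, form3_add_left, ← mul_add, ← Finset.sum_add_distrib]
  congr 1
  exact Finset.sum_congr rfl fun _ _ => by ring

theorem jMap_smul_right (γ : Form3) (a : ℝ) (v w : R7) : jMap γ v (a • w) = a * jMap γ v w := by
  simp only [jMap, form3_smul_left, Finset.mul_sum]
  exact Finset.sum_congr rfl fun _ _ => by ring

/-- `jMap γ` as a bilinear map. -/
def jBilin (γ : Form3) : R7 →ₗ[ℝ] R7 →ₗ[ℝ] ℝ :=
  LinearMap.mk₂ ℝ (jMap γ) (jMap_add_left γ) (jMap_smul_left γ) (jMap_add_right γ)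
    (jMap_smul_right γ)

theorem jMap_phi0 (v w : R7) : jMap phi0 v w = 6 * inner ℝ v w := by
  have h : jBilin phi0 = (6 : ℝ) • (innerₗ R7) := by
    refine LinearMap.ext_basis (EuclideanSpace.basisFun (Fin 7) ℝ).toBasis
      (EuclideanSpace.basisFun (Fin 7) ℝ).toBasis fun i j => ?_
    have := jMap_phi0_basis i j
    have h2 := inner_e_e i j
    simp only [e] at this h2
    simp only [OrthonormalBasis.coe_toBasis, EuclideanSpace.basisFun_apply, jBilin,
      LinearMap.mk₂_apply, LinearMap.smul_apply, innerₗ_apply_apply, this, h2]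
    split_ifs <;> simp
  have := congrArg (fun f => f v w) h
  simpa [jBilin] using this

/-- The determinant of the cubic form. -/
def cubicDet (η : Form3) : ℝ := Matrix.det (Matrix.of fun i j => cubic η (e i) (e j) / 6)

/-- The metric of a definite 3-form, by an explicit formula. -/
def formMetric (η : Form3) (v w : R7) : ℝ :=
  -- For `η = c^* φ` with `d = det c`, the cubic form over 6 is `d` times the metric and `cubicDet η
  -- = d ^ 9`. The last factor is then `d ^ 8 / d ^ 9 = 1 / d`. Squaring first keeps the base of the
  -- real power positive for either sign of `d`, so the expression is smooth.
  cubic η v w / 6 * ((cubicDet η ^ 2) ^ (4 / 9 : ℝ) / cubicDet η)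

theorem cubic_adapted (c : R7 ≃L[ℝ] R7) (v w : R7) :
    cubic (phi0.compContinuousLinearMap (c : R7 →L[ℝ] R7)) v w / 6 =
      LinearMap.det ((c : R7 →L[ℝ] R7) : R7 →ₗ[ℝ] R7) * inner ℝ (c v) (c w) := by
  rw [cubic_comp, cubic_phi0_eq_jMap, jMap_phi0]
  simp only [ContinuousLinearEquiv.coe_coe]
  ring

/-- The matrix is `d • (mᵀ * m)` with `m` the matrix of `c`: seven factors `d` from the scalar and
two from the determinants. -/
theorem cubicDet_adapted (c : R7 ≃L[ℝ] R7) :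
    cubicDet (phi0.compContinuousLinearMap (c : R7 →L[ℝ] R7)) =
      LinearMap.det ((c : R7 →L[ℝ] R7) : R7 →ₗ[ℝ] R7) ^ 9 := by
  set d := LinearMap.det ((c : R7 →L[ℝ] R7) : R7 →ₗ[ℝ] R7)
  set b := (EuclideanSpace.basisFun (Fin 7) ℝ).toBasis
  set m := LinearMap.toMatrix b b ((c : R7 →L[ℝ] R7) : R7 →ₗ[ℝ] R7)
  have hm : ∀ i j, m i j = (c (e j)) i := by
    intro i j
    simp [m, b, LinearMap.toMatrix_apply, e]
  have h1 : (Matrix.of fun i j =>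
      cubic (phi0.compContinuousLinearMap (c : R7 →L[ℝ] R7)) (e i) (e j) / 6) =
      d • (m.transpose * m) := by
    ext i j
    simp only [Matrix.of_apply, cubic_adapted, Matrix.smul_apply, Matrix.mul_apply,
      Matrix.transpose_apply, hm, smul_eq_mul, PiLp.inner_apply, d]
    congr 1
    exact Finset.sum_congr rfl fun k _ => by simp [mul_comm]
  rw [cubicDet, h1, Matrix.det_smul, Matrix.det_mul, Matrix.det_transpose, LinearMap.det_toMatrix]
  simp only [Fintype.card_fin]
  ring

theorem det_adapted_ne_zero (c : R7 ≃L[ℝ] R7) :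
    LinearMap.det ((c : R7 →L[ℝ] R7) : R7 →ₗ[ℝ] R7) ≠ 0 := by
  have := LinearEquiv.isUnit_det' c.toLinearEquiv
  exact this.ne_zero

/-- The right side is thus a function of the 3-form alone, so the arbitrary choice made in `coframe`
affects neither the metric nor its smoothness. -/
theorem formMetric_adapted (c : R7 ≃L[ℝ] R7) (v w : R7) :
    formMetric (phi0.compContinuousLinearMap (c : R7 →L[ℝ] R7)) v w = inner ℝ (c v) (c w) := by
  rw [formMetric, cubicDet_adapted, cubic_adapted]
  set d := LinearMap.det ((c : R7 →L[ℝ] R7) : R7 →ₗ[ℝ] R7)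
  have hd : d ≠ 0 := det_adapted_ne_zero c
  have h : ((d ^ 9) ^ 2) ^ (4 / 9 : ℝ) = d ^ 8 := by
    rw [show (d ^ 9) ^ 2 = (d ^ 2) ^ (9 : ℕ) by ring, ← Real.rpow_natCast, ← Real.rpow_mul (sq_nonneg d)]
    norm_num
    ring
  rw [h]
  field_simp

end G2Flow

end

noncomputable section
namespace G2Flow
open Equiv Finset

/-! ### The constant in `d²⁷₇ = A div j` -/

theorem phi0_eval_left (w : R7) (b c : Fin 7) :
    phi0 ![w, e b, e c] = ∑ l, w l * (phiTable l b c : ℝ) := by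
  conv_lhs => rw [← sum_smul_e w]
  rw [form3_cons, map_sum, ContinuousAlternatingMap.sum_apply]
  refine Finset.sum_congr rfl fun l _ => ?_
  rw [← form3_cons, form3_smul_left, phi0_basis']

/-- Since `φ` has constant coefficients, `d(X ⌟ φ)` is the sum of `∂_k X^l e^k ∧ (e_l ⌟ φ)`. -/
theorem extDeriv_contract_basis (X : R7 → R7) (x : R7) (hX : DifferentiableAt ℝ X x)
    (a b c : Fin 7) :
    extDeriv (fun y => phi0.curryLeft (X y)) x ![e a, e b, e c] =
      ∑ k, ∑ l, fderiv ℝ X x (e k) l * (wedgeZ k l a b c : ℝ) := by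
  have hd : ∀ v, fderiv ℝ (fun y => phi0.curryLeft (X y)) x v = phi0.curryLeft (fderiv ℝ X x v) := by
    intro v
    have h := (phi0.curryLeft.hasFDerivAt (x := X x)).comp x hX.hasFDerivAt
    have h2 := h.fderiv
    rw [show (fun y => phi0.curryLeft (X y)) = ⇑phi0.curryLeft ∘ X from rfl, h2]
    rfl
  have h1 : extDeriv (fun y => phi0.curryLeft (X y)) x ![e a, e b, e c] =
      phi0 ![fderiv ℝ X x (e a), e b, e c] - phi0 ![fderiv ℝ X x (e b), e a, e c]
        + phi0 ![fderiv ℝ X x (e c), e a, e b] := by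
    rw [extDeriv, ContinuousAlternatingMap.alternatizeUncurryFin_apply, Fin.sum_univ_three]
    simp only [hd, form3_cons]
    have r0 : (0 : Fin 3).removeNth ![e a, e b, e c] = ![e b, e c] := by
      funext i; fin_cases i <;> rfl
    have r1 : (1 : Fin 3).removeNth ![e a, e b, e c] = ![e a, e c] := by
      funext i; fin_cases i <;> rfl
    have r2 : (2 : Fin 3).removeNth ![e a, e b, e c] = ![e a, e b] := by
      funext i; fin_cases i <;> rfl
    rw [r0, r1, r2]
    simp [sub_eq_add_neg]
  rw [h1, phi0_eval_left, phi0_eval_left, phi0_eval_left, ← Finset.sum_sub_distrib,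
    ← Finset.sum_add_distrib, Finset.sum_comm]
  refine Finset.sum_congr rfl fun l _ => ?_
  simp only [wedgeZ]
  push_cast
  simp [mul_add, mul_sub, Finset.sum_add_distrib]

theorem inner3_extDeriv (γ : Form3) (hγ : IsLambda27 γ) (X : R7 → R7) (x : R7)
    (hX : DifferentiableAt ℝ X x) :
    inner3 γ (extDeriv (fun y => phi0.curryLeft (X y)) x) =
      ∑ k, ∑ l, (1 / 2) * (jMap γ (e k) (e l) * fderiv ℝ X x (e k) l) := by
  have h : ∀ k l, (1 / 2) * (jMap γ (e k) (e l) * fderiv ℝ X x (e k) l) =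
      (1 / 6) * ∑ a, ∑ b, ∑ c, γ ![e a, e b, e c] *
        (fderiv ℝ X x (e k) l * (wedgeZ k l a b c : ℝ)) := by
    intro k l
    have h1 := lambda27_pairing γ hγ k l
    have : jMap γ (e k) (e l) = (1 / 3) * ∑ a, ∑ b, ∑ c, γ ![e a, e b, e c] *
        (wedgeZ k l a b c : ℝ) := by rw [h1]; ring
    rw [this]
    simp only [Finset.mul_sum, Finset.sum_mul]
    refine Finset.sum_congr rfl fun a _ => Finset.sum_congr rfl fun b _ =>
      Finset.sum_congr rfl fun c _ => ?_
    ring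
  simp only [h, inner3, extDeriv_contract_basis X x hX, ← Finset.mul_sum]
  congr 1
  have comm5 : ∀ F : Fin 7 → Fin 7 → Fin 7 → Fin 7 → Fin 7 → ℝ,
      ∑ a, ∑ b, ∑ c, ∑ k, ∑ l, F a b c k l = ∑ k, ∑ l, ∑ a, ∑ b, ∑ c, F a b c k l := by
    intro F
    have s2 : ∀ G : Fin 7 → Fin 7 → Fin 7 → ℝ, ∑ a, ∑ k, ∑ l, G a k l = ∑ k, ∑ l, ∑ a, G a k l := by
      intro G
      rw [Finset.sum_comm]
      exact Finset.sum_congr rfl fun k _ => Finset.sum_comm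
    calc _ = ∑ a, ∑ b, ∑ k, ∑ l, ∑ c, F a b c k l :=
          Finset.sum_congr rfl fun a _ => Finset.sum_congr rfl fun b _ => s2 _
      _ = ∑ a, ∑ k, ∑ l, ∑ b, ∑ c, F a b c k l := Finset.sum_congr rfl fun a _ => s2 _
      _ = _ := s2 _
  rw [← comm5]
  refine Finset.sum_congr rfl fun a _ => Finset.sum_congr rfl fun b _ =>
    Finset.sum_congr rfl fun c _ => ?_
  simp only [Finset.mul_sum]

theorem contDiff_jMap (γ : R7 → Form3) (hγ : ContDiff ℝ ∞ γ) (v w : R7) :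
    ContDiff ℝ ∞ (fun y => jMap (γ y) v w) := by
  unfold jMap
  refine contDiff_const.mul (ContDiff.sum fun π _ => contDiff_const.mul ?_)
  exact ((ContinuousAlternatingMap.apply ℝ R7 ℝ ![e (π 4), e (π 5), e (π 6)]).contDiff).comp hγ

/-- The factor 1/2 is that of the pairing on `Λ³₂₇`; the sign comes from integrating by parts, where
the compact support of `X` provides all integrability. -/
theorem integral_inner3_extDeriv (γ : R7 → Form3) (hγ : ContDiff ℝ ∞ γ)
    (h27 : ∀ x, IsLambda27 (γ x)) (X : R7 → R7) (hX : ContDiff ℝ ∞ X) (hc : HasCompactSupport X) :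
    ∫ x, inner3 (γ x) (extDeriv (fun y => phi0.curryLeft (X y)) x) =
      (-1 / 2) * ∫ x, divJ γ x (X x) := by
  have hXl : ∀ l, ContDiff ℝ ∞ (fun x => X x l) := fun l => by fun_prop
  have hXc : ∀ l, HasCompactSupport (fun x => X x l) := fun l =>
    hc.comp_left (g := fun v : R7 => v l) rfl
  have hd : ∀ x k l, fderiv ℝ X x (e k) l = fderiv ℝ (fun y => X y l) x (e k) := by
    intro x k l
    have h := ((EuclideanSpace.proj l : R7 →L[ℝ] ℝ).hasFDerivAt (x := X x)).comp x
      (hX.differentiable (by simp) x).hasFDerivAt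
    have h2 := h.fderiv
    rw [show (fun y => X y l) = ⇑(EuclideanSpace.proj l : R7 →L[ℝ] ℝ) ∘ X from rfl, h2]
    rfl
  have hJ := fun k l => contDiff_jMap γ hγ (e k) (e l)
  have cJd : ∀ k l, Continuous (fun x => fderiv ℝ (fun y => jMap (γ y) (e k) (e l)) x (e k)) :=
    fun k l => ((hJ k l).continuous_fderiv (by simp)).clm_apply continuous_const
  have cXd : ∀ k l, Continuous (fun x => fderiv ℝ (fun y => X y l) x (e k)) :=
    fun k l => ((hXl l).continuous_fderiv (by simp)).clm_apply continuous_const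
  have i1 : ∀ k l, Integrable
      (fun x => fderiv ℝ (fun y => jMap (γ y) (e k) (e l)) x (e k) * X x l) := fun k l =>
    ((cJd k l).mul (hXl l).continuous).integrable_of_hasCompactSupport (hXc l).mul_left
  have i2 : ∀ k l, Integrable
      (fun x => jMap (γ x) (e k) (e l) * fderiv ℝ (fun y => X y l) x (e k)) := fun k l =>
    ((hJ k l).continuous.mul (cXd k l)).integrable_of_hasCompactSupport
      (((hXc l).fderiv_apply (𝕜 := ℝ) (e k)).mul_left)
  have i3 : ∀ k l, Integrable (fun x => jMap (γ x) (e k) (e l) * X x l) := fun k l =>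
    ((hJ k l).continuous.mul (hXl l).continuous).integrable_of_hasCompactSupport (hXc l).mul_left
  have hparts : ∀ k l, ∫ x, jMap (γ x) (e k) (e l) * fderiv ℝ (fun y => X y l) x (e k) =
      -∫ x, fderiv ℝ (fun y => jMap (γ y) (e k) (e l)) x (e k) * X x l := fun k l =>
    integral_mul_fderiv_eq_neg_fderiv_mul_of_integrable (i1 k l) (i2 k l) (i3 k l)
      (fun x _ => (hJ k l).differentiable (by simp) x)
      (fun x _ => (hXl l).differentiable (by simp) x)
  have h1 : ∀ x, inner3 (γ x) (extDeriv (fun y => phi0.curryLeft (X y)) x) =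
      ∑ k, ∑ l, (1 / 2) * (jMap (γ x) (e k) (e l) * fderiv ℝ (fun y => X y l) x (e k)) := by
    intro x
    rw [inner3_extDeriv (γ x) (h27 x) X x (hX.differentiable (by simp) x)]
    simp only [hd]
  simp only [h1, divJ]
  rw [integral_finsetSum _ fun k _ => integrable_finsetSum _ fun l _ => (i2 k l).const_mul _,
    integral_finsetSum _ fun k _ => integrable_finsetSum _ fun l _ => i1 k l, Finset.mul_sum]
  refine Finset.sum_congr rfl fun k _ => ?_
  rw [integral_finsetSum _ fun l _ => (i2 k l).const_mul _, integral_finsetSum _ fun l _ => i1 k l,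
    Finset.mul_sum]
  refine Finset.sum_congr rfl fun l _ => ?_
  rw [integral_const_mul, hparts]
  ring

theorem isDivConstant_neg_half : IsDivConstant (-1 / 2) := by
  intro γ hγ h27 X hX hc
  rw [integral_inner3_extDeriv γ hγ h27 X hX hc, integral_const_mul]

/-! ### Uniqueness of the constant, by an explicit element of `Λ³₂₇`. -/

/-- The 6-linear map whose alternatization is `γ ∧ φ`, up to a factor. -/
def sextMap (γ : Form3) : MultilinearMap ℝ (fun _ : Fin 6 => R7) ℝ where
  toFun x := γ ![x 0, x 1, x 2] * phi0 ![x 3, x 4, x 5]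
  map_update_add' := by
    intro inst x i a b
    obtain rfl : inst = instDecidableEqFin 6 := Subsingleton.elim _ _
    fin_cases i <;>
      simp [Function.update, form3_add_left, form3_add_mid, form3_add_right] <;> ring
  map_update_smul' := by
    intro inst x i a b
    obtain rfl : inst = instDecidableEqFin 6 := Subsingleton.elim _ _
    fin_cases i <;>
      simp [Function.update, form3_smul_left, form3_smul_mid, form3_smul_right] <;> ring

/-- An alternating map is determined by its values on distinct basis vectors, and there only
products of components with disjoint index sets occur. -/
theorem wedge_phi0_eq_zero (γ : Form3) (h : ∀ a b c d f g : Fin 7,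
    ({a, b, c} : Finset (Fin 7)) ∩ {d, f, g} = ∅ →
      γ ![e a, e b, e c] * phi0 ![e d, e f, e g] = 0) (v : Fin 6 → R7) :
    ∑ π : Equiv.Perm (Fin 6), ((Equiv.Perm.sign π : ℤ) : ℝ) *
      γ ![v (π 0), v (π 1), v (π 2)] * phi0 ![v (π 3), v (π 4), v (π 5)] = 0 := by
  have h0 : MultilinearMap.alternatization (sextMap γ) = 0 := by
    refine Module.Basis.ext_alternating (EuclideanSpace.basisFun (Fin 7) ℝ).toBasis fun f hf => ?_
    rw [MultilinearMap.alternatization_apply]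
    refine Finset.sum_eq_zero fun π _ => ?_
    have := h (f (π 0)) (f (π 1)) (f (π 2)) (f (π 3)) (f (π 4)) (f (π 5)) (by
      ext z
      simp only [Finset.mem_inter, Finset.mem_insert, Finset.mem_singleton, Finset.notMem_empty,
        iff_false, not_and, not_or]
      rintro (rfl | rfl | rfl) <;> simp [hf.eq_iff, π.injective.eq_iff])
    have hb : ∀ i, (EuclideanSpace.basisFun (Fin 7) ℝ).toBasis i = e i := by
      intro i; simp [e]
    simp only [sextMap, MultilinearMap.domDomCongr_apply, MultilinearMap.coe_mk, hb, this,
      smul_zero]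
  have h1 := DFunLike.congr_fun h0 v
  rw [MultilinearMap.alternatization_apply] at h1
  rw [AlternatingMap.zero_apply] at h1
  rw [← h1]
  refine Finset.sum_congr rfl fun π _ => ?_
  simp [sextMap, Units.smul_def, zsmul_eq_mul, mul_assoc]

/-- An element of `Λ³₂₇`. -/
def gamma0 : Form3 := elem3 0 1 2 - elem3 0 3 4

theorem gamma0_basis (a b c : Fin 7) :
    gamma0 ![e a, e b, e c] = ((elemZ 0 1 2 a b c - elemZ 0 3 4 a b c : ℤ) : ℝ) := by
  simp [gamma0, elem3_basis]

theorem gamma0_support : ∀ a b c : Fin 7, elemZ 0 1 2 a b c - elemZ 0 3 4 a b c ≠ 0 →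
    ({a, b, c} : Finset (Fin 7)) = {0, 1, 2} ∨ ({a, b, c} : Finset (Fin 7)) = {0, 3, 4} := by
  decide +kernel

/-- The index triples of `φ` are the lines of the Fano plane, and any two lines meet. So a
combination of terms of `φ` has zero wedge product with `φ`. -/
theorem phiTable_disjoint : ∀ d f g : Fin 7, phiTable d f g ≠ 0 →
    ({0, 1, 2} : Finset (Fin 7)) ∩ {d, f, g} ≠ ∅ ∧
      ({0, 3, 4} : Finset (Fin 7)) ∩ {d, f, g} ≠ ∅ := by
  decide +kernel

theorem gamma0_phi : ∑ a, ∑ b, ∑ c, (elemZ 0 1 2 a b c - elemZ 0 3 4 a b c) * phiTable a b c = 0 := by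
  decide +kernel

theorem gamma0_wedge : ∑ a, ∑ b, ∑ c, (elemZ 0 1 2 a b c - elemZ 0 3 4 a b c) * wedgeZ 1 1 a b c = 6 := by
  decide +kernel

theorem isLambda27_gamma0 : IsLambda27 gamma0 := by
  constructor
  · refine wedge_phi0_eq_zero gamma0 fun a b c d f g hdis => ?_
    rw [gamma0_basis, phi0_basis']
    by_contra hne
    have h1 : elemZ 0 1 2 a b c - elemZ 0 3 4 a b c ≠ 0 := fun h => hne (by rw [h]; simp)
    have h2 : phiTable d f g ≠ 0 := fun h => hne (by rw [h]; simp)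
    rcases gamma0_support a b c h1 with h | h
    · exact (phiTable_disjoint d f g h2).1 (h ▸ hdis)
    · exact (phiTable_disjoint d f g h2).2 (h ▸ hdis)
  · simp only [inner3, gamma0_basis, phi0_basis']
    have := gamma0_phi
    have h : ((∑ a, ∑ b, ∑ c, (elemZ 0 1 2 a b c - elemZ 0 3 4 a b c) * phiTable a b c : ℤ) : ℝ)
      = 0 := by rw [this]; simp
    push_cast at h ⊢
    rw [h, mul_zero]

theorem jMap_gamma0 : jMap gamma0 (e 1) (e 1) = 2 := by
  have h := lambda27_pairing gamma0 isLambda27_gamma0 1 1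
  simp only [gamma0_basis] at h
  have h2 : ((∑ a, ∑ b, ∑ c, (elemZ 0 1 2 a b c - elemZ 0 3 4 a b c) * wedgeZ 1 1 a b c : ℤ) : ℝ)
      = 6 := by rw [gamma0_wedge]; simp
  push_cast at h h2
  rw [h2] at h
  linarith

theorem isLambda27_smul (a : ℝ) {γ : Form3} (h : IsLambda27 γ) : IsLambda27 (a • γ) := by
  constructor
  · intro v
    have := congrArg (fun t => a * t) (h.1 v)
    simp only [mul_zero, Finset.mul_sum] at this
    rw [← this]
    refine Finset.sum_congr rfl fun π _ => ?_
    simp only [ContinuousAlternatingMap.smul_apply, smul_eq_mul]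
    ring
  · have := congrArg (fun t => a * t) h.2
    simp only [inner3, mul_zero, Finset.mul_sum] at this ⊢
    rw [← this]
    refine Finset.sum_congr rfl fun _ _ => Finset.sum_congr rfl fun _ _ =>
      Finset.sum_congr rfl fun _ _ => ?_
    simp only [ContinuousAlternatingMap.smul_apply, smul_eq_mul]
    ring

theorem jMap_smul_form (a : ℝ) (γ : Form3) (v w : R7) : jMap (a • γ) v w = a * jMap γ v w := by
  simp only [jMap, Finset.mul_sum, ContinuousAlternatingMap.smul_apply, smul_eq_mul]
  exact Finset.sum_congr rfl fun _ _ => by ring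

theorem isDivConstant_unique {A : ℝ} (hA : IsDivConstant A) : A = -1 / 2 := by
  let χ : ContDiffBump (0 : R7) := ⟨1, 2, one_pos, one_lt_two⟩
  -- With this linear coefficient `div j(γ)` is the constant covector `j(gamma0)(e 1, ·)`. Paired
  -- with a bump function times `e 1` it gives `2 χ`, whose integral is positive, so `A` can be
  -- cancelled out.
  let γ : R7 → Form3 := fun x => x 1 • gamma0
  let X : R7 → R7 := fun x => χ x • e 1
  have hγ : ContDiff ℝ ∞ γ := by
    have : ContDiff ℝ ∞ (fun x : R7 => x 1) := by fun_prop
    exact this.smul contDiff_const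
  have hX : ContDiff ℝ ∞ X := χ.contDiff.smul contDiff_const
  have hc : HasCompactSupport X := χ.hasCompactSupport.smul_right
  have h27 : ∀ x, IsLambda27 (γ x) := fun x => isLambda27_smul _ isLambda27_gamma0
  have hdiv : ∀ x, divJ γ x (X x) = 2 * χ x := by
    intro x
    have hfd : ∀ i l, fderiv ℝ (fun y => jMap (γ y) (e i) (e l)) x (e i) =
        (if i = 1 then 1 else 0) * jMap gamma0 (e i) (e l) := by
      intro i l
      have h1 : (fun y : R7 => jMap (γ y) (e i) (e l)) =
          fun y => (jMap gamma0 (e i) (e l)) * (EuclideanSpace.proj 1 : R7 →L[ℝ] ℝ) y := by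
        funext y
        simp only [γ, jMap_smul_form]
        exact mul_comm _ _
      rw [h1, fderiv_const_mul (by fun_prop), ContinuousLinearMap.fderiv]
      change _ * (e i) 1 = _
      rw [← inner_e_left 1 (e i), inner_e_e]
      simp only [eq_comm (a := (1 : Fin 7))]
      ring
    have hXl : ∀ l, X x l = χ x * if l = 1 then 1 else 0 := by
      intro l
      simp only [X, PiLp.smul_apply, smul_eq_mul]
      rw [← inner_e_left l (e 1), inner_e_e]
    simp only [divJ, hfd, hXl]
    rw [Finset.sum_eq_single 1, Finset.sum_eq_single 1] <;> simp +contextual [jMap_gamma0]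
  have h := hA γ hγ h27 X hX hc
  rw [integral_inner3_extDeriv γ hγ h27 X hX hc, integral_const_mul] at h
  have hpos : 0 < ∫ x, divJ γ x (X x) := by
    simp only [hdiv]
    rw [integral_const_mul]
    exact mul_pos two_pos χ.integral_pos
  exact (mul_right_cancel₀ hpos.ne' h).symm

end G2Flow

end

noncomputable section
namespace G2Flow
open Bundle VectorField Filter
open scoped Topology

theorem two_le_infty : (2 : WithTop ℕ∞) ≤ ∞ := WithTop.coe_le_coe.2 le_top

/-! ### Charts: functions, vector fields, brackets -/

variable {M : Type*} [TopologicalSpace M] [ChartedSpace R7 M] [IsManifold (𝓡 7) ∞ M]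

/-- The coordinates of a tangent vector at `y` with respect to the chart at `x`. -/
def toE (x y : M) : T y →L[ℝ] R7 :=
  (trivializationAt R7 (TangentSpace (𝓡 7) : M → Type _) x).continuousLinearMapAt ℝ y

/-- The tangent vector at `y` with given coordinates with respect to the chart at `x`. -/
def ofE (x y : M) : R7 →L[ℝ] T y :=
  (trivializationAt R7 (TangentSpace (𝓡 7) : M → Type _) x).symmL ℝ y

theorem toE_ofE {x y : M} (hy : y ∈ (chartAt R7 x).source) (v : R7) : toE x y (ofE x y v) = v :=
  Trivialization.continuousLinearMapAt_symmL _ hy v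

theorem ofE_toE {x y : M} (hy : y ∈ (chartAt R7 x).source) (v : T y) : ofE x y (toE x y v) = v :=
  Trivialization.symmL_continuousLinearMapAt _ hy v

theorem toE_injective {x y : M} (hy : y ∈ (chartAt R7 x).source) {v w : T y}
    (h : toE x y v = toE x y w) : v = w := by
  rw [← ofE_toE hy v, h, ofE_toE hy]

theorem toE_eq_mfderiv {x y : M} (hy : y ∈ (chartAt R7 x).source) :
    toE x y = mfderiv (𝓡 7) (𝓡 7) (chartAt R7 x) y :=
  TangentBundle.continuousLinearMapAt_trivializationAt hy

theorem ofE_eq_mfderiv {x y : M} (hy : y ∈ (chartAt R7 x).source) :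
    ofE x y = mfderiv (𝓡 7) (𝓡 7) (chartAt R7 x).symm (chartAt R7 x y) := by
  have := TangentBundle.symmL_trivializationAt (I := 𝓡 7) hy
  rw [show Set.range (𝓡 7) = Set.univ from ModelWithCorners.Boundaryless.range_eq_univ,
    mfderivWithin_univ] at this
  exact this

theorem toE_self (x : M) (v : T x) : toE x x v = v := by
  have h : toE x x = _ := TangentBundle.continuousLinearMapAt_trivializationAt (I := 𝓡 7) (mem_chart_source R7 x)
  rw [h, mfderiv_extChartAt_self]
  rfl

theorem contMDiffAt_chart {x y : M} (hy : y ∈ (chartAt R7 x).source) :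
    ContMDiffAt (𝓡 7) (𝓡 7) ∞ (chartAt R7 x) y :=
  contMDiffOn_chart.contMDiffAt ((chartAt R7 x).open_source.mem_nhds hy)

theorem contMDiffAt_chart_symm {x : M} {u : R7} (hu : u ∈ (chartAt R7 x).target) :
    ContMDiffAt (𝓡 7) (𝓡 7) ∞ (chartAt R7 x).symm u :=
  contMDiffOn_chart_symm.contMDiffAt ((chartAt R7 x).open_target.mem_nhds hu)

variable {F : Type*} [NormedAddCommGroup F] [NormedSpace ℝ F]

theorem contMDiffAt_iff_chart {x y : M} (hy : y ∈ (chartAt R7 x).source) (h : M → F) :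
    ContMDiffAt (𝓡 7) 𝓘(ℝ, F) ∞ h y ↔
      ContDiffAt ℝ ∞ (h ∘ (chartAt R7 x).symm) (chartAt R7 x y) := by
  have hu := (chartAt R7 x).map_source hy
  constructor
  · intro H
    rw [← contMDiffAt_iff_contDiffAt]
    refine ContMDiffAt.comp _ ?_ (contMDiffAt_chart_symm hu)
    rwa [(chartAt R7 x).left_inv hy]
  · intro H
    have H2 := ContMDiffAt.comp y (contMDiffAt_iff_contDiffAt.2 H) (contMDiffAt_chart hy)
    refine H2.congr_of_eventuallyEq ?_
    filter_upwards [(chartAt R7 x).open_source.mem_nhds hy] with z hz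
    simp [(chartAt R7 x).left_inv hz]

theorem mdifferentiableAt_iff_chart {x y : M} (hy : y ∈ (chartAt R7 x).source) (h : M → F) :
    MDifferentiableAt (𝓡 7) 𝓘(ℝ, F) h y ↔
      DifferentiableAt ℝ (h ∘ (chartAt R7 x).symm) (chartAt R7 x y) := by
  have hu := (chartAt R7 x).map_source hy
  constructor
  · intro H
    rw [← mdifferentiableAt_iff_differentiableAt]
    refine MDifferentiableAt.comp _ ?_ ((contMDiffAt_chart_symm hu).mdifferentiableAt (by simp))
    rwa [(chartAt R7 x).left_inv hy]
  · intro H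
    have H2 := MDifferentiableAt.comp y (mdifferentiableAt_iff_differentiableAt.2 H)
      ((contMDiffAt_chart hy).mdifferentiableAt (by simp))
    refine H2.congr_of_eventuallyEq ?_
    filter_upwards [(chartAt R7 x).open_source.mem_nhds hy] with z hz
    simp [(chartAt R7 x).left_inv hz]

/-- Differentiability need not be assumed: differentiability of `h` and of its chart expression are
equivalent, and where they fail both derivatives have the default value 0. -/
theorem mvfderiv_chart {x y : M} (hy : y ∈ (chartAt R7 x).source) (h : M → F) (v : T y) :
    mvfderiv (𝓡 7) h y v =
      fderiv ℝ (h ∘ (chartAt R7 x).symm) (chartAt R7 x y) (toE x y v) := by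
  have hu := (chartAt R7 x).map_source hy
  by_cases H : MDifferentiableAt (𝓡 7) 𝓘(ℝ, F) h y
  · have h1 : h =ᶠ[𝓝 y] (h ∘ (chartAt R7 x).symm) ∘ chartAt R7 x := by
      filter_upwards [(chartAt R7 x).open_source.mem_nhds hy] with z hz
      simp [(chartAt R7 x).left_inv hz]
    have h2 : mfderiv (𝓡 7) 𝓘(ℝ, F) h y = (fderiv ℝ (h ∘ (chartAt R7 x).symm) (chartAt R7 x y)).comp
        (toE x y) := by
      rw [h1.mfderiv_eq, mfderiv_comp y
        (mdifferentiableAt_iff_differentiableAt.2 ((mdifferentiableAt_iff_chart hy h).1 H))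
        ((contMDiffAt_chart hy).mdifferentiableAt (by simp)), toE_eq_mfderiv hy, mfderiv_eq_fderiv]
      rfl
    unfold mvfderiv
    rw [h2]
    rfl
  · have H2 := mt (mdifferentiableAt_iff_chart hy h).2 H
    unfold mvfderiv
    rw [mfderiv_zero_of_not_mdifferentiableAt H, fderiv_zero_of_not_differentiableAt H2]
    simp

/-- The coordinate expression of a vector field in the chart at `x`. -/
def loc (x : M) (X : Field M) (u : R7) : R7 :=
  toE x ((chartAt R7 x).symm u) (X ((chartAt R7 x).symm u))

theorem loc_apply {x y : M} (hy : y ∈ (chartAt R7 x).source) (X : Field M) :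
    loc x X (chartAt R7 x y) = toE x y (X y) := by
  unfold loc
  rw [(chartAt R7 x).left_inv hy]

theorem loc_eq_comp {x : M} (X : Field M) :
    loc x X = (fun y => toE x y (X y)) ∘ (chartAt R7 x).symm := rfl

/-- The vector field `X` as a section of the tangent bundle. -/
abbrev sec (X : Field M) : M → TangentBundle (𝓡 7) M := fun y => ⟨y, X y⟩

theorem toE_eventuallyEq {x y : M} (hy : y ∈ (chartAt R7 x).source) (X : Field M) :
    (fun y => (trivializationAt R7 (TangentSpace (𝓡 7) : M → Type _) x ⟨y, X y⟩).2) =ᶠ[𝓝 y]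
      fun y => toE x y (X y) := by
  filter_upwards [(chartAt R7 x).open_source.mem_nhds hy] with z hz
  exact (Trivialization.continuousLinearMapAt_apply_of_mem ℝ _ hz (X z)).symm

theorem contMDiffAt_sec_iff {x y : M} (hy : y ∈ (chartAt R7 x).source) (X : Field M) :
    ContMDiffAt (𝓡 7) ((𝓡 7).prod 𝓘(ℝ, R7)) ∞ (sec X) y ↔
      ContDiffAt ℝ ∞ (loc x X) (chartAt R7 x y) := by
  rw [loc_eq_comp, ← contMDiffAt_iff_chart hy]
  refine (Trivialization.contMDiffAt_section_iff
    (trivializationAt R7 (TangentSpace (𝓡 7) : M → Type _) x) hy).trans ?_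
  exact (toE_eventuallyEq hy X).contMDiffAt_iff

theorem mdifferentiableAt_sec_iff {x y : M} (hy : y ∈ (chartAt R7 x).source) (X : Field M) :
    MDifferentiableAt (𝓡 7) ((𝓡 7).prod 𝓘(ℝ, R7)) (sec X) y ↔
      DifferentiableAt ℝ (loc x X) (chartAt R7 x y) := by
  rw [loc_eq_comp, ← mdifferentiableAt_iff_chart hy]
  refine (Trivialization.mdifferentiableAt_section_iff _
    (trivializationAt R7 (TangentSpace (𝓡 7) : M → Type _) x) X hy).trans ?_
  exact (toE_eventuallyEq hy X).mdifferentiableAt_iff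

theorem SmoothField.contDiffAt_loc (X : SmoothField M) {x : M} {u : R7}
    (hu : u ∈ (chartAt R7 x).target) : ContDiffAt ℝ ∞ (loc x X) u := by
  have hy := (chartAt R7 x).map_target hu
  have := (contMDiffAt_sec_iff hy X).1 (X.contMDiff _)
  rwa [(chartAt R7 x).right_inv hu] at this

/-- The vector field with constant coordinates in the chart at `x`. -/
def constField (x : M) (a : R7) : Field M := fun y => ofE x y a

theorem loc_constField {x : M} (a : R7) {u : R7} (hu : u ∈ (chartAt R7 x).target) :
    loc x (constField x a) u = a :=
  toE_ofE ((chartAt R7 x).map_target hu) a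

theorem loc_constField_eventuallyEq {x : M} (a : R7) {u : R7} (hu : u ∈ (chartAt R7 x).target) :
    loc x (constField x a) =ᶠ[𝓝 u] fun _ => a := by
  filter_upwards [(chartAt R7 x).open_target.mem_nhds hu] with z hz
  exact loc_constField a hz

theorem contMDiffAt_constField {x y : M} (hy : y ∈ (chartAt R7 x).source) (a : R7) :
    ContMDiffAt (𝓡 7) ((𝓡 7).prod 𝓘(ℝ, R7)) ∞ (sec (constField x a)) y := by
  rw [contMDiffAt_sec_iff hy]
  exact contDiffAt_const.congr_of_eventuallyEq
    (loc_constField_eventuallyEq a ((chartAt R7 x).map_source hy))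

theorem contMDiffAt_ext {x : M} (v : T x) :
    ContMDiffAt (𝓡 7) ((𝓡 7).prod 𝓘(ℝ, R7)) ∞ (sec (ext v)) x :=
  FiberBundle.contMDiffAt_extend (𝓡 7) R7 v

theorem ext_self {x : M} (v : T x) : ext v x = v :=
  FiberBundle.extend_apply_self _ v

/-- The bracket commutes with pull-back by the inverse chart, and on a vector space `[V, W] = DW(V)
- DV(W)`. -/
theorem mlieBracket_chart {x y : M} (hy : y ∈ (chartAt R7 x).source) {V W : Field M}
    (hV : MDifferentiableAt (𝓡 7) ((𝓡 7).prod 𝓘(ℝ, R7)) (sec V) y)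
    (hW : MDifferentiableAt (𝓡 7) ((𝓡 7).prod 𝓘(ℝ, R7)) (sec W) y) :
    toE x y (mlieBracket (𝓡 7) V W y) =
      fderiv ℝ (loc x W) (chartAt R7 x y) (toE x y (V y)) -
        fderiv ℝ (loc x V) (chartAt R7 x y) (toE x y (W y)) := by
  have hu := (chartAt R7 x).map_source hy
  have hli := (chartAt R7 x).left_inv hy
  have hpull : ∀ Z : Field M, ∀ u ∈ (chartAt R7 x).target,
      mpullback (𝓡 7) (𝓡 7) (chartAt R7 x).symm Z u = loc x Z u := by
    intro Z u hu
    have hz := (chartAt R7 x).map_target hu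
    have h1 := ofE_eq_mfderiv hz
    rw [(chartAt R7 x).right_inv hu] at h1
    rw [mpullback_apply, ← h1, loc]
    have h2 : (ofE x ((chartAt R7 x).symm u)).inverse = toE x ((chartAt R7 x).symm u) := by
      refine ContinuousLinearMap.inverse_eq ?_ ?_
      · ext v; simp [ofE_toE hz]
      · ext v; simp [toE_ofE hz]
    rw [← h2]
    rfl
  have : IsManifold (𝓡 7) (minSmoothness ℝ 2) M := by
    rw [minSmoothness_of_isRCLikeNormedField]
    exact IsManifold.of_le (n := ∞) (two_le_infty)
  have key := mpullback_mlieBracket (I := 𝓡 7) (I' := 𝓡 7) (f := (chartAt R7 x).symm)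
    (x₀ := chartAt R7 x y) (V := V) (W := W) (n := ∞) (by rwa [hli]) (by rwa [hli])
    (contMDiffAt_chart_symm hu) (by
      rw [minSmoothness_of_isRCLikeNormedField]; exact two_le_infty)
  rw [hpull _ _ hu, loc_apply hy] at key
  rw [key]
  have hE : ∀ Z : Field M, mpullback (𝓡 7) (𝓡 7) (chartAt R7 x).symm Z =ᶠ[𝓝 (chartAt R7 x y)]
      loc x Z := by
    intro Z
    filter_upwards [(chartAt R7 x).open_target.mem_nhds hu] with z hz
    exact hpull Z z hz
  rw [Filter.EventuallyEq.mlieBracket_vectorField_eq (hE V) (hE W)]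
  have h3 := mlieBracketWithin_eq_lieBracketWithin (𝕜 := ℝ) (V := loc x V) (W := loc x W)
    (s := Set.univ)
  rw [lieBracketWithin_univ] at h3
  have h4 := mlieBracketWithin_univ (I := 𝓡 7) (V := loc x V) (W := loc x W)
  refine (congrFun (h4.symm.trans h3) _).trans ?_
  simp only [lieBracket, loc_apply hy]
  rfl

end G2Flow

end

noncomputable section
namespace G2Flow
open Bundle VectorField Filter
open scoped Topology

variable {M : Type*} [TopologicalSpace M] [ChartedSpace R7 M] [IsManifold (𝓡 7) ∞ M]

/-! ### Extension of local vector fields -/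

/-- Smoothness of `σ` and of `∇⁰` is expressed through global smooth fields, while computations use
fields constant in a chart. A bump function passes from one to the other. -/
theorem exists_smoothField_eventuallyEq [T2Space M] {x y : M} (hy : y ∈ (chartAt R7 x).source)
    (Y : Field M) (hY : ContDiffOn ℝ ∞ (loc x Y) (chartAt R7 x).target) :
    ∃ Z : SmoothField M, ∀ᶠ z in 𝓝 y, Z z = Y z := by
  obtain ⟨f, -, hf⟩ := (SmoothBumpFunction.nhds_basis_tsupport (I := 𝓡 7) y).mem_iff.1
    ((chartAt R7 x).open_source.mem_nhds hy)
  have hsm : ContMDiff (𝓡 7) ((𝓡 7).prod 𝓘(ℝ, R7)) ∞ (sec (fun z => f z • Y z)) := by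
    refine ContMDiffOn.smul_section_of_tsupport (u := (chartAt R7 x).source)
      f.contMDiff.contMDiffOn (chartAt R7 x).open_source hf ?_
    intro z hz
    refine ContMDiffAt.contMDiffWithinAt ((contMDiffAt_sec_iff hz Y).2 ?_)
    exact hY.contDiffAt ((chartAt R7 x).open_target.mem_nhds ((chartAt R7 x).map_source hz))
  refine ⟨⟨_, hsm⟩, ?_⟩
  filter_upwards [f.eventuallyEq_one] with z hz
  change f z • Y z = Y z
  rw [hz]
  exact one_smul ℝ (Y z)

theorem exists_smoothField_constField [T2Space M] {x y : M} (hy : y ∈ (chartAt R7 x).source)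
    (a : R7) : ∃ Z : SmoothField M, ∀ᶠ z in 𝓝 y, Z z = constField x a z :=
  exists_smoothField_eventuallyEq hy _
    (contDiffOn_const.congr fun _ hu => loc_constField a hu)

/-! ### Connections in charts -/

/-- The flat connection of the chart at `x`. -/
def chartConnection (x : M) (Y : Field M) (y : M) : T y →L[ℝ] T y :=
  (ofE x y).comp ((fderiv ℝ (loc x Y) (chartAt R7 x y)).comp (toE x y))

theorem isCovariantDerivativeOn_chartConnection (x : M) :
    IsCovariantDerivativeOn R7 (chartConnection x) (chartAt R7 x).source where
  add {Y Z y} hY hZ hy := by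
    rw [mdifferentiableAt_sec_iff hy] at hY hZ
    have h : loc x (Y + Z) = loc x Y + loc x Z := by
      ext1 u; simp [loc]
    ext1 v
    simp only [chartConnection, h, fderiv_add hY hZ, ContinuousLinearMap.comp_apply,
      add_apply, map_add]
  leibniz {Y g y} hY hg hy := by
    rw [mdifferentiableAt_sec_iff hy] at hY
    have hg' := (mdifferentiableAt_iff_chart hy g).1 hg
    have h : loc x (g • Y) = (g ∘ (chartAt R7 x).symm) • loc x Y := by
      ext1 u; simp [loc]
    ext1 v
    simp only [chartConnection, h, fderiv_smul hg' hY, ContinuousLinearMap.comp_apply,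
      add_apply, map_add, smul_apply, map_smul,
      ContinuousLinearMap.smulRight_apply, mvfderiv_chart hy, Function.comp_apply,
      (chartAt R7 x).left_inv hy, loc_apply hy, ofE_toE hy]

/-- The Christoffel symbols of the connection `D` in the chart at `x`; the first argument is the
section, the second one the direction. -/
def christoffel (D : AffineConnection M) (x : M) (u : R7) : R7 →L[ℝ] R7 →L[ℝ] R7 :=
  -- Expansion in the standard basis makes the value continuous linear in the section argument by
  -- construction; `christoffel_apply` recovers the closed form.
  ∑ j, (EuclideanSpace.proj j : R7 →L[ℝ] ℝ).smulRight
    ((toE x ((chartAt R7 x).symm u)).comp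
      ((IsCovariantDerivativeOn.difference D.isCovariantDerivativeOn
        (isCovariantDerivativeOn_chartConnection x) ((chartAt R7 x).symm u)
          (ofE x ((chartAt R7 x).symm u) (e j))).comp (ofE x ((chartAt R7 x).symm u))))

theorem christoffel_apply (D : AffineConnection M) (x : M) (u a b : R7) :
    christoffel D x u a b = toE x ((chartAt R7 x).symm u)
      (IsCovariantDerivativeOn.difference D.isCovariantDerivativeOn
        (isCovariantDerivativeOn_chartConnection x) ((chartAt R7 x).symm u)
          (ofE x ((chartAt R7 x).symm u) a) (ofE x ((chartAt R7 x).symm u) b)) := by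
  conv_rhs => rw [← sum_smul_e a]
  simp only [christoffel, sum_apply, ContinuousLinearMap.smulRight_apply,
    smul_apply, ContinuousLinearMap.comp_apply, map_sum, map_smul]
  rfl

theorem toE_connection (D : AffineConnection M) {x y : M} (hy : y ∈ (chartAt R7 x).source)
    {Y : Field M} (hY : MDifferentiableAt (𝓡 7) ((𝓡 7).prod 𝓘(ℝ, R7)) (sec Y) y) (v : T y) :
    toE x y (D Y y v) = fderiv ℝ (loc x Y) (chartAt R7 x y) (toE x y v) +
      christoffel D x (chartAt R7 x y) (toE x y (Y y)) (toE x y v) := by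
  rw [christoffel_apply, (chartAt R7 x).left_inv hy, ofE_toE hy, ofE_toE hy,
    IsCovariantDerivativeOn.difference_apply _ _ hy hY]
  simp [chartConnection, toE_ofE hy]

theorem christoffel_eq {D : AffineConnection M} {x : M} {u : R7} (hu : u ∈ (chartAt R7 x).target)
    (a b : R7) : christoffel D x u a b = toE x ((chartAt R7 x).symm u)
      (D (constField x a) ((chartAt R7 x).symm u) (ofE x ((chartAt R7 x).symm u) b)) := by
  have hy := (chartAt R7 x).map_target hu
  rw [toE_connection D hy ((contMDiffAt_constField hy a).mdifferentiableAt (by simp)),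
    (chartAt R7 x).right_inv hu, (loc_constField_eventuallyEq a hu).fderiv_eq, toE_ofE hy]
  simp [constField, toE_ofE hy]

/-- Applied to fields constant in the chart, whose bracket vanishes, freedom from torsion says
exactly that the symbols are symmetric. -/
theorem christoffel_symm {D : AffineConnection M} (hD : D.torsion = 0) {x : M} {u : R7}
    (hu : u ∈ (chartAt R7 x).target) (a b : R7) :
    christoffel D x u a b = christoffel D x u b a := by
  have hy := (chartAt R7 x).map_target hu
  have hdiff := fun a => (contMDiffAt_constField hy a).mdifferentiableAt (n := ∞) (by simp)
  have h := (CovariantDerivative.torsion_eq_zero_iff D).1 hD (hdiff b) (hdiff a)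
  have h2 := congrArg (toE x ((chartAt R7 x).symm u)) h
  rw [mlieBracket_chart hy (hdiff b) (hdiff a), (chartAt R7 x).right_inv hu,
    (loc_constField_eventuallyEq a hu).fderiv_eq, (loc_constField_eventuallyEq b hu).fderiv_eq,
    map_sub] at h2
  rw [christoffel_eq hu, christoffel_eq hu, ← sub_eq_zero]
  refine h2.trans ?_
  simp

theorem contDiffOn_christoffel [T2Space M] (D : AffineConnection M)
    (hD : CovariantDerivative.ContMDiffCovariantDerivative D ∞) (x : M) :
    ContDiffOn ℝ ∞ (christoffel D x) (chartAt R7 x).target := by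
  refine contDiffOn_clm_apply.2 fun a => contDiffOn_clm_apply.2 fun b => ?_
  intro u hu
  refine ContDiffAt.contDiffWithinAt ?_
  have hy := (chartAt R7 x).map_target hu
  obtain ⟨Z, hZ⟩ := exists_smoothField_constField hy a
  have h1 := hD.contMDiff.contMDiff (σ := Z) (Z.contMDiff.of_le (by simp)).contMDiffOn
  have h2 : ContMDiffAt (𝓡 7) ((𝓡 7).prod 𝓘(ℝ, R7)) ∞
      (sec (fun z => D Z z (constField x b z))) ((chartAt R7 x).symm u) :=
    ContMDiffAt.clm_bundle_apply (contMDiffOn_univ.1 h1 _) (contMDiffAt_constField hy b)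
  rw [contMDiffAt_sec_iff hy, (chartAt R7 x).right_inv hu] at h2
  refine h2.congr_of_eventuallyEq ?_
  have hc := (chartAt R7 x).continuousAt_symm hu
  filter_upwards [(chartAt R7 x).open_target.mem_nhds hu, hc.eventually hZ.eventually_nhds]
    with w hw hZw
  have hyw := (chartAt R7 x).map_target hw
  rw [christoffel_eq hw]
  simp only [loc]
  -- Locality of `D`: the global extension `Z` and the constant field agree near each nearby point,
  -- hence have the same covariant derivative there.
  rw [D.isCovariantDerivativeOn.congr_of_eventuallyEq (s := Set.univ)
    (Z.contMDiff.mdifferentiableAt (by simp))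
    ((contMDiffAt_constField hyw a).mdifferentiableAt (n := ∞) (by simp)) univ_mem hZw]
  rfl

theorem difference_eq (D D' : AffineConnection M) {x y : M} (hy : y ∈ (chartAt R7 x).source)
    (v w : T y) : toE x y (D.difference D' y w v) =
      christoffel D x (chartAt R7 x y) (toE x y w) (toE x y v) -
        christoffel D' x (chartAt R7 x y) (toE x y w) (toE x y v) := by
  have hd := (contMDiffAt_ext w).mdifferentiableAt (n := ∞) (by simp)
  have h := IsCovariantDerivativeOn.difference_apply D.isCovariantDerivativeOn
    D'.isCovariantDerivativeOn (s := Set.univ) (by trivial) hd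
  rw [ext_self] at h
  change toE x y (IsCovariantDerivativeOn.difference D.isCovariantDerivativeOn
    D'.isCovariantDerivativeOn y w v) = _
  rw [h, sub_apply, map_sub, toE_connection D hy hd, toE_connection D' hy hd,
    ext_self]
  abel

end G2Flow

end

noncomputable section
namespace G2Flow
open Bundle VectorField Filter
open scoped Topology

/-! ### Traces with respect to an inner product -/

variable {F : Type*} [NormedAddCommGroup F] [NormedSpace ℝ F]

/-- Bilinear forms on `ℝ⁷`. -/
abbrev Bil : Type := R7 →L[ℝ] R7 →L[ℝ] ℝ

/-- The Gram matrix of a bilinear form in the standard basis. -/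
def gram (g : Bil) : Matrix (Fin 7) (Fin 7) ℝ := Matrix.of fun j k => g (e j) (e k)

/-- The trace of a bilinear map with respect to a nondegenerate bilinear form. -/
def trG (g : Bil) (B : R7 →L[ℝ] R7 →L[ℝ] F) : F :=
  ∑ j, ∑ k, (gram g)⁻¹ j k • B (e j) (e k)

/-- The pull-back of the Euclidean inner product. -/
def pullInner (c : R7 →L[ℝ] R7) : Bil := (innerSL ℝ).bilinearComp c c

theorem pullInner_apply (c : R7 →L[ℝ] R7) (v w : R7) :
    pullInner c v w = inner ℝ (c v) (c w) := rfl

theorem pullInner_symm (c : R7 →L[ℝ] R7) (v w : R7) : pullInner c v w = pullInner c w v :=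
  (real_inner_comm (c v) (c w)).symm

theorem sum_pullInner_smul (c : R7 ≃L[ℝ] R7) (v : R7) :
    ∑ i, pullInner (c : R7 →L[ℝ] R7) v (c.symm (e i)) • c.symm (e i) = v := by
  have h : ∀ i, pullInner (c : R7 →L[ℝ] R7) v (c.symm (e i)) = c v i := by
    intro i
    rw [pullInner_symm, pullInner_apply]
    simp [inner_e_left]
  simp only [h, ← map_smul, ← map_sum, sum_smul_e]
  simp

theorem pullInner_injective (c : R7 ≃L[ℝ] R7) {v w : R7}
    (h : ∀ z, pullInner (c : R7 →L[ℝ] R7) v z = pullInner (c : R7 →L[ℝ] R7) w z) : v = w := by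
  rw [← sum_pullInner_smul c v, ← sum_pullInner_smul c w]
  simp only [h]

/-- This is the expansion of `e j` in the orthonormal frame `c.symm (e i)`, read in coordinates. -/
theorem gram_pullInner_mul (c : R7 ≃L[ℝ] R7) :
    gram (pullInner (c : R7 →L[ℝ] R7)) *
      (Matrix.of fun j k => ∑ i, c.symm (e i) j * c.symm (e i) k) = 1 := by
  ext j k
  have h := congrArg (fun v : R7 => v k) (sum_pullInner_smul c (e j))
  simp only [WithLp.ofLp_sum, Finset.sum_apply, PiLp.smul_apply, smul_eq_mul] at h
  have h2 : (e j : R7) k = (1 : Matrix (Fin 7) (Fin 7) ℝ) j k := by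
    simp [e, Matrix.one_apply, eq_comm]
  rw [← h2, ← h, Matrix.mul_apply]
  simp only [Matrix.of_apply, gram, Finset.mul_sum]
  rw [Finset.sum_comm]
  refine Finset.sum_congr rfl fun i _ => ?_
  conv_rhs => rw [← sum_smul_e (c.symm (e i))]
  simp only [map_sum, map_smul, smul_eq_mul, Finset.sum_mul]
  refine Finset.sum_congr rfl fun l _ => ?_
  have h3 : (∑ x, c.symm (e i) x • e x) k = c.symm (e i) k := by rw [sum_smul_e]
  rw [h3]
  ring

theorem inv_gram_pullInner (c : R7 ≃L[ℝ] R7) :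
    (gram (pullInner (c : R7 →L[ℝ] R7)))⁻¹ =
      Matrix.of fun j k => ∑ i, c.symm (e i) j * c.symm (e i) k :=
  Matrix.inv_eq_right_inv (gram_pullInner_mul c)

theorem isUnit_det_gram_pullInner (c : R7 ≃L[ℝ] R7) :
    IsUnit (gram (pullInner (c : R7 →L[ℝ] R7))).det :=
  Matrix.isUnit_det_of_right_inverse (gram_pullInner_mul c)

/-- Links two forms of the trace. The definitions use orthonormal frames, chosen pointwise without
continuity; the inverse Gram matrix depends smoothly on the metric, so it is used for
differentiation. -/
theorem trG_pullInner (c : R7 ≃L[ℝ] R7) (B : R7 →L[ℝ] R7 →L[ℝ] F) :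
    trG (pullInner (c : R7 →L[ℝ] R7)) B = ∑ i, B (c.symm (e i)) (c.symm (e i)) := by
  simp only [trG, inv_gram_pullInner, Matrix.of_apply, Finset.sum_smul]
  have h : ∀ i, B (c.symm (e i)) (c.symm (e i)) =
      ∑ j, ∑ k, (c.symm (e i) j * c.symm (e i) k) • B (e j) (e k) := by
    intro i
    conv_lhs => rw [← sum_smul_e (c.symm (e i))]
    simp only [map_sum, sum_apply, map_smul, smul_apply, Finset.smul_sum, smul_smul]
    rw [Finset.sum_comm]
    refine Finset.sum_congr rfl fun j _ => Finset.sum_congr rfl fun k _ => ?_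
    rw [mul_comm]
  simp only [h]
  conv_rhs => rw [Finset.sum_comm]
  refine Finset.sum_congr rfl fun j _ => ?_
  rw [Finset.sum_comm]

/-- An isometry `A` carries orthonormal frames to orthonormal frames. -/
theorem trG_comp (c c' A : R7 ≃L[ℝ] R7)
    (h : ∀ v w, pullInner (c' : R7 →L[ℝ] R7) (A v) (A w) = pullInner (c : R7 →L[ℝ] R7) v w)
    (B : R7 →L[ℝ] R7 →L[ℝ] F) :
    trG (pullInner (c' : R7 →L[ℝ] R7)) B =
      trG (pullInner (c : R7 →L[ℝ] R7)) (B.bilinearComp (A : R7 →L[ℝ] R7) (A : R7 →L[ℝ] R7)) := by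
  have h1 : pullInner (c : R7 →L[ℝ] R7) = pullInner ((A.trans c' : R7 ≃L[ℝ] R7) : R7 →L[ℝ] R7) := by
    ext v w
    rw [← h]
    rfl
  rw [h1, trG_pullInner, trG_pullInner]
  refine Finset.sum_congr rfl fun i _ => ?_
  simp

theorem contDiffOn_det {E : Type*} [NormedAddCommGroup E] [NormedSpace ℝ E] {n : Type*} [Fintype n]
    [DecidableEq n] {s : Set E} {A : E → Matrix n n ℝ}
    (hA : ∀ i j, ContDiffOn ℝ ∞ (fun u => A u i j) s) :
    ContDiffOn ℝ ∞ (fun u => (A u).det) s := by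
  simp only [Matrix.det_apply]
  refine ContDiffOn.sum fun σ _ => ContDiffOn.const_smul _ ?_
  exact contDiffOn_prod fun i _ => hA _ _

theorem contDiffOn_inv_gram {s : Set R7} {g : R7 → Bil} (hg : ContDiffOn ℝ ∞ g s)
    (h : ∀ u ∈ s, IsUnit (gram (g u)).det) (j k : Fin 7) :
    ContDiffOn ℝ ∞ (fun u => (gram (g u))⁻¹ j k) s := by
  have hA : ∀ i j, ContDiffOn ℝ ∞ (fun u => gram (g u) i j) s := fun i j =>
    (hg.clm_apply contDiffOn_const).clm_apply contDiffOn_const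
  simp only [Matrix.inv_def, Matrix.smul_apply, Ring.inverse_eq_inv', smul_eq_mul,
    Matrix.adjugate_apply]
  refine ((contDiffOn_det hA).inv fun u hu => (h u hu).ne_zero).mul (contDiffOn_det ?_)
  intro a b
  by_cases hak : a = k
  · subst hak
    simp only [Matrix.updateRow_self]
    exact contDiffOn_const
  · simp only [Matrix.updateRow_ne hak]
    exact hA a b

theorem contDiffOn_trG {s : Set R7} {g : R7 → Bil} (hg : ContDiffOn ℝ ∞ g s)
    (h : ∀ u ∈ s, IsUnit (gram (g u)).det) {B : R7 → R7 →L[ℝ] R7 →L[ℝ] F}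
    (hB : ContDiffOn ℝ ∞ B s) : ContDiffOn ℝ ∞ (fun u => trG (g u) (B u)) s :=
  ContDiffOn.sum fun j _ => ContDiffOn.sum fun k _ => (contDiffOn_inv_gram hg h j k).smul
    ((hB.clm_apply contDiffOn_const).clm_apply contDiffOn_const)

theorem trG_add (g : Bil) (B C : R7 →L[ℝ] R7 →L[ℝ] F) : trG g (B + C) = trG g B + trG g C := by
  simp [trG, Finset.sum_add_distrib]

theorem trG_smul (g : Bil) (r : ℝ) (B : R7 →L[ℝ] R7 →L[ℝ] F) : trG g (r • B) = r • trG g B := by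
  simp only [trG, Finset.smul_sum, smul_apply]
  refine Finset.sum_congr rfl fun j _ => Finset.sum_congr rfl fun k _ => ?_
  rw [smul_comm]

theorem trG_map {F' : Type*} [NormedAddCommGroup F'] [NormedSpace ℝ F'] (g : Bil)
    (B : R7 →L[ℝ] R7 →L[ℝ] F) (L : F →L[ℝ] F') :
    L (trG g B) = ∑ j, ∑ k, (gram g)⁻¹ j k • L (B (e j) (e k)) := by
  simp [trG]

end G2Flow

end

noncomputable section
namespace G2Flow
open Bundle VectorField Filter
open scoped Topology

variable {M : Type*} [TopologicalSpace M] [ChartedSpace R7 M] [IsManifold (𝓡 7) ∞ M]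

/-! ### The metric in charts -/

/-- The chart at `x` identifies `ℝ⁷` with the tangent space at `y`. -/
def chartEquiv {x y : M} (hy : y ∈ (chartAt R7 x).source) : R7 ≃L[ℝ] T y :=
  ContinuousLinearEquiv.equivOfInverse (ofE x y) (toE x y) (toE_ofE hy) (ofE_toE hy)

/-- An adapted coframe in the chart at `x`. -/
def locCoframe (σ : ThreeFormField M) {x : M} {u : R7} (hu : u ∈ (chartAt R7 x).target) :
    R7 ≃L[ℝ] R7 :=
  (chartEquiv ((chartAt R7 x).map_target hu)).trans (coframe (σ ((chartAt R7 x).symm u)))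

/-- The metric in the chart at `x`. -/
def locMetric (σ : ThreeFormField M) (x : M) (u : R7) : Bil :=
  pullInner ((coframe (σ ((chartAt R7 x).symm u)) : T ((chartAt R7 x).symm u) →L[ℝ] R7).comp
    (ofE x ((chartAt R7 x).symm u)))

theorem locMetric_eq_pullInner (σ : ThreeFormField M) {x : M} {u : R7}
    (hu : u ∈ (chartAt R7 x).target) :
    locMetric σ x u = pullInner (locCoframe σ hu : R7 →L[ℝ] R7) := rfl

theorem locMetric_apply (σ : ThreeFormField M) (x : M) (u a b : R7) :
    locMetric σ x u a b = metric σ ((chartAt R7 x).symm u) (ofE x ((chartAt R7 x).symm u) a)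
      (ofE x ((chartAt R7 x).symm u) b) := rfl

theorem metric_eq_locMetric (σ : ThreeFormField M) {x y : M} (hy : y ∈ (chartAt R7 x).source)
    (v w : T y) : metric σ y v w = locMetric σ x (chartAt R7 x y) (toE x y v) (toE x y w) := by
  rw [locMetric_apply, (chartAt R7 x).left_inv hy, ofE_toE hy, ofE_toE hy]

theorem locMetric_symm (σ : ThreeFormField M) (x : M) (u a b : R7) :
    locMetric σ x u a b = locMetric σ x u b a := pullInner_symm _ _ _

theorem isUnit_det_gram_locMetric (σ : ThreeFormField M) {x : M} {u : R7}
    (hu : u ∈ (chartAt R7 x).target) : IsUnit (gram (locMetric σ x u)).det := by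
  rw [locMetric_eq_pullInner σ hu]
  exact isUnit_det_gram_pullInner _

theorem locCoframe_symm (σ : ThreeFormField M) {x y : M} (hy : y ∈ (chartAt R7 x).source)
    (i : Fin 7) : (locCoframe σ ((chartAt R7 x).map_source hy)).symm (e i) =
      toE x y (frame σ y i) := by
  -- The point obtained by applying the chart and its inverse equals `y` only propositionally, so
  -- the base point is generalized before substitution.
  have : ∀ z (hz : z ∈ (chartAt R7 x).source), z = y →
      (chartEquiv hz).symm ((coframe (σ z)).symm (e i)) = toE x y (frame σ y i) := by
    rintro z hz rfl
    rfl
  exact this _ ((chartAt R7 x).map_target ((chartAt R7 x).map_source hy))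
    ((chartAt R7 x).left_inv hy)

variable {F : Type*} [NormedAddCommGroup F] [NormedSpace ℝ F]

theorem sum_frame (σ : ThreeFormField M) {x y : M} (hy : y ∈ (chartAt R7 x).source)
    (B : R7 →L[ℝ] R7 →L[ℝ] F) :
    ∑ i, B (toE x y (frame σ y i)) (toE x y (frame σ y i)) =
      trG (locMetric σ x (chartAt R7 x y)) B := by
  rw [locMetric_eq_pullInner σ ((chartAt R7 x).map_source hy), trG_pullInner]
  simp only [locCoframe_symm σ hy]

/-! ### Smoothness of the metric -/

/-- The 3-form `σ` in the chart at `x`. -/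
def locForm (σ : ThreeFormField M) (x : M) (u : R7) : Form3 :=
  (σ ((chartAt R7 x).symm u)).compContinuousLinearMap (ofE x ((chartAt R7 x).symm u))

theorem contDiffOn_locForm [T2Space M] {σ : ThreeFormField M} (hσ : IsG2Structure σ) (x : M)
    (a b c : R7) : ContDiffOn ℝ ∞ (fun u => locForm σ x u ![a, b, c]) (chartAt R7 x).target := by
  intro u hu
  refine ContDiffAt.contDiffWithinAt ?_
  have hy := (chartAt R7 x).map_target hu
  obtain ⟨X, hX⟩ := exists_smoothField_constField hy a
  obtain ⟨Y, hY⟩ := exists_smoothField_constField hy b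
  obtain ⟨Z, hZ⟩ := exists_smoothField_constField hy c
  have h := (contMDiffAt_iff_chart hy _).1 (hσ.smooth X Y Z _)
  rw [(chartAt R7 x).right_inv hu] at h
  refine h.congr_of_eventuallyEq ?_
  have hc := (chartAt R7 x).continuousAt_symm hu
  filter_upwards [hc.eventually hX, hc.eventually hY, hc.eventually hZ] with w h1 h2 h3
  simp only [Function.comp_apply, h1, h2, h3, locForm]
  rw [ContinuousAlternatingMap.compContinuousLinearMap_apply]
  congr 1
  ext i
  fin_cases i <;> rfl

theorem contDiffOn_cubic {E : Type*} [NormedAddCommGroup E] [NormedSpace ℝ E] {s : Set E}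
    {η : E → Form3} (hη : ∀ a b c, ContDiffOn ℝ ∞ (fun u => η u ![a, b, c]) s) (v w : R7) :
    ContDiffOn ℝ ∞ (fun u => cubic (η u) v w) s := by
  refine contDiffOn_const.mul (ContDiffOn.sum fun ρ _ => contDiffOn_const.mul ?_)
  exact ((hη _ _ _).mul (hη _ _ _)).mul (hη _ _ _)

theorem contDiffOn_formMetric {E : Type*} [NormedAddCommGroup E] [NormedSpace ℝ E] {s : Set E}
    {η : E → Form3} (hη : ∀ a b c, ContDiffOn ℝ ∞ (fun u => η u ![a, b, c]) s)
    (h0 : ∀ u ∈ s, cubicDet (η u) ≠ 0) (v w : R7) :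
    ContDiffOn ℝ ∞ (fun u => formMetric (η u) v w) s := by
  have hD : ContDiffOn ℝ ∞ (fun u => cubicDet (η u)) s :=
    contDiffOn_det fun i j => (contDiffOn_cubic hη _ _).div_const 6
  refine ((contDiffOn_cubic hη v w).div_const 6).mul (ContDiffOn.div ?_ hD h0)
  exact (hD.pow 2).rpow_const_of_ne fun u hu => pow_ne_zero 2 (h0 u hu)

theorem IsAdapted.coframe {x : M} {τ : T x [⋀^Fin 3]→L[ℝ] ℝ}
    (h : ∃ u : T x ≃L[ℝ] R7, IsAdapted τ u) : IsAdapted τ (coframe τ) := by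
  have h2 : G2Flow.coframe τ = h.choose := dif_pos h
  rw [h2]
  exact h.choose_spec

theorem locForm_eq {σ : ThreeFormField M} (hσ : IsG2Structure σ) {x : M} {u : R7}
    (hu : u ∈ (chartAt R7 x).target) :
    locForm σ x u = phi0.compContinuousLinearMap (locCoframe σ hu : R7 →L[ℝ] R7) := by
  have h := IsAdapted.coframe (hσ.definite ((chartAt R7 x).symm u))
  unfold IsAdapted at h
  rw [locForm, ← h]
  rfl

theorem locMetric_eq_formMetric {σ : ThreeFormField M} (hσ : IsG2Structure σ) {x : M} {u : R7}
    (hu : u ∈ (chartAt R7 x).target) (a b : R7) :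
    locMetric σ x u a b = formMetric (locForm σ x u) a b := by
  rw [locForm_eq hσ hu, formMetric_adapted, locMetric_eq_pullInner σ hu, pullInner_apply]
  rfl

theorem contDiffOn_locMetric [T2Space M] {σ : ThreeFormField M} (hσ : IsG2Structure σ) (x : M) :
    ContDiffOn ℝ ∞ (locMetric σ x) (chartAt R7 x).target := by
  refine contDiffOn_clm_apply.2 fun a => contDiffOn_clm_apply.2 fun b => ?_
  refine (contDiffOn_formMetric (contDiffOn_locForm hσ x) ?_ a b).congr fun u hu =>
    locMetric_eq_formMetric hσ hu a b
  intro u hu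
  rw [locForm_eq hσ hu, cubicDet_adapted]
  exact pow_ne_zero _ (det_adapted_ne_zero _)

/-! ### Naturality of the metric -/

/-- Any adapted coframe computes the same metric, because `formMetric` sees only the 3-form. This is
what makes the metric natural under diffeomorphisms. -/
theorem metric_eq_of_adapted {σ : ThreeFormField M} {x : M} {u : T x ≃L[ℝ] R7}
    (hu : IsAdapted (σ x) u) (v w : T x) : metric σ x v w = inner ℝ (u v) (u w) := by
  have h := IsAdapted.coframe ⟨u, hu⟩
  have hx := mem_chart_source R7 x
  have key : ∀ c : T x ≃L[ℝ] R7, IsAdapted (σ x) c → inner ℝ (c v) (c w) =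
      formMetric ((σ x).compContinuousLinearMap (ofE x x)) (toE x x v) (toE x x w) := by
    intro c hc
    unfold IsAdapted at hc
    have h2 : (σ x).compContinuousLinearMap (ofE x x) =
        phi0.compContinuousLinearMap (((chartEquiv hx).trans c : R7 ≃L[ℝ] R7) : R7 →L[ℝ] R7) := by
      rw [← hc]
      rfl
    rw [h2, formMetric_adapted]
    change _ = inner ℝ (c (ofE x x (toE x x v))) (c (ofE x x (toE x x w)))
    rw [ofE_toE hx, ofE_toE hx]
  rw [metric, key _ h, key _ hu]

theorem mfderiv_symm_mfderiv (f : Diffeo M) (x : M) (v : T x) :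
    mfderiv (𝓡 7) (𝓡 7) f.symm (f x) (mfderiv (𝓡 7) (𝓡 7) f x v) = v := by
  have h := mfderiv_comp x (f.symm.contMDiff.mdifferentiableAt (by simp))
    (f.contMDiff.mdifferentiableAt (x := x) (by simp))
  have h2 : f.symm ∘ f = id := by ext z; simp
  rw [h2, mfderiv_id] at h
  exact (congrArg (fun L : T x →L[ℝ] T x => L v) h).symm

theorem pushForm_adapted {σ : ThreeFormField M} (f : Diffeo M) {y : M}
    (c : T (f.symm y) ≃L[ℝ] R7) (hc : IsAdapted (σ (f.symm y)) c) :
    ∃ c' : T y ≃L[ℝ] R7, IsAdapted (pushForm f σ y) c' ∧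
      ∀ v, c' v = c (mfderiv (𝓡 7) (𝓡 7) f.symm y v) := by
  refine ⟨(f.symm.mfderivToContinuousLinearEquiv (by simp) y).trans c, ?_, fun v => rfl⟩
  unfold IsAdapted at hc ⊢
  rw [pushForm, ← hc]
  rfl

theorem metric_pushForm {σ : ThreeFormField M} (hσ : IsG2Structure σ) (f : Diffeo M) (x : M)
    (v w : T x) : metric (pushForm f σ) (f x) (mfderiv (𝓡 7) (𝓡 7) f x v)
      (mfderiv (𝓡 7) (𝓡 7) f x w) = metric σ x v w := by
  obtain ⟨c, hc⟩ := hσ.definite (f.symm (f x))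
  obtain ⟨c', hc', h⟩ := pushForm_adapted f c hc
  rw [metric_eq_of_adapted hc', h, h, ← metric_eq_of_adapted hc, mfderiv_symm_mfderiv,
    mfderiv_symm_mfderiv]
  have : ∀ z, z = x → metric σ z v w = metric σ x v w := by
    rintro z rfl; rfl
  exact this _ (by simp)

theorem IsG2Structure.pushForm {σ : ThreeFormField M} (hσ : IsG2Structure σ) (f : Diffeo M) :
    IsG2Structure (pushForm f σ) where
  definite y := by
    obtain ⟨c, hc⟩ := hσ.definite (f.symm y)
    obtain ⟨c', hc', -⟩ := pushForm_adapted f c hc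
    exact ⟨c', hc'⟩
  smooth X Y Z := by
    -- The pushed-forward form on `X`, `Y`, `Z` is `σ` on their pull-backs, composed with `f.symm`;
    -- the pull-backs are again global smooth fields.
    have hpull : ∀ X : SmoothField M, ∃ X' : SmoothField M, ∀ x,
        X' x = mfderiv (𝓡 7) (𝓡 7) f.symm (f x) (X (f x)) := by
      intro X
      have h := ContMDiff.mpullback_vectorField (I := 𝓡 7) (I' := 𝓡 7) (f := f) (V := X)
        (m := ∞) (n := ∞) X.contMDiff f.contMDiff
        (fun x => ⟨f.mfderivToContinuousLinearEquiv (by simp) x, rfl⟩) (by simp)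
      refine ⟨⟨_, h⟩, fun x => ?_⟩
      change mpullback (𝓡 7) (𝓡 7) f X x = _
      rw [mpullback_apply]
      have h2 : (mfderiv (𝓡 7) (𝓡 7) f x).inverse = mfderiv (𝓡 7) (𝓡 7) f.symm (f x) := by
        have h3 : mfderiv (𝓡 7) (𝓡 7) f x = f.mfderivToContinuousLinearEquiv (by simp) x := rfl
        refine ContinuousLinearMap.ext fun w => ?_
        obtain ⟨v, rfl⟩ := (f.mfderivToContinuousLinearEquiv (by simp) x).surjective w
        rw [h3, ContinuousLinearMap.inverse_equiv]
        refine Eq.trans ?_ (mfderiv_symm_mfderiv f x v).symm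
        simp
      rw [h2]
      rfl
    obtain ⟨X', hX'⟩ := hpull X
    obtain ⟨Y', hY'⟩ := hpull Y
    obtain ⟨Z', hZ'⟩ := hpull Z
    have h := (hσ.smooth X' Y' Z').comp f.symm.contMDiff
    refine h.congr fun y => ?_
    simp only [Function.comp_apply, G2Flow.pushForm, hX', hY', hZ']
    rw [ContinuousAlternatingMap.compContinuousLinearMap_apply]
    congr 1
    ext i
    have h4 : ∀ (W : SmoothField M) (z : M), z = y →
        @Eq R7 (mfderiv (𝓡 7) (𝓡 7) f.symm y (W y)) (mfderiv (𝓡 7) (𝓡 7) f.symm z (W z)) := by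
      rintro W z rfl
      rfl
    have h5 : f (f.symm y) = y := by simp
    fin_cases i
    exacts [h4 X _ h5, h4 Y _ h5, h4 Z _ h5]

end G2Flow

end

noncomputable section
namespace G2Flow
open Bundle VectorField Filter
open scoped Topology

/-! ### Christoffel symbols on open subsets of `ℝ⁷` -/

instance instNormedAddCommGroupBil : NormedAddCommGroup Bil :=
  ContinuousLinearMap.toNormedAddCommGroup

instance instNormedSpaceBil : NormedSpace ℝ Bil := ContinuousLinearMap.toNormedSpace

/-- The right hand side of the Koszul formula in coordinates. -/
def koszulForm (g : R7 → Bil) (u a b : R7) : R7 →L[ℝ] ℝ :=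
  (1 / 2 : ℝ) • (fderiv ℝ g u a b + fderiv ℝ g u b a - ((fderiv ℝ g u).flip a).flip b)

theorem koszulForm_apply (g : R7 → Bil) (u a b w : R7) : koszulForm g u a b w =
    1 / 2 * (fderiv ℝ g u a b w + fderiv ℝ g u b a w - fderiv ℝ g u w a b) := by
  simp [koszulForm]

/-- The Christoffel symbols of the metric `g` on an open subset of `ℝ⁷`. -/
def koszulMap (g : R7 → Bil) (u : R7) : R7 →L[ℝ] R7 →L[ℝ] R7 :=
  (LinearMap.mk₂ ℝ (fun a b => trG (g u)
      ((koszulForm g u a b).smulRight (ContinuousLinearMap.id ℝ R7)))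
    (fun a a' b => by
      rw [← trG_add]; congr 1; ext w z : 2
      simp only [add_apply, ContinuousLinearMap.smulRight_apply, koszulForm_apply, map_add,
        smul_apply, ← add_smul]
      congr 1; ring)
    (fun r a b => by
      rw [← trG_smul]; congr 1; ext w z : 2
      simp only [ContinuousLinearMap.smulRight_apply, koszulForm_apply, map_smul,
        smul_apply, smul_smul, smul_eq_mul]
      congr 1; ring)
    (fun a b b' => by
      rw [← trG_add]; congr 1; ext w z : 2
      simp only [add_apply, ContinuousLinearMap.smulRight_apply, koszulForm_apply, map_add,
        smul_apply, ← add_smul]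
      congr 1; ring)
    (fun r a b => by
      rw [← trG_smul]; congr 1; ext w z : 2
      simp only [ContinuousLinearMap.smulRight_apply, koszulForm_apply, map_smul,
        smul_apply, smul_smul, smul_eq_mul]
      congr 1; ring)).toContinuousBilinearMap

theorem koszulMap_apply (g : R7 → Bil) (u a b : R7) : koszulMap g u a b =
    trG (g u) ((koszulForm g u a b).smulRight (ContinuousLinearMap.id ℝ R7)) := rfl

/-- `koszulMap` raises an index of `koszulForm`; lowering it again with the same inner product
undoes this. -/
theorem inner_koszulMap {g : R7 → Bil} {u : R7} {c : R7 ≃L[ℝ] R7}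
    (hc : g u = pullInner (c : R7 →L[ℝ] R7)) (a b w : R7) :
    g u (koszulMap g u a b) w = koszulForm g u a b w := by
  rw [koszulMap_apply, hc, trG_pullInner, map_sum, sum_apply]
  conv_rhs => rw [← sum_pullInner_smul c w, map_sum]
  refine Finset.sum_congr rfl fun i _ => ?_
  simp only [ContinuousLinearMap.smulRight_apply, smul_apply, ContinuousLinearMap.id_apply,
    map_smul, smul_eq_mul]
  rw [pullInner_symm, mul_comm]

theorem fderiv_metric_symm {g : R7 → Bil} {u : R7} (hg : DifferentiableAt ℝ g u)
    (hs : ∀ᶠ w in 𝓝 u, ∀ a b, g w a b = g w b a) (v a b : R7) :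
    fderiv ℝ g u v a b = fderiv ℝ g u v b a := by
  have h1 : ∀ a b, fderiv ℝ (fun w => g w a b) u v = fderiv ℝ g u v a b := by
    intro a b
    have h := (hg.hasFDerivAt.clm_apply (hasFDerivAt_const a u)).clm_apply (hasFDerivAt_const b u)
    rw [h.fderiv]
    simp
  rw [← h1, ← h1]
  have h2 : (fun w => g w a b) =ᶠ[𝓝 u] fun w => g w b a := by
    filter_upwards [hs] with w hw using hw a b
  rw [h2.fderiv_eq]

theorem koszulMap_symm {g : R7 → Bil} {u : R7} (hg : DifferentiableAt ℝ g u)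
    (hs : ∀ᶠ w in 𝓝 u, ∀ a b, g w a b = g w b a) (a b : R7) :
    koszulMap g u a b = koszulMap g u b a := by
  rw [koszulMap_apply, koszulMap_apply]
  congr 2
  ext w
  rw [koszulForm_apply, koszulForm_apply, fderiv_metric_symm hg hs w a b]
  ring

theorem fderiv_metric_eq {g : R7 → Bil} {u : R7} {c : R7 ≃L[ℝ] R7}
    (hc : g u = pullInner (c : R7 →L[ℝ] R7)) (hg : DifferentiableAt ℝ g u)
    (hs : ∀ᶠ w in 𝓝 u, ∀ a b, g w a b = g w b a) (v a b : R7) :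
    fderiv ℝ g u v a b = g u (koszulMap g u a v) b + g u a (koszulMap g u b v) := by
  rw [hs.self_of_nhds a (koszulMap g u b v), inner_koszulMap hc, inner_koszulMap hc,
    koszulForm_apply, koszulForm_apply, fderiv_metric_symm hg hs a v b,
    fderiv_metric_symm hg hs b a v, fderiv_metric_symm hg hs v b a]
  ring

theorem koszulForm_eq_of_compatible {g : R7 → Bil} {u : R7} {Γ : R7 →L[ℝ] R7 →L[ℝ] R7}
    (hΓ : ∀ a b, Γ a b = Γ b a) (hs : ∀ a b, g u a b = g u b a)
    (h : ∀ v a b, fderiv ℝ g u v a b = g u (Γ a v) b + g u a (Γ b v)) (a b w : R7) :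
    koszulForm g u a b w = g u (Γ a b) w := by
  rw [koszulForm_apply, h, h, h, hΓ b a, hΓ w a, hΓ w b, hs b, hs a (Γ b w)]
  ring

/-- Uniqueness half of the Koszul formula: symmetry and metric compatibility determine the symbols.
-/
theorem koszulMap_eq_of_compatible {g : R7 → Bil} {u : R7} {c : R7 ≃L[ℝ] R7}
    (hc : g u = pullInner (c : R7 →L[ℝ] R7)) {Γ : R7 →L[ℝ] R7 →L[ℝ] R7}
    (hΓ : ∀ a b, Γ a b = Γ b a)
    (h : ∀ v a b, fderiv ℝ g u v a b = g u (Γ a v) b + g u a (Γ b v)) :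
    koszulMap g u = Γ := by
  have hs : ∀ a b, g u a b = g u b a := by
    intro a b; rw [hc, pullInner_symm]
  ext a b : 2
  refine pullInner_injective c fun w => ?_
  rw [← hc, inner_koszulMap hc, koszulForm_eq_of_compatible hΓ hs h]

theorem contDiffOn_koszulMap {s : Set R7} (hs : IsOpen s) {g : R7 → Bil}
    (hg : ContDiffOn ℝ ∞ g s) (h : ∀ u ∈ s, IsUnit (gram (g u)).det) :
    ContDiffOn ℝ ∞ (koszulMap g) s := by
  have hL := hg.fderiv_of_isOpen hs (m := ∞) (by simp)
  refine contDiffOn_clm_apply.2 fun a => contDiffOn_clm_apply.2 fun b => ?_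
  simp only [koszulMap_apply]
  refine contDiffOn_trG hg h ?_
  refine contDiffOn_clm_apply.2 fun w => ?_
  simp only [ContinuousLinearMap.smulRight_apply, koszulForm_apply]
  have h3 : ∀ x y z : R7, ContDiffOn ℝ ∞ (fun u => fderiv ℝ g u x y z) s := fun x y z =>
    ((hL.clm_apply contDiffOn_const).clm_apply contDiffOn_const).clm_apply contDiffOn_const
  exact (contDiffOn_const.mul (((h3 _ _ _).add (h3 _ _ _)).sub (h3 _ _ _))).smul contDiffOn_const

/-- The Christoffel symbols transform under a diffeomorphism `ψ` with `ψ^* g' = g`. -/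
theorem koszulMap_transform {g g' : R7 → Bil} {ψ : R7 → R7} {u : R7} {A c c' : R7 ≃L[ℝ] R7}
    (hc : g u = pullInner (c : R7 →L[ℝ] R7)) (hc' : g' (ψ u) = pullInner (c' : R7 →L[ℝ] R7))
    (hg : DifferentiableAt ℝ g u) (hg' : DifferentiableAt ℝ g' (ψ u))
    (hs' : ∀ᶠ w in 𝓝 (ψ u), ∀ a b, g' w a b = g' w b a)
    (hψ : ContDiffAt ℝ 2 ψ u) (hA : fderiv ℝ ψ u = A)
    (hpull : ∀ᶠ w in 𝓝 u, ∀ a b, g' (ψ w) (fderiv ℝ ψ w a) (fderiv ℝ ψ w b) = g w a b)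
    (a b : R7) :
    koszulMap g' (ψ u) (A a) (A b) = A (koszulMap g u a b) - fderiv ℝ (fderiv ℝ ψ) u a b := by
  have hd : DifferentiableAt ℝ ψ u := hψ.differentiableAt (by simp)
  have hd2 : DifferentiableAt ℝ (fderiv ℝ ψ) u :=
    (hψ.fderiv_right (m := 1) (by norm_num)).differentiableAt (by simp)
  set H := fderiv ℝ (fderiv ℝ ψ) u with hH
  have hHs : ∀ a b, H a b = H b a := fun a b => hψ.isSymmSndFDerivAt (by simp) a b
  have hs0 := hs'.self_of_nhds
  -- The identity `ψ^* g' = g` is differentiated once. In the Koszul combination four of the six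
  -- terms containing `H` cancel by symmetry, and the other two add up to `g'(H a b, A w)` after the
  -- factor 1/2.
  have key : ∀ v a b, fderiv ℝ g u v a b = fderiv ℝ g' (ψ u) (A v) (A a) (A b) +
      g' (ψ u) (H v a) (A b) + g' (ψ u) (A a) (H v b) := by
    intro v a b
    have h1 := (hg.hasFDerivAt.clm_apply (hasFDerivAt_const a u)).clm_apply (hasFDerivAt_const b u)
    have h2 := ((hg'.hasFDerivAt.comp u hd.hasFDerivAt).clm_apply
      (hd2.hasFDerivAt.clm_apply (hasFDerivAt_const a u))).clm_apply
      (hd2.hasFDerivAt.clm_apply (hasFDerivAt_const b u))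
    have h3 := h2.congr_of_eventuallyEq (f₁ := fun w => g w a b) (by
      filter_upwards [hpull] with w hw
      exact (hw a b).symm)
    have h4 := congrArg (fun L : R7 →L[ℝ] ℝ => L v) (h1.unique h3)
    simp [hA] at h4
    rw [h4]
    ring
  have hinj : ∀ x y : R7, (∀ w, g' (ψ u) x (A w) = g' (ψ u) y (A w)) → x = y := by
    intro x y h
    refine pullInner_injective c' fun z => ?_
    have := h (A.symm z)
    rwa [A.apply_symm_apply, hc'] at this
  refine hinj _ _ fun w => ?_
  have h5 : ∀ x y, g' (ψ u) (A x) (A y) = g u x y := by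
    intro x y
    have := hpull.self_of_nhds x y
    rwa [hA] at this
  rw [map_sub, sub_apply, inner_koszulMap hc', h5, inner_koszulMap hc, koszulForm_apply,
    koszulForm_apply, key, key, key, hHs b a, hHs w a, hHs w b, hs0 (A b), hs0 (A a) (H b w)]
  ring

end G2Flow

end

noncomputable section
namespace G2Flow
open Bundle VectorField Filter
open scoped Topology

variable {M : Type*} [TopologicalSpace M] [ChartedSpace R7 M] [IsManifold (𝓡 7) ∞ M]

/-! ### The Levi-Civita connection -/

theorem differentiableAt_locMetric [T2Space M] {σ : ThreeFormField M} (hσ : IsG2Structure σ)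
    {x : M} {u : R7} (hu : u ∈ (chartAt R7 x).target) : DifferentiableAt ℝ (locMetric σ x) u :=
  ((contDiffOn_locMetric hσ x).contDiffAt ((chartAt R7 x).open_target.mem_nhds hu)).differentiableAt
    (by simp)

theorem locMetric_symm_eventually (σ : ThreeFormField M) (x : M) (u : R7) :
    ∀ᶠ w in 𝓝 u, ∀ a b, locMetric σ x w a b = locMetric σ x w b a :=
  Eventually.of_forall fun w => locMetric_symm σ x w

/-- The Levi-Civita connection, at each point defined by the chart at this point. -/
def leviCivitaConnection (σ : ThreeFormField M) : AffineConnection M where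
  toFun Y y := chartConnection y Y y + (ofE y y).comp
    ((koszulMap (locMetric σ y) (chartAt R7 y y) (toE y y (Y y))).comp (toE y y))
  isCovariantDerivativeOnUniv :=
    { add := by
        intro Y Z y hY hZ _
        rw [(isCovariantDerivativeOn_chartConnection y).add hY hZ (mem_chart_source R7 y)]
        ext1 v
        simp only [Pi.add_apply, map_add, add_apply, ContinuousLinearMap.comp_apply]
        abel
      leibniz := by
        intro Y g y hY hg _
        rw [(isCovariantDerivativeOn_chartConnection y).leibniz hY hg (mem_chart_source R7 y)]
        ext1 v
        simp only [Pi.smul_apply', map_smul, add_apply, ContinuousLinearMap.comp_apply, smul_apply,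
          smul_add]
        abel }

/-- The connection is defined at each point by that point's own chart, so its symbols are known here
only at the centre. This suffices, as torsion and metric compatibility can be checked one point at a
time. -/
theorem christoffel_leviCivitaConnection (σ : ThreeFormField M) (x : M) :
    christoffel (leviCivitaConnection σ) x (chartAt R7 x x) =
      koszulMap (locMetric σ x) (chartAt R7 x x) := by
  have hx := mem_chart_source R7 x
  have hli := (chartAt R7 x).left_inv hx
  ext a b : 2
  have h1 := (contMDiffAt_constField hx a).mdifferentiableAt (n := ∞) (by simp)
  have h2 := toE_connection (leviCivitaConnection σ) hx h1 (ofE x x b)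
  have h3 : leviCivitaConnection σ (constField x a) x (ofE x x b) =
    chartConnection x (constField x a) x (ofE x x b) + ofE x x
      (koszulMap (locMetric σ x) (chartAt R7 x x) (toE x x (constField x a x))
        (toE x x (ofE x x b))) := rfl
  rw [h3, map_add] at h2
  simp only [chartConnection, ContinuousLinearMap.comp_apply, toE_ofE hx, constField] at h2
  exact (add_left_cancel h2).symm

theorem torsion_eq_zero_of_symm {D : AffineConnection M}
    (h : ∀ x a b, christoffel D x (chartAt R7 x x) a b = christoffel D x (chartAt R7 x x) b a) :
    D.torsion = 0 := by
  refine (CovariantDerivative.torsion_eq_zero_iff D).2 ?_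
  intro X Y x hX hY
  have hx := mem_chart_source R7 x
  refine toE_injective hx ?_
  rw [mlieBracket_chart hx hX hY, map_sub, toE_connection D hx hX, toE_connection D hx hY,
    h x (toE x x (X x))]
  abel

theorem isLeviCivita_leviCivitaConnection [T2Space M] {σ : ThreeFormField M}
    (hσ : IsG2Structure σ) : IsLeviCivita σ (leviCivitaConnection σ) where
  torsion_free := by
    refine torsion_eq_zero_of_symm fun x a b => ?_
    rw [christoffel_leviCivitaConnection]
    exact koszulMap_symm (differentiableAt_locMetric hσ (mem_chart_target R7 x))
      (locMetric_symm_eventually σ x _) a b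
  metric_compatible x Y Z hY hZ v := by
    have hx := mem_chart_source R7 x
    have hu := mem_chart_target R7 x
    have hg := differentiableAt_locMetric hσ hu
    rw [mvfderiv_chart hx]
    have h1 : (fun y => metric σ y (Y y) (Z y)) ∘ (chartAt R7 x).symm =ᶠ[𝓝 (chartAt R7 x x)]
        fun u => locMetric σ x u (loc x Y u) (loc x Z u) := by
      filter_upwards [(chartAt R7 x).open_target.mem_nhds hu] with u hu'
      have hy := (chartAt R7 x).map_target hu'
      rw [Function.comp_apply, metric_eq_locMetric σ hy, (chartAt R7 x).right_inv hu']
      rfl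
    have h2 := (hg.hasFDerivAt.clm_apply
      ((mdifferentiableAt_sec_iff hx Y).1 hY).hasFDerivAt).clm_apply
      ((mdifferentiableAt_sec_iff hx Z).1 hZ).hasFDerivAt
    rw [h1.fderiv_eq, h2.fderiv, metric_eq_locMetric σ hx, metric_eq_locMetric σ hx,
      toE_connection _ hx hY, toE_connection _ hx hZ, christoffel_leviCivitaConnection]
    have h3 := fderiv_metric_eq (locMetric_eq_pullInner σ hu) hg (locMetric_symm_eventually σ x _)
      (toE x x v) (toE x x (Y x)) (toE x x (Z x))
    simp only [add_apply, ContinuousLinearMap.comp_apply, ContinuousLinearMap.flip_apply,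
      loc_apply hx, h3, map_add]
    ring

theorem isLeviCivita_leviCivita [T2Space M] (D0 : AffineConnection M) {σ : ThreeFormField M}
    (hσ : IsG2Structure σ) : IsLeviCivita σ (leviCivita D0 σ) := by
  have h : ∃ D : AffineConnection M, IsLeviCivita σ D := ⟨_, isLeviCivita_leviCivitaConnection hσ⟩
  have h2 : leviCivita D0 σ = h.choose := dif_pos h
  rw [h2]
  exact h.choose_spec

/-- By uniqueness the formula holds on the whole chart domain and for every Levi-Civita connection,
in particular for the one selected by choice in `leviCivita`. -/
theorem christoffel_eq_koszulMap [T2Space M] {σ : ThreeFormField M} (hσ : IsG2Structure σ)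
    {D : AffineConnection M} (hD : IsLeviCivita σ D) {x : M} {u : R7}
    (hu : u ∈ (chartAt R7 x).target) : christoffel D x u = koszulMap (locMetric σ x) u := by
  have hy := (chartAt R7 x).map_target hu
  have hdiff := fun a => (contMDiffAt_constField hy a).mdifferentiableAt (n := ∞) (by simp)
  refine (koszulMap_eq_of_compatible (locMetric_eq_pullInner σ hu)
    (christoffel_symm hD.torsion_free hu) ?_).symm
  intro v a b
  have h := hD.metric_compatible _ _ _ (hdiff a) (hdiff b) (ofE x _ v)
  have h1 : (fun y => metric σ y (constField x a y) (constField x b y)) ∘ (chartAt R7 x).symm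
      =ᶠ[𝓝 u] fun u => locMetric σ x u a b := Eventually.of_forall fun w => rfl
  have h2 := ((differentiableAt_locMetric hσ hu).hasFDerivAt.clm_apply
    (hasFDerivAt_const a u)).clm_apply (hasFDerivAt_const b u)
  rw [mvfderiv_chart hy, (chartAt R7 x).right_inv hu, h1.fderiv_eq, h2.fderiv,
    metric_eq_locMetric σ hy, metric_eq_locMetric σ hy, ← christoffel_eq hu, ← christoffel_eq hu,
    (chartAt R7 x).right_inv hu] at h
  simpa [constField, toE_ofE hy] using h

theorem christoffel_leviCivita [T2Space M] (D0 : AffineConnection M) {σ : ThreeFormField M}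
    (hσ : IsG2Structure σ) {x : M} {u : R7} (hu : u ∈ (chartAt R7 x).target) :
    christoffel (leviCivita D0 σ) x u = koszulMap (locMetric σ x) u :=
  christoffel_eq_koszulMap hσ (isLeviCivita_leviCivita D0 hσ) hu

theorem contDiffOn_koszulMap_locMetric [T2Space M] {σ : ThreeFormField M} (hσ : IsG2Structure σ)
    (x : M) : ContDiffOn ℝ ∞ (koszulMap (locMetric σ x)) (chartAt R7 x).target :=
  contDiffOn_koszulMap (chartAt R7 x).open_target (contDiffOn_locMetric hσ x)
    fun _ hu => isUnit_det_gram_locMetric σ hu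

end G2Flow

end

noncomputable section
namespace G2Flow
open Bundle VectorField Filter
open scoped Topology

/-! ### Families of local diffeomorphisms of `ℝ⁷` -/

variable {E F : Type*} [NormedAddCommGroup E] [NormedSpace ℝ E] [NormedAddCommGroup F]
  [NormedSpace ℝ F]

theorem eventually_contDiffAt {f : E → F} {x : E} (hf : ContDiffAt ℝ ∞ f x) (n : ℕ) :
    ∀ᶠ y in 𝓝 x, ContDiffAt ℝ n f y :=
  (hf.of_le (mod_cast le_top : (n : WithTop ℕ∞) ≤ ∞)).eventually (by simp)

theorem hasFDerivAt_slice {Φ : ℝ × E → F} {s : ℝ} {u : E}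
    (h : DifferentiableAt ℝ Φ (s, u)) :
    HasFDerivAt (fun w => Φ (s, w)) ((fderiv ℝ Φ (s, u)).comp (ContinuousLinearMap.inr ℝ ℝ E)) u :=
  h.hasFDerivAt.comp u (hasFDerivAt_prodMk_right s u)

theorem fderiv_slice_apply {Φ : ℝ × E → F} {s : ℝ} {u : E}
    (h : DifferentiableAt ℝ Φ (s, u)) (a : E) :
    fderiv ℝ (fun w => Φ (s, w)) u a = fderiv ℝ Φ (s, u) (0, a) := by
  rw [(hasFDerivAt_slice h).fderiv]
  simp

theorem fderiv_fderiv_slice_apply {Φ : ℝ × E → F} {s : ℝ} {u : E}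
    (h : ContDiffAt ℝ 2 Φ (s, u)) (a b : E) :
    fderiv ℝ (fderiv ℝ (fun w => Φ (s, w))) u a b =
      fderiv ℝ (fderiv ℝ Φ) (s, u) (0, a) (0, b) := by
  have h1 : ∀ᶠ q in 𝓝 (s, u), DifferentiableAt ℝ Φ q :=
    (h.eventually (by simp)).mono fun q hq => hq.differentiableAt (by simp)
  have hc : Tendsto (fun w : E => (s, w)) (𝓝 u) (𝓝 (s, u)) :=
    (Continuous.prodMk_right s).continuousAt
  have h2 : fderiv ℝ (fun w => Φ (s, w)) =ᶠ[𝓝 u]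
      fun w => (fderiv ℝ Φ (s, w)).comp (ContinuousLinearMap.inr ℝ ℝ E) := by
    filter_upwards [hc.eventually h1] with w hw using (hasFDerivAt_slice hw).fderiv
  have h3 : DifferentiableAt ℝ (fderiv ℝ Φ) (s, u) :=
    (h.fderiv_right (m := 1) (by norm_num)).differentiableAt (by simp)
  have h4 := (hasFDerivAt_slice h3).clm_comp
    (hasFDerivAt_const (ContinuousLinearMap.inr ℝ ℝ E) u)
  rw [h2.fderiv_eq, h4.fderiv]
  simp

/-- Symmetry of the second derivative of `Φ`: differentiation along the curve and in the direction
`(0, a)` may be exchanged. -/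
theorem hasDerivAt_fderiv_curve {Φ : ℝ × E → F} {u₀ : E} (hΦ : ContDiffAt ℝ 2 Φ (0, u₀))
    {γ : ℝ → ℝ × E} {γ' : ℝ × E} (hγ : HasDerivAt γ γ' 0) (hγ0 : γ 0 = (0, u₀)) (a : E) :
    HasDerivAt (fun s => fderiv ℝ Φ (γ s) (0, a))
      (fderiv ℝ (fun u => fderiv ℝ Φ (0, u) γ') u₀ a) 0 := by
  have h3 : DifferentiableAt ℝ (fderiv ℝ Φ) (0, u₀) :=
    (hΦ.fderiv_right (m := 1) (by norm_num)).differentiableAt (by simp)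
  have h4 : DifferentiableAt ℝ (fderiv ℝ Φ) (γ 0) := by rwa [hγ0]
  have h5 := (h4.hasFDerivAt.comp_hasDerivAt 0 hγ).clm_apply (hasDerivAt_const 0 ((0, a) : ℝ × E))
  have h6 := ((hasFDerivAt_slice h3).clm_apply (hasFDerivAt_const γ' u₀)).fderiv
  have hsymm : fderiv ℝ (fderiv ℝ Φ) (0, u₀) γ' (0, a) =
      fderiv ℝ (fderiv ℝ Φ) (0, u₀) (0, a) γ' := hΦ.isSymmSndFDerivAt (by simp) _ _
  rw [h6]
  simpa [hγ0, hsymm] using h5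

variable {Ψ : ℝ × E → E} {X : E → E} {u₀ : E}

/-- The space part is the identity because `Ψ(0, ·)` is the identity; the time part is the velocity
`X`. -/
theorem fderiv_family_apply (hΨ : ContDiffAt ℝ ∞ Ψ (0, u₀)) (hid : ∀ᶠ u in 𝓝 u₀, Ψ (0, u) = u)
    (hX : ∀ᶠ u in 𝓝 u₀, X u = fderiv ℝ Ψ (0, u) (1, 0)) (r : ℝ) (w : E) :
    ∀ᶠ u in 𝓝 u₀, fderiv ℝ Ψ (0, u) (r, w) = r • X u + w := by
  have hc : Tendsto (fun w : E => ((0 : ℝ), w)) (𝓝 u₀) (𝓝 (0, u₀)) :=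
    (Continuous.prodMk_right (0 : ℝ)).continuousAt
  filter_upwards [hid.eventually_nhds, hX, hc.eventually (eventually_contDiffAt hΨ 1)]
    with u h1 h2 h3
  have h4 := fderiv_slice_apply (h3.differentiableAt (by simp)) w
  have h5 : (fun w => Ψ (0, w)) =ᶠ[𝓝 u] id := h1
  rw [h5.fderiv_eq, fderiv_id] at h4
  have h6 : ((r, w) : ℝ × E) = r • (1, 0) + (0, w) := by simp
  rw [h6, map_add, map_smul, ← h2, ← h4]
  rfl

/-- The velocity `p'` of the base point does not contribute: by `fderiv_family_apply` the field to
be differentiated is `X + p'`, with `p'` constant. -/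
theorem hasDerivAt_family_fderiv (hΨ : ContDiffAt ℝ ∞ Ψ (0, u₀))
    (hid : ∀ᶠ u in 𝓝 u₀, Ψ (0, u) = u)
    (hX : ∀ᶠ u in 𝓝 u₀, X u = fderiv ℝ Ψ (0, u) (1, 0)) {p : ℝ → E} {p' : E}
    (hp : HasDerivAt p p' 0) (hp0 : p 0 = u₀) (a : E) :
    HasDerivAt (fun s => fderiv ℝ (fun u => Ψ (s, u)) (p s) a) (fderiv ℝ X u₀ a) 0 := by
  have hγ : HasDerivAt (fun s : ℝ => (s, p s)) (1, p') 0 := (hasDerivAt_id 0).prodMk hp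
  have hγ0 : (fun s : ℝ => (s, p s)) 0 = (0, u₀) := by simp [hp0]
  have h1 := hasDerivAt_fderiv_curve (hΨ.of_le two_le_infty) hγ hγ0 a
  have h2 : (fun u => fderiv ℝ Ψ (0, u) (1, p')) =ᶠ[𝓝 u₀] fun u => X u + p' := by
    filter_upwards [fderiv_family_apply hΨ hid hX 1 p'] with u hu
    rw [hu, one_smul]
  rw [h2.fderiv_eq, fderiv_add_const] at h1
  have hcont : Tendsto (fun s : ℝ => (s, p s)) (𝓝 0) (𝓝 (0, u₀)) := by
    have := hγ.continuousAt
    rwa [ContinuousAt, hp0] at this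
  refine h1.congr_of_eventuallyEq ?_
  filter_upwards [hcont.eventually (eventually_contDiffAt hΨ 1)] with s hs
  exact fderiv_slice_apply (hs.differentiableAt (by simp)) a

/-- The previous argument applied to the partial derivative of `Ψ` in the direction `b`; again the
motion of the base point drops out. -/
theorem hasDerivAt_family_fderiv_fderiv (hΨ : ContDiffAt ℝ ∞ Ψ (0, u₀))
    (hid : ∀ᶠ u in 𝓝 u₀, Ψ (0, u) = u)
    (hX : ∀ᶠ u in 𝓝 u₀, X u = fderiv ℝ Ψ (0, u) (1, 0)) (hXd : ContDiffAt ℝ ∞ X u₀)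
    {p : ℝ → E} {p' : E}
    (hp : HasDerivAt p p' 0) (hp0 : p 0 = u₀) (a b : E) :
    HasDerivAt (fun s => fderiv ℝ (fderiv ℝ (fun u => Ψ (s, u))) (p s) a b)
      (fderiv ℝ (fderiv ℝ X) u₀ a b) 0 := by
  have hγ : HasDerivAt (fun s : ℝ => (s, p s)) (1, p') 0 := (hasDerivAt_id 0).prodMk hp
  have hγ0 : (fun s : ℝ => (s, p s)) 0 = (0, u₀) := by simp [hp0]
  have hc : Tendsto (fun w : E => ((0 : ℝ), w)) (𝓝 u₀) (𝓝 (0, u₀)) :=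
    (Continuous.prodMk_right (0 : ℝ)).continuousAt
  have hfd : ContDiffAt ℝ ∞ (fderiv ℝ Ψ) (0, u₀) := hΨ.fderiv_right (by simp)
  have hΦ : ContDiffAt ℝ ∞ (fun q => fderiv ℝ Ψ q (0, b)) (0, u₀) :=
    hfd.clm_apply contDiffAt_const
  have h1 := hasDerivAt_fderiv_curve (hΦ.of_le two_le_infty) hγ hγ0 a
  have h2 : (fun u => fderiv ℝ (fun q => fderiv ℝ Ψ q (0, b)) (0, u) (1, p')) =ᶠ[𝓝 u₀]
      fun u => fderiv ℝ X u b := by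
    filter_upwards [(fderiv_family_apply hΨ hid hX 1 p').eventually_nhds,
      hc.eventually (eventually_contDiffAt hΨ 2)] with u hu h3
    have h3d : DifferentiableAt ℝ (fderiv ℝ Ψ) (0, u) :=
      (h3.fderiv_right (m := 1) (by norm_num)).differentiableAt (by simp)
    have h4 : (fun u => fderiv ℝ Ψ (0, u) (1, p')) =ᶠ[𝓝 u] fun u => X u + p' := by
      filter_upwards [hu] with w hw
      rw [hw, one_smul]
    have h5 := ((hasFDerivAt_slice h3d).clm_apply (hasFDerivAt_const ((1, p') : ℝ × E) u)).fderiv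
    rw [h4.fderiv_eq, fderiv_add_const] at h5
    have h6 := (h3d.hasFDerivAt.clm_apply
      (hasFDerivAt_const ((0, b) : ℝ × E) ((0, u) : ℝ × E))).fderiv
    have hsymm : fderiv ℝ (fderiv ℝ Ψ) (0, u) (1, p') (0, b) =
      fderiv ℝ (fderiv ℝ Ψ) (0, u) (0, b) (1, p') := h3.isSymmSndFDerivAt (by simp) _ _
    rw [h5, h6]
    simpa using hsymm
  have hXd1 : DifferentiableAt ℝ (fderiv ℝ X) u₀ :=
    (hXd.fderiv_right (m := 1) (WithTop.coe_le_coe.2 le_top)).differentiableAt (by simp)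
  have h7 := (hXd1.hasFDerivAt.clm_apply (hasFDerivAt_const b u₀)).fderiv
  rw [h2.fderiv_eq, h7] at h1
  have hcont : Tendsto (fun s : ℝ => (s, p s)) (𝓝 0) (𝓝 (0, u₀)) := by
    have := hγ.continuousAt
    rwa [ContinuousAt, hp0] at this
  refine HasDerivAt.congr_of_eventuallyEq (f := fun s => fderiv ℝ (fun q => fderiv ℝ Ψ q (0, b))
    (s, p s) (0, a)) (by simpa using h1) ?_
  filter_upwards [hcont.eventually (eventually_contDiffAt hΨ 2)] with s hs
  have hsd : DifferentiableAt ℝ (fderiv ℝ Ψ) (s, p s) :=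
    (hs.fderiv_right (m := 1) (by norm_num)).differentiableAt (by simp)
  have h6 := (hsd.hasFDerivAt.clm_apply
      (hasFDerivAt_const ((0, b) : ℝ × E) (s, p s))).fderiv
  rw [fderiv_fderiv_slice_apply hs, h6]
  simp

/-- The preimage of `u₀` under `Ψ(s, ·)` is followed in `s`, by the inverse function theorem for
`(s, u) ↦ (s, Ψ(s, u))`. -/
theorem exists_curve [CompleteSpace E] (hΨ : ContDiffAt ℝ ∞ Ψ (0, u₀))
    (hid : ∀ᶠ u in 𝓝 u₀, Ψ (0, u) = u)
    (hX : ∀ᶠ u in 𝓝 u₀, X u = fderiv ℝ Ψ (0, u) (1, 0)) :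
    ∃ p : ℝ → E, p 0 = u₀ ∧ HasDerivAt p (-X u₀) 0 ∧ ∀ᶠ s in 𝓝 0, Ψ (s, p s) = u₀ := by
  -- The derivative at `(0, u₀)` is the shear `(r, w) ↦ (r, r X u₀ + w)`; its inverse maps `(1, 0)`
  -- to `(1, -X u₀)`, which gives the velocity of `p`.
  let L : (ℝ × E) ≃L[ℝ] ℝ × E := ContinuousLinearEquiv.equivOfInverse
    ((ContinuousLinearMap.fst ℝ ℝ E).prod ((ContinuousLinearMap.fst ℝ ℝ E).smulRight (X u₀) +
      ContinuousLinearMap.snd ℝ ℝ E))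
    ((ContinuousLinearMap.fst ℝ ℝ E).prod (ContinuousLinearMap.snd ℝ ℝ E -
      (ContinuousLinearMap.fst ℝ ℝ E).smulRight (X u₀)))
    (fun q => by simp) (fun q => by simp)
  have hd : HasStrictFDerivAt Ψ (fderiv ℝ Ψ (0, u₀)) (0, u₀) :=
    hΨ.hasStrictFDerivAt (by simp)
  have hΘ : HasStrictFDerivAt (fun q : ℝ × E => (q.1, Ψ q)) (L : ℝ × E →L[ℝ] ℝ × E) (0, u₀) := by
    have h := (hasStrictFDerivAt_fst (𝕜 := ℝ) (p := ((0 : ℝ), u₀))).prodMk hd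
    refine h.congr_fderiv ?_
    refine ContinuousLinearMap.ext fun q => ?_
    obtain ⟨r, w⟩ := q
    have := (fderiv_family_apply hΨ hid hX r w).self_of_nhds
    simp [L, this]
  have hinv := hΘ.to_localInverse
  have hr := hΘ.eventually_right_inverse
  have hl := hΘ.localInverse_apply_image
  set Λ := hΘ.localInverse with hΛ
  simp only [hid.self_of_nhds] at hinv hr hl
  have hline : HasDerivAt (fun s : ℝ => (s, u₀)) ((1, 0) : ℝ × E) 0 :=
    (hasDerivAt_id 0).prodMk (hasDerivAt_const 0 u₀)
  have hlc : Tendsto (fun s : ℝ => (s, u₀)) (𝓝 0) (𝓝 (0, u₀)) := hline.continuousAt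
  have hcomp : HasDerivAt (fun s : ℝ => Λ (s, u₀)) (L.symm (1, 0)) 0 :=
    HasFDerivAt.comp_hasDerivAt (f := fun s : ℝ => (s, u₀)) (0 : ℝ) hinv.hasFDerivAt hline
  refine ⟨fun s => (Λ (s, u₀)).2, by simp [hl], ?_, ?_⟩
  · have : L.symm (1, 0) = (1, -X u₀) := by
      rw [ContinuousLinearEquiv.symm_apply_eq]
      simp [L]
    rw [this] at hcomp
    exact (ContinuousLinearMap.snd ℝ ℝ E).hasFDerivAt.comp_hasDerivAt (0 : ℝ) hcomp
  · filter_upwards [hlc.eventually hr] with s hs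
    have h1 : (Λ (s, u₀)).1 = s := congrArg Prod.fst hs
    have h2 : Ψ (Λ (s, u₀)) = u₀ := congrArg Prod.snd hs
    have h3 : (s, (Λ (s, u₀)).2) = Λ (s, u₀) := Prod.ext h1.symm rfl
    rw [h3, h2]

end G2Flow

end

noncomputable section
namespace G2Flow
open Bundle VectorField Filter
open scoped Topology

/-! ### The linearized operator in coordinates -/

instance instNormedAddCommGroupEnd : NormedAddCommGroup (R7 →L[ℝ] R7) :=
  ContinuousLinearMap.toNormedAddCommGroup

instance instNormedSpaceEnd : NormedSpace ℝ (R7 →L[ℝ] R7) := ContinuousLinearMap.toNormedSpace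

instance instNormedAddCommGroupBilinear : NormedAddCommGroup (R7 →L[ℝ] R7 →L[ℝ] R7) :=
  ContinuousLinearMap.toNormedAddCommGroup

instance instNormedSpaceBilinear : NormedSpace ℝ (R7 →L[ℝ] R7 →L[ℝ] R7) :=
  ContinuousLinearMap.toNormedSpace

/-- The second derivative part of the Lie derivative, along `X`, of the difference of the
connections with Christoffel symbols `Γ` and `Γ0`; only the first one is transported. -/
def linTerm (Γ Γ0 : R7 → R7 →L[ℝ] R7 →L[ℝ] R7) (X : R7 → R7) (u a b : R7) : R7 :=
  fderiv ℝ Γ u (X u) a b - fderiv ℝ X u (Γ u a b) + fderiv ℝ (fderiv ℝ X) u a b +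
    Γ0 u (fderiv ℝ X u a) b + Γ0 u a (fderiv ℝ X u b)

/-- The coordinate expression of the linearized operator. -/
def linE (g : R7 → Bil) (Γ Γ0 : R7 → R7 →L[ℝ] R7 →L[ℝ] R7) (X : R7 → R7) (u : R7) : R7 :=
  ∑ j, ∑ k, (fderiv ℝ (fun w => (gram (g w))⁻¹ j k) u (X u) • (Γ u - Γ0 u) (e j) (e k) +
    (gram (g u))⁻¹ j k • linTerm Γ Γ0 X u (e j) (e k))

theorem hasDerivAt_clm {F : Type*} [NormedAddCommGroup F] [NormedSpace ℝ F] {A : ℝ → R7 →L[ℝ] F}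
    {A' : R7 →L[ℝ] F} {s : ℝ} (h : ∀ a, HasDerivAt (fun t => A t a) (A' a) s) :
    HasDerivAt A A' s := by
  have h1 : ∀ B : R7 →L[ℝ] F, B = ∑ i, ContinuousLinearMap.smulRightL ℝ R7 F
      (EuclideanSpace.proj i) (B (e i)) := by
    intro B
    ext v
    conv_lhs => rw [← sum_smul_e v]
    simp [sum_apply]
  rw [h1 A', show A = fun t => ∑ i, ContinuousLinearMap.smulRightL ℝ R7 F
      (EuclideanSpace.proj i) (A t (e i)) from funext fun t => h1 (A t)]
  exact HasDerivAt.fun_sum fun i _ =>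
    (ContinuousLinearMap.hasFDerivAt _).comp_hasDerivAt s (h (e i))

variable {g : R7 → Bil} {Γ Γ0 : R7 → R7 →L[ℝ] R7 →L[ℝ] R7} {Ψ : ℝ × R7 → R7} {X : R7 → R7}
  {u₀ : R7} {p : ℝ → R7}

/-- The differentiated expression is minus the trace of the difference tensor of the transported
metric at the fixed point `u₀`, written at its preimage `p s`. `Γ0` stays at `u₀` and is not
transported, so no derivative of `Γ0` appears. -/
theorem hasDerivAt_transported
    (hg : ∀ j k, DifferentiableAt ℝ (fun w => (gram (g w))⁻¹ j k) u₀)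
    (hΓ : DifferentiableAt ℝ Γ u₀) (hΨ : ContDiffAt ℝ ∞ Ψ (0, u₀))
    (hid : ∀ᶠ u in 𝓝 u₀, Ψ (0, u) = u)
    (hX : ∀ᶠ u in 𝓝 u₀, X u = fderiv ℝ Ψ (0, u) (1, 0)) (hXd : ContDiffAt ℝ ∞ X u₀)
    (hp : HasDerivAt p (-X u₀) 0) (hp0 : p 0 = u₀) :
    HasDerivAt (fun s => -∑ j, ∑ k, (gram (g (p s)))⁻¹ j k •
      (fderiv ℝ (fun u => Ψ (s, u)) (p s) (Γ (p s) (e j) (e k)) -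
        fderiv ℝ (fderiv ℝ (fun u => Ψ (s, u))) (p s) (e j) (e k) -
        Γ0 u₀ (fderiv ℝ (fun u => Ψ (s, u)) (p s) (e j))
          (fderiv ℝ (fun u => Ψ (s, u)) (p s) (e k))))
      (linE g Γ Γ0 X u₀) 0 := by
  have hA1 := fun a => hasDerivAt_family_fderiv hΨ hid hX hp hp0 a
  have hA := hasDerivAt_clm hA1
  have hH := fun a b => hasDerivAt_family_fderiv_fderiv hΨ hid hX hXd hp hp0 a b
  have hid0 : (fun u => Ψ (0, u)) =ᶠ[𝓝 u₀] id := hid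
  have hA0 : fderiv ℝ (fun u => Ψ (0, u)) u₀ = ContinuousLinearMap.id ℝ R7 := by
    rw [hid0.fderiv_eq, fderiv_id]
  have hH0 : fderiv ℝ (fderiv ℝ (fun u => Ψ (0, u))) u₀ = 0 := by
    have h1 : fderiv ℝ (fun u => Ψ (0, u)) =ᶠ[𝓝 u₀] fun _ => ContinuousLinearMap.id ℝ R7 := by
      filter_upwards [hid0.eventually_nhds] with w hw
      rw [Filter.EventuallyEq.fderiv_eq hw, fderiv_id]
    rw [h1.fderiv_eq]
    simp
  have hgp : ∀ j k, HasDerivAt (fun s => (gram (g (p s)))⁻¹ j k)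
      (fderiv ℝ (fun w => (gram (g w))⁻¹ j k) u₀ (-X u₀)) 0 := by
    intro j k
    have h := hg j k
    rw [← hp0] at h ⊢
    rw [← hp0] at hp
    exact h.hasFDerivAt.comp_hasDerivAt (0 : ℝ) hp
  have hΓp : HasDerivAt (fun s => Γ (p s)) (fderiv ℝ Γ u₀ (-X u₀)) 0 := by
    rw [← hp0] at hΓ hp ⊢
    exact hΓ.hasFDerivAt.comp_hasDerivAt (0 : ℝ) hp
  have hterm : ∀ j k, HasDerivAt (fun s => (gram (g (p s)))⁻¹ j k •
      (fderiv ℝ (fun u => Ψ (s, u)) (p s) (Γ (p s) (e j) (e k)) -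
        fderiv ℝ (fderiv ℝ (fun u => Ψ (s, u))) (p s) (e j) (e k) -
        Γ0 u₀ (fderiv ℝ (fun u => Ψ (s, u)) (p s) (e j))
          (fderiv ℝ (fun u => Ψ (s, u)) (p s) (e k))))
      (-(fderiv ℝ (fun w => (gram (g w))⁻¹ j k) u₀ (X u₀) • (Γ u₀ - Γ0 u₀) (e j) (e k) +
        (gram (g u₀))⁻¹ j k • linTerm Γ Γ0 X u₀ (e j) (e k))) 0 := by
    intro j k
    have h1 := hA.clm_apply ((hΓp.clm_apply (hasDerivAt_const (0 : ℝ) (e j))).clm_apply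
      (hasDerivAt_const (0 : ℝ) (e k)))
    have h2 := (((Γ0 u₀).hasFDerivAt.comp_hasDerivAt (0 : ℝ) (hA1 (e j))).clm_apply (hA1 (e k)))
    have h3 := (hgp j k).smul ((h1.sub (hH (e j) (e k))).sub h2)
    refine h3.congr_deriv ?_
    simp only [hp0, hA0, hH0, linTerm, ContinuousLinearMap.id_apply, Function.comp_apply, map_neg,
      map_zero, neg_apply, zero_apply, sub_apply, Pi.sub_apply, add_zero,
      sub_zero]
    module
  have hsum := (HasDerivAt.fun_sum (u := Finset.univ) fun j _ =>
    HasDerivAt.fun_sum (u := Finset.univ) fun k _ => hterm j k).neg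
  refine hsum.congr_deriv ?_
  simp only [linE, Finset.sum_neg_distrib, neg_neg]

end G2Flow

end

noncomputable section
namespace G2Flow
open Bundle VectorField Filter
open scoped Topology

variable {M : Type*} [TopologicalSpace M] [ChartedSpace R7 M] [IsManifold (𝓡 7) ∞ M]

/-! ### The linearization of the flow -/

/-- With `2A = -1` the contribution `+5 V₁` of `-V₂` cancels `-5 V₁`, and only the trace of the
difference tensor is left. -/
theorem V_eq (D0 : AffineConnection M) (σ : ThreeFormField M) (y : M) :
    V (-1 / 2) D0 σ y = ∑ p, diffTensor D0 σ y (frame σ y p) (frame σ y p) := by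
  simp only [V, V2]
  module

theorem toE_V [T2Space M] (D0 : AffineConnection M) {σ : ThreeFormField M} (hσ : IsG2Structure σ)
    {x y : M} (hy : y ∈ (chartAt R7 x).source) :
    toE x y (V (-1 / 2) D0 σ y) = trG (locMetric σ x (chartAt R7 x y))
      (koszulMap (locMetric σ x) (chartAt R7 x y) - christoffel D0 x (chartAt R7 x y)) := by
  rw [V_eq, map_sum, ← sum_frame σ hy]
  refine Finset.sum_congr rfl fun i _ => ?_
  rw [diffTensor, difference_eq _ _ hy, christoffel_leviCivita D0 hσ ((chartAt R7 x).map_source hy)]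
  rfl

/-- A linear map pulling some bilinear form back to an inner product is injective, hence invertible
in finite dimension. This gives invertibility of the derivative of `Ψ_s` without inverting `Ψ_s`. -/
theorem injective_of_pull {g g' : Bil} {c : R7 ≃L[ℝ] R7} (hc : g = pullInner (c : R7 →L[ℝ] R7))
    {A : R7 →L[ℝ] R7} (h : ∀ a b, g' (A a) (A b) = g a b) :
    ∃ A' : R7 ≃L[ℝ] R7, A = (A' : R7 →L[ℝ] R7) := by
  have hinj : Function.Injective (A : R7 →ₗ[ℝ] R7) := by
    intro v w hvw
    refine pullInner_injective c fun z => ?_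
    rw [← hc, ← h, ← h]
    have : A v = A w := hvw
    rw [this]
  refine ⟨(LinearEquiv.ofInjectiveEndo _ hinj).toContinuousLinearEquiv, ?_⟩
  ext v
  rfl

variable {F : ℝ → Diffeo M} {f : Diffeo M}

/-- The family `F s ∘ f⁻¹` in the chart at `x`. -/
def locFamily (F : ℝ → Diffeo M) (f : Diffeo M) (x : M) (q : ℝ × R7) : R7 :=
  chartAt R7 x (F q.1 (f.symm ((chartAt R7 x).symm q.2)))

theorem contMDiffAt_family (hF : ContMDiff (𝓘(ℝ, ℝ).prod (𝓡 7)) (𝓡 7) ∞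
    (fun p : ℝ × M => F p.1 p.2)) {x : M} {q : ℝ × R7} (hq : q.2 ∈ (chartAt R7 x).target) :
    ContMDiffAt (𝓘(ℝ, ℝ × R7)) (𝓡 7) ∞
      (fun q : ℝ × R7 => F q.1 (f.symm ((chartAt R7 x).symm q.2))) q := by
  have h1 : ContMDiffAt 𝓘(ℝ, ℝ × R7) (𝓘(ℝ, ℝ).prod (𝓡 7)) ∞
      (fun q : ℝ × R7 => (q.1, f.symm ((chartAt R7 x).symm q.2))) q := by
    refine ContMDiffAt.prodMk contDiff_fst.contMDiff.contMDiffAt ?_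
    refine f.symm.contMDiff.contMDiffAt.comp q ?_
    exact (contMDiffAt_chart_symm hq).comp q contDiff_snd.contMDiff.contMDiffAt
  exact ContMDiffAt.comp q (hF _) h1

theorem contDiffAt_locFamily (hF : ContMDiff (𝓘(ℝ, ℝ).prod (𝓡 7)) (𝓡 7) ∞
    (fun p : ℝ × M => F p.1 p.2)) {x : M} {q : ℝ × R7} (hq : q.2 ∈ (chartAt R7 x).target)
    (hs : F q.1 (f.symm ((chartAt R7 x).symm q.2)) ∈ (chartAt R7 x).source) :
    ContDiffAt ℝ ∞ (locFamily F f x) q := by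
  rw [← contMDiffAt_iff_contDiffAt]
  exact ContMDiffAt.comp q (contMDiffAt_chart hs) (contMDiffAt_family hF hq)

/-- Points at which `locFamily` is meaningful. -/
theorem eventually_locFamily (hF : ContMDiff (𝓘(ℝ, ℝ).prod (𝓡 7)) (𝓡 7) ∞
    (fun p : ℝ × M => F p.1 p.2)) (hF0 : F 0 = f) (y : M) :
    ∀ᶠ q : ℝ × R7 in 𝓝 (0, chartAt R7 y y), q.2 ∈ (chartAt R7 y).target ∧
      F q.1 (f.symm ((chartAt R7 y).symm q.2)) ∈ (chartAt R7 y).source := by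
  have h1 : ∀ᶠ q : ℝ × R7 in 𝓝 (0, chartAt R7 y y), q.2 ∈ (chartAt R7 y).target :=
    continuous_snd.continuousAt.eventually
      ((chartAt R7 y).open_target.mem_nhds (mem_chart_target R7 y))
  have hc := (contMDiffAt_family (f := f) hF (x := y) (q := (0, chartAt R7 y y))
    (mem_chart_target R7 y)).continuousAt
  refine h1.and (hc.eventually ((chartAt R7 y).open_source.mem_nhds ?_))
  simp [hF0]

theorem mfderiv_locFamily (hF : ContMDiff (𝓘(ℝ, ℝ).prod (𝓡 7)) (𝓡 7) ∞
    (fun p : ℝ × M => F p.1 p.2)) {y : M} {s : ℝ} {u : R7} (hu : u ∈ (chartAt R7 y).target)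
    (hs : F s (f.symm ((chartAt R7 y).symm u)) ∈ (chartAt R7 y).source)
    {x : M} (hx : f x = (chartAt R7 y).symm u) (v : T x) :
    fderiv ℝ (fun w => locFamily F f y (s, w)) u (toE y (f x) (mfderiv (𝓡 7) (𝓡 7) f x v)) =
      toE y (F s x) (mfderiv (𝓡 7) (𝓡 7) (F s) x v) := by
  have hxs : f.symm ((chartAt R7 y).symm u) = x := by rw [← hx]; simp
  rw [hxs] at hs
  have hfx : f x ∈ (chartAt R7 y).source := hx ▸ (chartAt R7 y).map_target hu
  have hφ : chartAt R7 y (f x) = u := by rw [hx, (chartAt R7 y).right_inv hu]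
  have hd : DifferentiableAt ℝ (fun w => locFamily F f y (s, w)) (chartAt R7 y (f x)) := by
    rw [hφ]
    have h := (contDiffAt_locFamily (f := f) hF (q := (s, u)) hu (by rwa [← hxs] at hs)).differentiableAt
      (by simp)
    exact (hasFDerivAt_slice h).differentiableAt
  have h1 : mfderiv (𝓡 7) (𝓡 7) (chartAt R7 y ∘ F s) x =
      (toE y (F s x)).comp (mfderiv (𝓡 7) (𝓡 7) (F s) x) := by
    rw [mfderiv_comp x ((contMDiffAt_chart hs).mdifferentiableAt (by simp))
      ((F s).contMDiff.mdifferentiableAt (by simp)), toE_eq_mfderiv hs]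
    rfl
  have h2 : chartAt R7 y ∘ F s =ᶠ[𝓝 x]
      (fun w => locFamily F f y (s, w)) ∘ (chartAt R7 y ∘ f) := by
    have hc : ContinuousAt f x := f.continuous.continuousAt
    filter_upwards [hc.eventually ((chartAt R7 y).open_source.mem_nhds hfx)] with z hz
    simp only [Function.comp_apply, locFamily]
    rw [(chartAt R7 y).left_inv hz]
    simp
  have hdc : MDifferentiableAt (𝓡 7) (𝓡 7) (chartAt R7 y ∘ f) x :=
    ((contMDiffAt_chart hfx).mdifferentiableAt (by simp)).comp x
      (f.contMDiff.mdifferentiableAt (by simp))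
  have h3 : mfderiv (𝓡 7) (𝓡 7) (chartAt R7 y ∘ F s) x =
      (fderiv ℝ (fun w => locFamily F f y (s, w)) u).comp
        ((toE y (f x)).comp (mfderiv (𝓡 7) (𝓡 7) f x)) := by
    rw [h2.mfderiv_eq, mfderiv_comp x hd.mdifferentiableAt hdc, mfderiv_eq_fderiv,
      mfderiv_comp x ((contMDiffAt_chart hfx).mdifferentiableAt (by simp))
      (f.contMDiff.mdifferentiableAt (by simp)), toE_eq_mfderiv hfx]
    have hφ' : (chartAt R7 y ∘ f) x = u := hφ
    rw [hφ']
    rfl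
  have h4 := congrArg (fun L : T x →L[ℝ] R7 => L v) (h3.symm.trans h1)
  exact h4

/-- Both sides are the metric of `σ` at `x`, on the vectors whose images under `f` have coordinates
`a` and `b`. -/
theorem locMetric_pushForm {σ : ThreeFormField M} (hσ : IsG2Structure σ)
    (hF : ContMDiff (𝓘(ℝ, ℝ).prod (𝓡 7)) (𝓡 7) ∞ (fun p : ℝ × M => F p.1 p.2))
    {y : M} {s : ℝ} {u : R7} (hu : u ∈ (chartAt R7 y).target)
    (hs : F s (f.symm ((chartAt R7 y).symm u)) ∈ (chartAt R7 y).source) (a b : R7) :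
    locMetric (pushForm (F s) σ) y (locFamily F f y (s, u))
      (fderiv ℝ (fun w => locFamily F f y (s, w)) u a)
      (fderiv ℝ (fun w => locFamily F f y (s, w)) u b) = locMetric (pushForm f σ) y u a b := by
  set x := f.symm ((chartAt R7 y).symm u) with hxdef
  have hx : f x = (chartAt R7 y).symm u := by simp [hxdef]
  have hfx : f x ∈ (chartAt R7 y).source := hx ▸ (chartAt R7 y).map_target hu
  have hφ : chartAt R7 y (f x) = u := by rw [hx, (chartAt R7 y).right_inv hu]
  have hsurj : ∀ a : R7, ∃ v : T x, toE y (f x) (mfderiv (𝓡 7) (𝓡 7) f x v) = a := by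
    intro a
    obtain ⟨v, hv⟩ := (f.mfderivToContinuousLinearEquiv (by simp) x).surjective (ofE y (f x) a)
    refine ⟨v, ?_⟩
    have h : mfderiv (𝓡 7) (𝓡 7) f x v = ofE y (f x) a := hv
    rw [h, toE_ofE hfx]
  obtain ⟨v, rfl⟩ := hsurj a
  obtain ⟨w, rfl⟩ := hsurj b
  have hΨ : locFamily F f y (s, u) = chartAt R7 y (F s x) := rfl
  rw [mfderiv_locFamily hF hu hs hx, mfderiv_locFamily hF hu hs hx, hΨ,
    ← metric_eq_locMetric _ hs, metric_pushForm hσ]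
  conv_rhs => rw [← hφ]
  rw [← metric_eq_locMetric _ hfx, metric_pushForm hσ]

theorem loc_velocity (hF : ContMDiff (𝓘(ℝ, ℝ).prod (𝓡 7)) (𝓡 7) ∞
    (fun p : ℝ × M => F p.1 p.2)) (hF0 : F 0 = f) {X : Field M}
    (hX : ∀ x, mfderiv 𝓘(ℝ, ℝ) (𝓡 7) (fun s : ℝ => F s x) 0 (1 : ℝ) = X (F 0 x))
    {y : M} {u : R7} (hu : u ∈ (chartAt R7 y).target) :
    loc y X u = fderiv ℝ (locFamily F f y) (0, u) (1, 0) := by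
  set x := f.symm ((chartAt R7 y).symm u) with hxdef
  have hx : F 0 x = (chartAt R7 y).symm u := by simp [hxdef, hF0]
  have hs : F 0 x ∈ (chartAt R7 y).source := hx ▸ (chartAt R7 y).map_target hu
  have hd : DifferentiableAt ℝ (locFamily F f y) (0, u) :=
    (contDiffAt_locFamily hF (q := (0, u)) hu hs).differentiableAt (by simp)
  have hline : HasDerivAt (fun s : ℝ => (s, u)) ((1, 0) : ℝ × R7) 0 :=
    (hasDerivAt_id 0).prodMk (hasDerivAt_const 0 u)
  have h1 := HasFDerivAt.comp_hasDerivAt (f := fun s : ℝ => (s, u)) (0 : ℝ) hd.hasFDerivAt hline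
  have hcurve : MDifferentiableAt 𝓘(ℝ, ℝ) (𝓡 7) (fun s : ℝ => F s x) 0 := by
    have h2 : ContMDiffAt 𝓘(ℝ, ℝ) (𝓘(ℝ, ℝ).prod (𝓡 7)) ∞ (fun s : ℝ => (s, x)) 0 :=
      contMDiffAt_id.prodMk contMDiffAt_const
    exact (ContMDiffAt.comp (0 : ℝ) (hF _) h2).mdifferentiableAt (by simp)
  have h3 := mfderiv_comp (0 : ℝ) ((contMDiffAt_chart hs).mdifferentiableAt (by simp)) hcurve
  rw [mfderiv_eq_fderiv] at h3
  have h4 := congrArg (fun L : ℝ →L[ℝ] R7 => L 1) h3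
  have h5 : fderiv ℝ (chartAt R7 y ∘ fun s : ℝ => F s x) 0 1 =
      fderiv ℝ (locFamily F f y) (0, u) (1, 0) := by
    exact h1.deriv
  have h6 : toE y (F 0 x) (X (F 0 x)) = loc y X u := by
    rw [← loc_apply hs, hx, (chartAt R7 y).right_inv hu]
  rw [← h6, ← hX x, toE_eq_mfderiv hs]
  exact h4.symm.trans h5

/-- For small `s` the value at the fixed point `y` is rewritten, by naturality of the Christoffel
symbols, through the fixed metric at the moving point `p s`; then `hasDerivAt_transported` applies.
-/
theorem hasDerivAt_flowField [T2Space M] {D0 : AffineConnection M} {σ : ThreeFormField M}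
    (hσ : IsG2Structure σ)
    (hF : ContMDiff (𝓘(ℝ, ℝ).prod (𝓡 7)) (𝓡 7) ∞ (fun p : ℝ × M => F p.1 p.2)) (hF0 : F 0 = f)
    {X : SmoothField M}
    (hX : ∀ x, mfderiv 𝓘(ℝ, ℝ) (𝓡 7) (fun s : ℝ => F s x) 0 (1 : ℝ) = X (F 0 x)) (y : M) :
    HasDerivAt (fun s : ℝ => toE y y (flowField (-1 / 2) D0 σ (F s) y))
      (linE (locMetric (pushForm f σ) y) (koszulMap (locMetric (pushForm f σ) y))
        (christoffel D0 y) (loc y X) (chartAt R7 y y)) 0 := by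
  have hy := mem_chart_source R7 y
  have hu₀ := mem_chart_target R7 y
  have hσf := hσ.pushForm f
  have hev := eventually_locFamily hF hF0 y
  set u₀ := chartAt R7 y y with hu₀def
  set Ψ := locFamily F f y with hΨdef
  set g := locMetric (pushForm f σ) y with hgdef
  have hΨ : ContDiffAt ℝ ∞ Ψ (0, u₀) :=
    contDiffAt_locFamily hF hev.self_of_nhds.1 hev.self_of_nhds.2
  have hid : ∀ᶠ u in 𝓝 u₀, Ψ (0, u) = u := by
    filter_upwards [(chartAt R7 y).open_target.mem_nhds hu₀] with u hu
    simp [hΨdef, locFamily, hF0, (chartAt R7 y).right_inv hu]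
  have hXv : ∀ᶠ u in 𝓝 u₀, loc y X u = fderiv ℝ Ψ (0, u) (1, 0) := by
    filter_upwards [(chartAt R7 y).open_target.mem_nhds hu₀] with u hu
    exact loc_velocity hF hF0 hX hu
  obtain ⟨p, hp0, hp, hpΨ⟩ := exists_curve hΨ hid hXv
  have hnhds := (chartAt R7 y).open_target.mem_nhds hu₀
  have hmain := hasDerivAt_transported (g := g) (Γ := koszulMap g) (Γ0 := christoffel D0 y)
    (fun j k => ((contDiffOn_inv_gram (contDiffOn_locMetric hσf y)
      (fun _ hu => isUnit_det_gram_locMetric _ hu) j k).contDiffAt hnhds).differentiableAt (by simp))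
    (((contDiffOn_koszulMap_locMetric hσf y).contDiffAt hnhds).differentiableAt (by simp))
    hΨ hid hXv (X.contDiffAt_loc hu₀) hp hp0
  refine hmain.congr_of_eventuallyEq ?_
  have hcont : Tendsto (fun s : ℝ => (s, p s)) (𝓝 0) (𝓝 (0, u₀)) := by
    have := ((hasDerivAt_id (0 : ℝ)).prodMk hp).continuousAt
    rwa [ContinuousAt, hp0] at this
  filter_upwards [hcont.eventually hev.eventually_nhds, hpΨ] with s hs hps
  have hs0 := hs.self_of_nhds
  have hσs := hσ.pushForm (F s)
  have hslice : Tendsto (fun w : R7 => (s, w)) (𝓝 (p s)) (𝓝 (s, p s)) :=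
    (Continuous.prodMk_right s).continuousAt
  have hpull : ∀ᶠ w in 𝓝 (p s), ∀ a b, locMetric (pushForm (F s) σ) y (Ψ (s, w))
      (fderiv ℝ (fun w => Ψ (s, w)) w a) (fderiv ℝ (fun w => Ψ (s, w)) w b) = g w a b := by
    filter_upwards [hslice.eventually hs] with w hw
    exact locMetric_pushForm hσ hF hw.1 hw.2
  have hc := locMetric_eq_pullInner (pushForm f σ) hs0.1
  have hc' := locMetric_eq_pullInner (pushForm (F s) σ) hu₀
  obtain ⟨A, hA⟩ := injective_of_pull hc hpull.self_of_nhds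
  have hΨs : ContDiffAt ℝ 2 (fun w => Ψ (s, w)) (p s) :=
    ((contDiffAt_locFamily hF hs0.1 hs0.2).of_le two_le_infty).comp (p s)
      (contDiffAt_const.prodMk contDiffAt_id)
  -- The target point is `Ψ(s, p s)`, which `hps` identifies with the chart centre `u₀`, where the
  -- flow field is evaluated.
  have htrans := koszulMap_transform (ψ := fun w => Ψ (s, w)) (u := p s) (A := A) hc
    (by rw [hps]; exact hc') (differentiableAt_locMetric hσf hs0.1)
    (by rw [hps]; exact differentiableAt_locMetric hσs hu₀)
    (by rw [hps]; exact locMetric_symm_eventually _ _ _) hΨs hA hpull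
  have hpull0 := hpull.self_of_nhds
  rw [hps] at htrans
  simp only [hps] at hpull0
  rw [hc', hA] at hpull0
  have hc2 : g (p s) = _ := hc
  rw [hc2] at hpull0
  have h1 : toE y y (flowField (-1 / 2) D0 σ (F s) y) = -toE y y (V (-1 / 2) D0 (pushForm (F s) σ) y) :=
    map_neg _ _
  rw [h1, toE_V D0 hσs hy, hc', trG_comp _ _ A hpull0, ← hc2]
  simp only [trG, hA]
  refine congrArg Neg.neg (Finset.sum_congr rfl fun j _ => Finset.sum_congr rfl fun k _ => ?_)
  have h2 := htrans (e j) (e k)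
  simp only [ContinuousLinearMap.bilinearComp_apply, sub_apply]
  congr 2

end G2Flow

end

noncomputable section
namespace G2Flow
open Bundle VectorField Filter
open scoped Topology

/-! ### Properties of the linearized operator in coordinates -/

/-- `linTerm` as a bilinear map. -/
def linTermMap (Γ Γ0 : R7 → R7 →L[ℝ] R7 →L[ℝ] R7) (X : R7 → R7) (u : R7) :
    R7 →L[ℝ] R7 →L[ℝ] R7 :=
  fderiv ℝ Γ u (X u) - (ContinuousLinearMap.compL ℝ R7 R7 R7 (fderiv ℝ X u)).comp (Γ u) +
    fderiv ℝ (fderiv ℝ X) u + (Γ0 u).comp (fderiv ℝ X u) +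
    ((ContinuousLinearMap.compL ℝ R7 R7 R7).flip (fderiv ℝ X u)).comp (Γ0 u)

theorem trG_linTermMap (g : Bil) (Γ Γ0 : R7 → R7 →L[ℝ] R7 →L[ℝ] R7) (X : R7 → R7) (u : R7) :
    trG g (linTermMap Γ Γ0 X u) =
      ∑ j, ∑ k, (gram g)⁻¹ j k • linTerm Γ Γ0 X u (e j) (e k) := rfl

/-- The first two terms are the coordinate bracket of `X` with the traced difference of connections,
the third is the trace of the Lie derivative of `Γ0`; all derivatives of `Γ` sit in the bracket.
This form is independent of the chart, so the local expressions patch together. -/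
theorem linE_eq {g : R7 → Bil} {Γ Γ0 : R7 → R7 →L[ℝ] R7 →L[ℝ] R7} {u : R7}
    (hg : ∀ j k, DifferentiableAt ℝ (fun w => (gram (g w))⁻¹ j k) u)
    (hΓ : DifferentiableAt ℝ Γ u) (hΓ0 : DifferentiableAt ℝ Γ0 u) (X : R7 → R7) :
    linE g Γ Γ0 X u = fderiv ℝ (fun w => trG (g w) (Γ w - Γ0 w)) u (X u) -
      fderiv ℝ X u (trG (g u) (Γ u - Γ0 u)) + trG (g u) (linTermMap Γ0 Γ0 X u) := by
  have hK : HasFDerivAt (fun w => Γ w - Γ0 w) (fderiv ℝ Γ u - fderiv ℝ Γ0 u) u :=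
    hΓ.hasFDerivAt.sub hΓ0.hasFDerivAt
  have h1 : ∀ j k, HasFDerivAt (fun w => (gram (g w))⁻¹ j k • (Γ w - Γ0 w) (e j) (e k)) _ u :=
    fun j k => (hg j k).hasFDerivAt.smul
      ((hK.clm_apply (hasFDerivAt_const (e j) u)).clm_apply (hasFDerivAt_const (e k) u))
  have h2 : HasFDerivAt (fun w => trG (g w) (Γ w - Γ0 w)) _ u :=
    HasFDerivAt.fun_sum (u := Finset.univ) fun j _ =>
      HasFDerivAt.fun_sum (u := Finset.univ) fun k _ => h1 j k
  rw [h2.fderiv, trG_map, trG_linTermMap, sum_apply]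
  simp only [sum_apply, ← Finset.sum_sub_distrib, ← Finset.sum_add_distrib, linE]
  refine Finset.sum_congr rfl fun j _ => Finset.sum_congr rfl fun k _ => ?_
  simp only [linTerm, add_apply, smul_apply, ContinuousLinearMap.smulRight_apply,
    ContinuousLinearMap.comp_apply, ContinuousLinearMap.flip_apply, zero_apply, map_zero,
    sub_apply, map_sub, zero_add]
  module

theorem linTerm_add {Γ Γ0 : R7 → R7 →L[ℝ] R7 →L[ℝ] R7} {X Y : R7 → R7} {u : R7}
    (hX : ContDiffAt ℝ 2 X u) (hY : ContDiffAt ℝ 2 Y u) (a b : R7) :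
    linTerm Γ Γ0 (X + Y) u a b = linTerm Γ Γ0 X u a b + linTerm Γ Γ0 Y u a b := by
  have h1 : fderiv ℝ (X + Y) =ᶠ[𝓝 u] fderiv ℝ X + fderiv ℝ Y := by
    filter_upwards [hX.eventually (by simp), hY.eventually (by simp)] with w h1 h2
    exact fderiv_add (h1.differentiableAt (by simp)) (h2.differentiableAt (by simp))
  have h2 : fderiv ℝ (fderiv ℝ (X + Y)) u = fderiv ℝ (fderiv ℝ X) u + fderiv ℝ (fderiv ℝ Y) u := by
    rw [h1.fderiv_eq, fderiv_add
      ((hX.fderiv_right (m := 1) (by norm_num)).differentiableAt (by simp))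
      ((hY.fderiv_right (m := 1) (by norm_num)).differentiableAt (by simp))]
  simp only [linTerm, h2, h1.self_of_nhds, Pi.add_apply, map_add, add_apply]
  abel

theorem linTerm_smul {Γ Γ0 : R7 → R7 →L[ℝ] R7 →L[ℝ] R7} {X : R7 → R7} {u : R7} (r : ℝ)
    (a b : R7) : linTerm Γ Γ0 (r • X) u a b = r • linTerm Γ Γ0 X u a b := by
  have h1 : fderiv ℝ (r • X) = r • fderiv ℝ X := fderiv_const_smul_field r
  have h2 : fderiv ℝ (r • fderiv ℝ X) u = r • fderiv ℝ (fderiv ℝ X) u :=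
    congrFun (fderiv_const_smul_field r) u
  simp only [linTerm, h1, h2, Pi.smul_apply, map_smul, smul_apply]
  module

theorem linE_add {g : R7 → Bil} {Γ Γ0 : R7 → R7 →L[ℝ] R7 →L[ℝ] R7} {X Y : R7 → R7} {u : R7}
    (hX : ContDiffAt ℝ 2 X u) (hY : ContDiffAt ℝ 2 Y u) :
    linE g Γ Γ0 (X + Y) u = linE g Γ Γ0 X u + linE g Γ Γ0 Y u := by
  simp only [linE, ← Finset.sum_add_distrib]
  refine Finset.sum_congr rfl fun j _ => Finset.sum_congr rfl fun k _ => ?_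
  rw [linTerm_add hX hY, Pi.add_apply, map_add]
  module

theorem linE_smul {g : R7 → Bil} {Γ Γ0 : R7 → R7 →L[ℝ] R7 →L[ℝ] R7} {X : R7 → R7} {u : R7}
    (r : ℝ) : linE g Γ Γ0 (r • X) u = r • linE g Γ Γ0 X u := by
  simp only [linE, Finset.smul_sum]
  refine Finset.sum_congr rfl fun j _ => Finset.sum_congr rfl fun k _ => ?_
  rw [linTerm_smul, Pi.smul_apply, map_smul]
  module

theorem contDiffOn_linE {s : Set R7} (hs : IsOpen s) {g : R7 → Bil}
    {Γ Γ0 : R7 → R7 →L[ℝ] R7 →L[ℝ] R7} {X : R7 → R7}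
    (hg : ∀ j k, ContDiffOn ℝ ∞ (fun w => (gram (g w))⁻¹ j k) s)
    (hΓ : ContDiffOn ℝ ∞ Γ s) (hΓ0 : ContDiffOn ℝ ∞ Γ0 s) (hX : ContDiffOn ℝ ∞ X s) :
    ContDiffOn ℝ ∞ (linE g Γ Γ0 X) s := by
  have hX1 := hX.fderiv_of_isOpen hs (m := ∞) (by simp)
  have hX2 := hX1.fderiv_of_isOpen hs (m := ∞) (by simp)
  have hΓ1 := hΓ.fderiv_of_isOpen hs (m := ∞) (by simp)
  have hc : ∀ a : R7, ContDiffOn ℝ ∞ (fun _ : R7 => a) s := fun a => contDiffOn_const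
  refine ContDiffOn.sum fun j _ => ContDiffOn.sum fun k _ => ContDiffOn.add ?_ ?_
  · exact (((hg j k).fderiv_of_isOpen hs (m := ∞) (by simp)).clm_apply hX).smul
      (((hΓ.sub hΓ0).clm_apply (hc _)).clm_apply (hc _))
  · refine (hg j k).smul ?_
    exact (((((hΓ1.clm_apply hX).clm_apply (hc _)).clm_apply (hc _)).sub
      (hX1.clm_apply ((hΓ.clm_apply (hc _)).clm_apply (hc _)))).add
      ((hX2.clm_apply (hc _)).clm_apply (hc _))).add
      ((hΓ0.clm_apply (hX1.clm_apply (hc _))).clm_apply (hc _)) |>.add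
      ((hΓ0.clm_apply (hc _)).clm_apply (hX1.clm_apply (hc _)))

/-! ### The linearized operator -/

variable {M : Type*} [TopologicalSpace M] [ChartedSpace R7 M] [IsManifold (𝓡 7) ∞ M]

/-- The Lie derivative `(L_X D)(v, w) = [X, D_V W] - D_{[X, V]} W - D_V [X, W]` of a connection. -/
def lieConnection (D : AffineConnection M) (X : Field M) (x : M) (v w : T x) : T x :=
  mlieBracket (𝓡 7) X (fun y => D (ext w) y (ext v y)) x
    - D (ext w) x (mlieBracket (𝓡 7) X (ext v) x) - D (mlieBracket (𝓡 7) X (ext w)) x v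

theorem eventually_chart {x y : M} (hy : y ∈ (chartAt R7 x).source) {p : R7 → Prop}
    (h : ∀ᶠ u in 𝓝 (chartAt R7 x y), p u) :
    ∀ᶠ z in 𝓝 y, z ∈ (chartAt R7 x).source ∧ p (chartAt R7 x z) :=
  Filter.Eventually.and ((chartAt R7 x).open_source.mem_nhds hy)
    (((chartAt R7 x).continuousAt hy).eventually h)

theorem eventually_loc {x y : M} (hy : y ∈ (chartAt R7 x).source) {Z : Field M} {f : R7 → R7}
    (h : ∀ᶠ z in 𝓝 y, z ∈ (chartAt R7 x).source ∧ toE x z (Z z) = f (chartAt R7 x z)) :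
    loc x Z =ᶠ[𝓝 (chartAt R7 x y)] f := by
  have hu := (chartAt R7 x).map_source hy
  have hc := (chartAt R7 x).continuousAt_symm hu
  rw [ContinuousAt, (chartAt R7 x).left_inv hy] at hc
  filter_upwards [hc.eventually h, (chartAt R7 x).open_target.mem_nhds hu] with w hw hw2
  rw [loc, hw.2, (chartAt R7 x).right_inv hw2]

theorem eventually_mdifferentiableAt {x y : M} (hy : y ∈ (chartAt R7 x).source) {Z : Field M}
    (h : ContDiffAt ℝ ∞ (loc x Z) (chartAt R7 x y)) :
    ∀ᶠ z in 𝓝 y, z ∈ (chartAt R7 x).source ∧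
      MDifferentiableAt (𝓡 7) ((𝓡 7).prod 𝓘(ℝ, R7)) (sec Z) z := by
  filter_upwards [eventually_chart hy (eventually_contDiffAt h 1)] with z hz
  exact ⟨hz.1, (mdifferentiableAt_sec_iff hz.1 Z).2 (hz.2.differentiableAt (by simp))⟩

theorem toE_lieConnection {D : AffineConnection M} {X : Field M} {x y : M}
    (hy : y ∈ (chartAt R7 x).source) (hX : ContDiffAt ℝ ∞ (loc x X) (chartAt R7 x y))
    (hD : ContDiffAt ℝ ∞ (christoffel D x) (chartAt R7 x y)) (v w : T y) :
    toE x y (lieConnection D X y v w) =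
      linTerm (christoffel D x) (christoffel D x) (loc x X) (chartAt R7 x y)
        (toE x y w) (toE x y v) := by
  have hV := (contMDiffAt_sec_iff hy _).1 (contMDiffAt_ext v)
  have hW := (contMDiffAt_sec_iff hy _).1 (contMDiffAt_ext w)
  set u := chartAt R7 x y with hu
  have hVm := (mdifferentiableAt_sec_iff hy _).2 (hV.differentiableAt (by simp))
  have hWm := (mdifferentiableAt_sec_iff hy _).2 (hW.differentiableAt (by simp))
  have hXm := (mdifferentiableAt_sec_iff hy _).2 (hX.differentiableAt (by simp))
  have hfd : ∀ {f : R7 → R7}, ContDiffAt ℝ ∞ f u → ContDiffAt ℝ ∞ (fderiv ℝ f) u :=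
    fun hf => hf.fderiv_right (by simp)
  have h1 : loc x (fun y => D (ext w) y (ext v y)) =ᶠ[𝓝 u] fun u' =>
      fderiv ℝ (loc x (ext w)) u' (loc x (ext v) u') +
        christoffel D x u' (loc x (ext w) u') (loc x (ext v) u') := by
    refine eventually_loc hy ?_
    filter_upwards [eventually_mdifferentiableAt hy hW] with z hz
    rw [toE_connection D hz.1 hz.2, loc_apply hz.1, loc_apply hz.1]
    exact ⟨hz.1, rfl⟩
  have h1c : ContDiffAt ℝ ∞ (fun u' => fderiv ℝ (loc x (ext w)) u' (loc x (ext v) u') +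
        christoffel D x u' (loc x (ext w) u') (loc x (ext v) u')) u :=
    ((hfd hW).clm_apply hV).add ((hD.clm_apply hW).clm_apply hV)
  have h1m := (mdifferentiableAt_sec_iff hy (fun y => D (ext w) y (ext v y))).2
    ((h1c.congr_of_eventuallyEq h1).differentiableAt (by simp))
  have h2 : loc x (mlieBracket (𝓡 7) X (ext w)) =ᶠ[𝓝 u] fun u' =>
      fderiv ℝ (loc x (ext w)) u' (loc x X u') - fderiv ℝ (loc x X) u' (loc x (ext w) u') := by
    refine eventually_loc hy ?_
    filter_upwards [eventually_mdifferentiableAt hy hW, eventually_mdifferentiableAt hy hX]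
      with z hz hz2
    rw [mlieBracket_chart hz.1 hz2.2 hz.2, loc_apply hz.1, loc_apply hz.1]
    exact ⟨hz.1, rfl⟩
  have h2c : ContDiffAt ℝ ∞ (fun u' => fderiv ℝ (loc x (ext w)) u' (loc x X u') -
      fderiv ℝ (loc x X) u' (loc x (ext w) u')) u :=
    ((hfd hW).clm_apply hX).sub ((hfd hX).clm_apply hW)
  have h2m := (mdifferentiableAt_sec_iff hy (mlieBracket (𝓡 7) X (ext w))).2
    ((h2c.congr_of_eventuallyEq h2).differentiableAt (by simp))
  have hd : ∀ {f : R7 → R7}, ContDiffAt ℝ ∞ f u → HasFDerivAt f (fderiv ℝ f u) u :=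
    fun hf => (hf.differentiableAt (by simp)).hasFDerivAt
  have hd2 : ∀ {f : R7 → R7}, ContDiffAt ℝ ∞ f u →
      HasFDerivAt (fderiv ℝ f) (fderiv ℝ (fderiv ℝ f) u) u :=
    fun hf => ((hfd hf).differentiableAt (by simp)).hasFDerivAt
  have hdD : HasFDerivAt (christoffel D x) (fderiv ℝ (christoffel D x) u) u :=
    (hD.differentiableAt (by simp)).hasFDerivAt
  have h3 := (((hd2 hW).clm_apply (hd hV)).add ((hdD.clm_apply (hd hW)).clm_apply (hd hV))).fderiv
  have h4 := (((hd2 hW).clm_apply (hd hX)).sub ((hd2 hX).clm_apply (hd hW))).fderiv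
  -- The second derivatives of the extension of `w` cancel by this symmetry, and the first
  -- derivatives of both extensions cancel directly, so the result depends only on `v` and `w` at
  -- the point.
  have hsW : ∀ a b, fderiv ℝ (fderiv ℝ (loc x (ext w))) u a b =
      fderiv ℝ (fderiv ℝ (loc x (ext w))) u b a := fun a b =>
    (hW.of_le two_le_infty).isSymmSndFDerivAt (by simp) a b
  have hsX : ∀ a b, fderiv ℝ (fderiv ℝ (loc x X)) u a b =
      fderiv ℝ (fderiv ℝ (loc x X)) u b a := fun a b =>
    (hX.of_le two_le_infty).isSymmSndFDerivAt (by simp) a b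
  have hv : loc x (ext v) u = toE x y v := by rw [hu, loc_apply hy, ext_self]
  have hw : loc x (ext w) u = toE x y w := by rw [hu, loc_apply hy, ext_self]
  have hXu : toE x y (X y) = loc x X u := by rw [hu, loc_apply hy]
  rw [lieConnection, map_sub, map_sub, mlieBracket_chart hy hXm h1m, toE_connection D hy hWm,
    toE_connection D hy h2m, toE_connection D hy hWm, mlieBracket_chart hy hXm hVm,
    mlieBracket_chart hy hXm hWm, ← hu, h1.fderiv_eq, h2.fderiv_eq]
  erw [h3, h4]
  simp only [hXu, ext_self, hv, hw, linTerm, add_apply, sub_apply, ContinuousLinearMap.comp_apply,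
    ContinuousLinearMap.flip_apply, map_add, map_sub, hsX (toE x y v) (toE x y w),
    hsW (toE x y v) (loc x X u)]
  abel

end G2Flow

end

/-! ### From chart expressions to global operators; the linearization as an operator on `M`. -/

noncomputable section
namespace G2Flow
open Bundle VectorField Filter
open scoped Topology

variable {M : Type*} [TopologicalSpace M] [ChartedSpace R7 M] [IsManifold (𝓡 7) ∞ M]

theorem SmoothField.contDiffOn_loc (X : SmoothField M) (x : M) :
    ContDiffOn ℝ ∞ (loc x X) (chartAt R7 x).target :=
  fun _ hu => (X.contDiffAt_loc hu).contDiffWithinAt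

theorem loc_add (X Y : SmoothField M) (x : M) : loc x (X + Y : SmoothField M) =
    loc x X + loc x Y := by
  ext1 u
  exact map_add (toE x _) _ _

theorem loc_smul (r : ℝ) (X : SmoothField M) (x : M) : loc x (r • X : SmoothField M) =
    r • loc x X := by
  ext1 u
  exact map_smul (toE x _) _ _

/-- A linear operator on smooth vector fields, given by smooth linear expressions in charts. -/
def operatorOfCharts (Op : SmoothField M → Field M) (L : M → (R7 → R7) → R7 → R7)
    (h : ∀ (X : SmoothField M) (x y : M), y ∈ (chartAt R7 x).source →
      toE x y (Op X y) = L x (loc x X) (chartAt R7 x y))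
    (hs : ∀ x Y, ContDiffOn ℝ ∞ Y (chartAt R7 x).target →
      ContDiffOn ℝ ∞ (L x Y) (chartAt R7 x).target)
    (hadd : ∀ x Y Z, ContDiffOn ℝ ∞ Y (chartAt R7 x).target →
      ContDiffOn ℝ ∞ Z (chartAt R7 x).target → ∀ u ∈ (chartAt R7 x).target,
        L x (Y + Z) u = L x Y u + L x Z u)
    (hsmul : ∀ x (r : ℝ) Y, ContDiffOn ℝ ∞ Y (chartAt R7 x).target →
      ∀ u ∈ (chartAt R7 x).target, L x (r • Y) u = r • L x Y u) :
    SmoothField M →ₗ[ℝ] SmoothField M where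
  toFun X := ⟨Op X, by
    intro y
    have hy := mem_chart_source R7 y
    refine (contMDiffAt_sec_iff hy (Op X)).2 ?_
    have hnhds := (chartAt R7 y).open_target.mem_nhds (mem_chart_target R7 y)
    refine ((hs y _ (X.contDiffOn_loc y)).contDiffAt hnhds).congr_of_eventuallyEq ?_
    refine eventually_loc hy ?_
    filter_upwards [(chartAt R7 y).open_source.mem_nhds hy] with z hz
    exact ⟨hz, h X y z hz⟩⟩
  map_add' X Y := by
    ext1 y
    have hy := mem_chart_source R7 y
    refine toE_injective hy ?_
    change toE y y (Op (X + Y) y) = toE y y (Op X y + Op Y y)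
    rw [map_add, h _ _ _ hy, h _ _ _ hy, h _ _ _ hy, loc_add]
    exact hadd y _ _ (X.contDiffOn_loc y) (Y.contDiffOn_loc y) _ (mem_chart_target R7 y)
  map_smul' r X := by
    ext1 y
    have hy := mem_chart_source R7 y
    refine toE_injective hy ?_
    change toE y y (Op (r • X) y) = toE y y (r • Op X y)
    rw [map_smul, h _ _ _ hy, h _ _ _ hy, loc_smul]
    exact hsmul y r _ (X.contDiffOn_loc y) _ (mem_chart_target R7 y)

/-- The linearization of the flow: `[X, V] + tr_g (L_X ∇⁰)`. -/
def linearizedField (D0 : AffineConnection M) (σ : ThreeFormField M) (X : SmoothField M) :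
    Field M := fun y =>
  mlieBracket (𝓡 7) X (V (-1 / 2) D0 σ) y +
    ∑ i, lieConnection D0 X y (frame σ y i) (frame σ y i)

/-- The coordinate expression of the linearization. -/
def locLinearized (D0 : AffineConnection M) (σ : ThreeFormField M) (x : M) : (R7 → R7) → R7 → R7 :=
  linE (locMetric σ x) (koszulMap (locMetric σ x)) (christoffel D0 x)

variable [T2Space M] {D0 : AffineConnection M} {σ : ThreeFormField M}

theorem contDiffOn_inv_gram_locMetric (hσ : IsG2Structure σ) (x : M) (j k : Fin 7) :
    ContDiffOn ℝ ∞ (fun w => (gram (locMetric σ x w))⁻¹ j k) (chartAt R7 x).target :=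
  contDiffOn_inv_gram (contDiffOn_locMetric hσ x) (fun _ hu => isUnit_det_gram_locMetric _ hu) j k

theorem contDiffOn_trG_locMetric {F : Type*} [NormedAddCommGroup F] [NormedSpace ℝ F]
    (hσ : IsG2Structure σ) (x : M) {B : R7 → R7 →L[ℝ] R7 →L[ℝ] F}
    (hB : ContDiffOn ℝ ∞ B (chartAt R7 x).target) :
    ContDiffOn ℝ ∞ (fun u => trG (locMetric σ x u) (B u)) (chartAt R7 x).target :=
  contDiffOn_trG (contDiffOn_locMetric hσ x) (fun _ hu => isUnit_det_gram_locMetric σ hu) hB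

theorem toE_linearizedField (hσ : IsG2Structure σ)
    (hD0 : CovariantDerivative.ContMDiffCovariantDerivative D0 ∞) (X : SmoothField M) {x y : M}
    (hy : y ∈ (chartAt R7 x).source) :
    toE x y (linearizedField D0 σ X y) = locLinearized D0 σ x (loc x X) (chartAt R7 x y) := by
  have hu := (chartAt R7 x).map_source hy
  have hnhds := (chartAt R7 x).open_target.mem_nhds hu
  have hΓ := contDiffOn_koszulMap_locMetric hσ x
  have hΓ0 := contDiffOn_christoffel D0 hD0 x
  have hV : loc x (V (-1 / 2) D0 σ) =ᶠ[𝓝 (chartAt R7 x y)] fun u => trG (locMetric σ x u)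
      (koszulMap (locMetric σ x) u - christoffel D0 x u) := by
    refine eventually_loc hy ?_
    filter_upwards [(chartAt R7 x).open_source.mem_nhds hy] with z hz
    exact ⟨hz, toE_V D0 hσ hz⟩
  have hVm := (mdifferentiableAt_sec_iff hy (V (-1 / 2) D0 σ)).2
    ((((contDiffOn_trG_locMetric hσ x (hΓ.sub hΓ0)).contDiffAt hnhds).congr_of_eventuallyEq
      hV).differentiableAt (by simp))
  have hXm := (X.contMDiff y).mdifferentiableAt (n := ∞) (by simp)
  -- The three terms of `linE_eq` are matched with the bracket and with the frame sum of Lie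
  -- derivatives.
  rw [locLinearized, linE_eq
    (fun j k => (((contDiffOn_inv_gram_locMetric hσ x j k).contDiffAt hnhds).differentiableAt
      (by simp)))
    ((hΓ.contDiffAt hnhds).differentiableAt (by simp))
    ((hΓ0.contDiffAt hnhds).differentiableAt (by simp)), linearizedField, map_add,
    mlieBracket_chart hy hXm hVm, hV.fderiv_eq, toE_V D0 hσ hy, ← loc_apply hy, map_sum,
    ← sum_frame σ hy (linTermMap _ _ _ _)]
  refine congrArg₂ _ rfl (Finset.sum_congr rfl fun i _ => ?_)
  rw [toE_lieConnection hy (X.contDiffAt_loc hu) (hΓ0.contDiffAt hnhds)]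
  rfl

/-- The linearization of the flow as a linear operator. -/
def linearizedOperator (hσ : IsG2Structure σ)
    (hD0 : CovariantDerivative.ContMDiffCovariantDerivative D0 ∞) :
    SmoothField M →ₗ[ℝ] SmoothField M :=
  operatorOfCharts (linearizedField D0 σ) (locLinearized D0 σ)
    (fun X _ _ hy => toE_linearizedField hσ hD0 X hy)
    (fun x _ hY => contDiffOn_linE (chartAt R7 x).open_target
      (contDiffOn_inv_gram_locMetric hσ x) (contDiffOn_koszulMap_locMetric hσ x)
      (contDiffOn_christoffel D0 hD0 x) hY)
    (fun x _ _ hY hZ _ hu => linE_add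
      ((hY.contDiffAt ((chartAt R7 x).open_target.mem_nhds hu)).of_le two_le_infty)
      ((hZ.contDiffAt ((chartAt R7 x).open_target.mem_nhds hu)).of_le two_le_infty))
    (fun _ r _ _ _ _ => linE_smul r)

theorem toE_linearizedOperator (hσ : IsG2Structure σ)
    (hD0 : CovariantDerivative.ContMDiffCovariantDerivative D0 ∞) (X : SmoothField M) {x y : M}
    (hy : y ∈ (chartAt R7 x).source) :
    toE x y (linearizedOperator hσ hD0 X y) = locLinearized D0 σ x (loc x X) (chartAt R7 x y) :=
  toE_linearizedField hσ hD0 X hy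

theorem isLinearizationAt_linearizedOperator (hσ : IsG2Structure σ)
    (hD0 : CovariantDerivative.ContMDiffCovariantDerivative D0 ∞) (f : Diffeo M) :
    IsLinearizationAt (flowField (-1 / 2) D0 σ) f (linearizedOperator (hσ.pushForm f) hD0) := by
  intro F hF hF0 X hX y
  have h := hasDerivAt_flowField (D0 := D0) hσ hF hF0 hX y
  have h2 := toE_linearizedOperator (hσ.pushForm f) hD0 X (mem_chart_source R7 y)
  rw [locLinearized] at h2
  rw [← h2] at h
  -- At its own centre a chart identifies tangent vectors with their coordinates, so the derivative
  -- in coordinates is the required one.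
  simp only [toE_self] at h
  exact h

end G2Flow

end

noncomputable section
namespace G2Flow
open Bundle VectorField Filter
open scoped Topology

instance instNormedAddCommGroupCovector : NormedAddCommGroup (R7 →L[ℝ] ℝ) :=
  ContinuousLinearMap.toNormedAddCommGroup

instance instNormedSpaceCovector : NormedSpace ℝ (R7 →L[ℝ] ℝ) :=
  ContinuousLinearMap.toNormedSpace

theorem fderiv_smul_fun {E F : Type*} [NormedAddCommGroup E] [NormedSpace ℝ E]
    [NormedAddCommGroup F] [NormedSpace ℝ F] (r : ℝ) (f : E → F) :
    fderiv ℝ (r • f) = r • fderiv ℝ f := fderiv_const_smul_field r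

/-! ### The Hodge Laplacian in coordinates -/

/-- The covariant derivative of a 1-form in coordinates. -/
def nabMap (Γ : R7 → R7 →L[ℝ] R7 →L[ℝ] R7) (a : R7 → R7 →L[ℝ] ℝ) (u : R7) : Bil :=
  fderiv ℝ a u - ((ContinuousLinearMap.compL ℝ R7 R7 ℝ (a u)).comp (Γ u)).flip

theorem nabMap_apply (Γ : R7 → R7 →L[ℝ] R7 →L[ℝ] R7) (a : R7 → R7 →L[ℝ] ℝ) (u v w : R7) :
    nabMap Γ a u v w = fderiv ℝ a u v w - a u (Γ u w v) := rfl

/-- The codifferential of a 1-form in coordinates. -/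
def codiffE (g : R7 → Bil) (Γ : R7 → R7 →L[ℝ] R7 →L[ℝ] R7) (a : R7 → R7 →L[ℝ] ℝ) (u : R7) : ℝ :=
  -trG (g u) (nabMap Γ a u)

/-- The exterior derivative of a 1-form in coordinates. -/
def dMap (a : R7 → R7 →L[ℝ] ℝ) (u : R7) : Bil := fderiv ℝ a u - (fderiv ℝ a u).flip

theorem dMap_apply (a : R7 → R7 →L[ℝ] ℝ) (u v w : R7) :
    dMap a u v w = fderiv ℝ a u v w - fderiv ℝ a u w v := rfl

/-- The covariant derivative of a 2-form in coordinates. -/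
def nabMap2 (Γ : R7 → R7 →L[ℝ] R7 →L[ℝ] R7) (b : R7 → Bil) (u : R7) :
    R7 →L[ℝ] R7 →L[ℝ] R7 →L[ℝ] ℝ :=
  (LinearMap.mk₂ ℝ (fun v x => fderiv ℝ b u v x - b u (Γ u x v) - (b u x).comp ((Γ u).flip v))
    (fun v v' x => by
      ext w
      simp only [map_add, add_apply, sub_apply, ContinuousLinearMap.comp_apply]; ring)
    (fun r v x => by
      ext w
      simp only [map_smul, smul_apply, sub_apply, ContinuousLinearMap.comp_apply, smul_eq_mul]
      ring)
    (fun v x x' => by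
      ext w
      simp only [map_add, add_apply, sub_apply, ContinuousLinearMap.comp_apply]; ring)
    (fun r v x => by
      ext w
      simp only [map_smul, smul_apply, sub_apply, ContinuousLinearMap.comp_apply, smul_eq_mul]
      ring)).toContinuousBilinearMap

theorem nabMap2_apply (Γ : R7 → R7 →L[ℝ] R7 →L[ℝ] R7) (b : R7 → Bil) (u v x w : R7) :
    nabMap2 Γ b u v x w = fderiv ℝ b u v x w - b u (Γ u x v) w - b u x (Γ u w v) := rfl

/-- The Hodge Laplacian of a 1-form in coordinates. -/
def hodgeMap (g : R7 → Bil) (Γ : R7 → R7 →L[ℝ] R7 →L[ℝ] R7) (a : R7 → R7 →L[ℝ] ℝ) (u : R7) :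
    R7 →L[ℝ] ℝ :=
  fderiv ℝ (codiffE g Γ a) u - trG (g u) (nabMap2 Γ (dMap a) u)

/-- The 1-form dual to a vector field. -/
def lowerE (g : R7 → Bil) (X : R7 → R7) (u : R7) : R7 →L[ℝ] ℝ := g u (X u)

/-- The vector dual to a covector. -/
def raiseE (g : Bil) (α : R7 →L[ℝ] ℝ) : R7 := trG g (α.smulRight (ContinuousLinearMap.id ℝ R7))

/-- The Hodge Laplacian on vector fields in coordinates. -/
def laplE (g : R7 → Bil) (Γ : R7 → R7 →L[ℝ] R7 →L[ℝ] R7) (X : R7 → R7) (u : R7) : R7 :=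
  raiseE (g u) (hodgeMap g Γ (lowerE g X) u)

theorem raiseE_add (g : Bil) (α β : R7 →L[ℝ] ℝ) : raiseE g (α + β) = raiseE g α + raiseE g β := by
  rw [raiseE, raiseE, raiseE, ← trG_add]
  congr 1
  ext v w : 2
  simp [add_smul]

theorem raiseE_smul (g : Bil) (r : ℝ) (α : R7 →L[ℝ] ℝ) : raiseE g (r • α) = r • raiseE g α := by
  rw [raiseE, raiseE, ← trG_smul]
  congr 1
  ext v w : 2
  simp [smul_smul]

theorem lowerE_add (g : R7 → Bil) (X Y : R7 → R7) :
    lowerE g (X + Y) = lowerE g X + lowerE g Y := by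
  ext1 u
  simp [lowerE]

theorem lowerE_smul (g : R7 → Bil) (r : ℝ) (X : R7 → R7) :
    lowerE g (r • X) = r • lowerE g X := by
  ext1 u
  simp [lowerE]

variable {g : R7 → Bil} {Γ : R7 → R7 →L[ℝ] R7 →L[ℝ] R7} {s : Set R7}

theorem contDiffOn_lowerE {X : R7 → R7} (hg : ContDiffOn ℝ ∞ g s) (hX : ContDiffOn ℝ ∞ X s) :
    ContDiffOn ℝ ∞ (lowerE g X) s := hg.clm_apply hX

theorem contDiffOn_nabMap {a : R7 → R7 →L[ℝ] ℝ} (hs : IsOpen s) (hΓ : ContDiffOn ℝ ∞ Γ s)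
    (ha : ContDiffOn ℝ ∞ a s) : ContDiffOn ℝ ∞ (nabMap Γ a) s := by
  have ha1 := ha.fderiv_of_isOpen hs (m := ∞) (by simp)
  refine contDiffOn_clm_apply.2 fun v => contDiffOn_clm_apply.2 fun w => ?_
  simp only [nabMap_apply]
  exact ((ha1.clm_apply contDiffOn_const).clm_apply contDiffOn_const).sub
    (ha.clm_apply ((hΓ.clm_apply contDiffOn_const).clm_apply contDiffOn_const))

theorem contDiffOn_dMap {a : R7 → R7 →L[ℝ] ℝ} (hs : IsOpen s)
    (ha : ContDiffOn ℝ ∞ a s) : ContDiffOn ℝ ∞ (dMap a) s := by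
  have ha1 := ha.fderiv_of_isOpen hs (m := ∞) (by simp)
  refine contDiffOn_clm_apply.2 fun v => contDiffOn_clm_apply.2 fun w => ?_
  simp only [dMap_apply]
  exact ((ha1.clm_apply contDiffOn_const).clm_apply contDiffOn_const).sub
    ((ha1.clm_apply contDiffOn_const).clm_apply contDiffOn_const)

theorem contDiffOn_nabMap2 {b : R7 → Bil} (hs : IsOpen s) (hΓ : ContDiffOn ℝ ∞ Γ s)
    (hb : ContDiffOn ℝ ∞ b s) : ContDiffOn ℝ ∞ (nabMap2 Γ b) s := by
  have hb1 := hb.fderiv_of_isOpen hs (m := ∞) (by simp)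
  refine contDiffOn_clm_apply.2 fun v => contDiffOn_clm_apply.2 fun w =>
    contDiffOn_clm_apply.2 fun x => ?_
  simp only [nabMap2_apply]
  exact ((((hb1.clm_apply contDiffOn_const).clm_apply contDiffOn_const).clm_apply
    contDiffOn_const).sub
    ((hb.clm_apply ((hΓ.clm_apply contDiffOn_const).clm_apply contDiffOn_const)).clm_apply
      contDiffOn_const)).sub
    ((hb.clm_apply contDiffOn_const).clm_apply
      ((hΓ.clm_apply contDiffOn_const).clm_apply contDiffOn_const))

theorem contDiffOn_codiffE {a : R7 → R7 →L[ℝ] ℝ} (hs : IsOpen s) (hg : ContDiffOn ℝ ∞ g s)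
    (hu : ∀ u ∈ s, IsUnit (gram (g u)).det) (hΓ : ContDiffOn ℝ ∞ Γ s)
    (ha : ContDiffOn ℝ ∞ a s) : ContDiffOn ℝ ∞ (codiffE g Γ a) s :=
  (contDiffOn_trG hg hu (contDiffOn_nabMap hs hΓ ha)).neg

theorem contDiffOn_hodgeMap {a : R7 → R7 →L[ℝ] ℝ} (hs : IsOpen s) (hg : ContDiffOn ℝ ∞ g s)
    (hu : ∀ u ∈ s, IsUnit (gram (g u)).det) (hΓ : ContDiffOn ℝ ∞ Γ s)
    (ha : ContDiffOn ℝ ∞ a s) : ContDiffOn ℝ ∞ (hodgeMap g Γ a) s :=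
  ((contDiffOn_codiffE hs hg hu hΓ ha).fderiv_of_isOpen hs (m := ∞) (by simp)).sub
    (contDiffOn_trG hg hu (contDiffOn_nabMap2 hs hΓ (contDiffOn_dMap hs ha)))

theorem contDiffOn_raiseE {α : R7 → R7 →L[ℝ] ℝ} (hg : ContDiffOn ℝ ∞ g s)
    (hu : ∀ u ∈ s, IsUnit (gram (g u)).det) (hα : ContDiffOn ℝ ∞ α s) :
    ContDiffOn ℝ ∞ (fun u => raiseE (g u) (α u)) s := by
  refine contDiffOn_trG hg hu (contDiffOn_clm_apply.2 fun v => ?_)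
  exact (hα.clm_apply contDiffOn_const).smul contDiffOn_const

theorem contDiffOn_laplE {X : R7 → R7} (hs : IsOpen s) (hg : ContDiffOn ℝ ∞ g s)
    (hu : ∀ u ∈ s, IsUnit (gram (g u)).det) (hΓ : ContDiffOn ℝ ∞ Γ s)
    (hX : ContDiffOn ℝ ∞ X s) : ContDiffOn ℝ ∞ (laplE g Γ X) s :=
  contDiffOn_raiseE hg hu (contDiffOn_hodgeMap hs hg hu hΓ (contDiffOn_lowerE hg hX))

theorem codiffE_add {a b : R7 → R7 →L[ℝ] ℝ} {u : R7} (ha : DifferentiableAt ℝ a u)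
    (hb : DifferentiableAt ℝ b u) : codiffE g Γ (a + b) u = codiffE g Γ a u + codiffE g Γ b u := by
  rw [codiffE, codiffE, codiffE, ← neg_add, ← trG_add]
  congr 2
  ext v w
  simp only [nabMap_apply, add_apply, fderiv_add ha hb, Pi.add_apply]
  ring

theorem codiffE_smul {a : R7 → R7 →L[ℝ] ℝ} {u : R7} (r : ℝ) :
    codiffE g Γ (r • a) u = r • codiffE g Γ a u := by
  rw [codiffE, codiffE, smul_neg, ← trG_smul]
  congr 2
  have hr : fderiv ℝ (r • a) = r • fderiv ℝ a := fderiv_smul_fun r a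
  ext v w
  simp only [nabMap_apply, smul_apply, hr, Pi.smul_apply, smul_eq_mul]
  ring

theorem dMap_add {a b : R7 → R7 →L[ℝ] ℝ} {u : R7} (ha : DifferentiableAt ℝ a u)
    (hb : DifferentiableAt ℝ b u) : dMap (a + b) u = dMap a u + dMap b u := by
  ext v w
  simp only [dMap_apply, add_apply, fderiv_add ha hb]
  ring

theorem dMap_smul (a : R7 → R7 →L[ℝ] ℝ) (r : ℝ) : dMap (r • a) = r • dMap a := by
  have hr : fderiv ℝ (r • a) = r • fderiv ℝ a := fderiv_smul_fun r a
  ext u v w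
  simp only [dMap_apply, smul_apply, hr, Pi.smul_apply, smul_eq_mul]
  ring

theorem hodgeMap_add {a b : R7 → R7 →L[ℝ] ℝ} (hs : IsOpen s) (hg : ContDiffOn ℝ ∞ g s)
    (hu : ∀ u ∈ s, IsUnit (gram (g u)).det) (hΓ : ContDiffOn ℝ ∞ Γ s)
    (ha : ContDiffOn ℝ ∞ a s) (hb : ContDiffOn ℝ ∞ b s) {u : R7} (hus : u ∈ s) :
    hodgeMap g Γ (a + b) u = hodgeMap g Γ a u + hodgeMap g Γ b u := by
  have hn := hs.mem_nhds hus
  have hd : ∀ {E : Type} [NormedAddCommGroup E] [NormedSpace ℝ E] {f : R7 → E},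
      ContDiffOn ℝ ∞ f s → ∀ w ∈ s, DifferentiableAt ℝ f w := fun hf w hw =>
    (hf.contDiffAt (hs.mem_nhds hw)).differentiableAt (by simp)
  have h1 : codiffE g Γ (a + b) =ᶠ[𝓝 u] codiffE g Γ a + codiffE g Γ b := by
    filter_upwards [hn] with w hw
    exact codiffE_add (hd ha w hw) (hd hb w hw)
  have h2 : dMap (a + b) =ᶠ[𝓝 u] dMap a + dMap b := by
    filter_upwards [hn] with w hw
    exact dMap_add (hd ha w hw) (hd hb w hw)
  have h3 : nabMap2 Γ (dMap (a + b)) u = nabMap2 Γ (dMap a) u + nabMap2 Γ (dMap b) u := by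
    ext v x w
    simp only [nabMap2_apply, add_apply, h2.fderiv_eq, h2.self_of_nhds,
      fderiv_add (hd (contDiffOn_dMap hs ha) u hus) (hd (contDiffOn_dMap hs hb) u hus),
      Pi.add_apply]
    ring
  rw [hodgeMap, h1.fderiv_eq, fderiv_add (hd (contDiffOn_codiffE hs hg hu hΓ ha) u hus)
    (hd (contDiffOn_codiffE hs hg hu hΓ hb) u hus), h3, trG_add, hodgeMap, hodgeMap]
  abel

theorem hodgeMap_smul {a : R7 → R7 →L[ℝ] ℝ} {u : R7} (r : ℝ) :
    hodgeMap g Γ (r • a) u = r • hodgeMap g Γ a u := by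
  have h1 : codiffE g Γ (r • a) = r • codiffE g Γ a := by
    ext1 w
    exact codiffE_smul r
  have h3 : nabMap2 Γ (dMap (r • a)) u = r • nabMap2 Γ (dMap a) u := by
    have hr : fderiv ℝ (r • dMap a) = r • fderiv ℝ (dMap a) := fderiv_smul_fun r (dMap a)
    ext v x w
    simp only [nabMap2_apply, smul_apply, dMap_smul, hr, Pi.smul_apply,
      smul_eq_mul]
    ring
  have hr : fderiv ℝ (r • codiffE g Γ a) = r • fderiv ℝ (codiffE g Γ a) :=
    fderiv_smul_fun r (codiffE g Γ a)
  rw [hodgeMap, h1, hr, h3, trG_smul, hodgeMap, smul_sub]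
  rfl

theorem laplE_add {X Y : R7 → R7} (hs : IsOpen s) (hg : ContDiffOn ℝ ∞ g s)
    (hu : ∀ u ∈ s, IsUnit (gram (g u)).det) (hΓ : ContDiffOn ℝ ∞ Γ s)
    (hX : ContDiffOn ℝ ∞ X s) (hY : ContDiffOn ℝ ∞ Y s) {u : R7} (hus : u ∈ s) :
    laplE g Γ (X + Y) u = laplE g Γ X u + laplE g Γ Y u := by
  rw [laplE, lowerE_add, hodgeMap_add hs hg hu hΓ (contDiffOn_lowerE hg hX)
    (contDiffOn_lowerE hg hY) hus, raiseE_add]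
  rfl

theorem laplE_smul {X : R7 → R7} {u : R7} (r : ℝ) :
    laplE g Γ (r • X) u = r • laplE g Γ X u := by
  rw [laplE, lowerE_smul, hodgeMap_smul, raiseE_smul]
  rfl

end G2Flow

end

noncomputable section
namespace G2Flow
open Bundle VectorField Filter
open scoped Topology

variable {M : Type*} [TopologicalSpace M] [ChartedSpace R7 M] [IsManifold (𝓡 7) ∞ M]

/-! ### The Hodge Laplacian in charts -/

theorem eventuallyEq_comp_chart_symm {F : Type*} {x y : M} (hy : y ∈ (chartAt R7 x).source)
    {h : M → F} {f : R7 → F} (hf : ∀ z ∈ (chartAt R7 x).source, h z = f (chartAt R7 x z)) :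
    h ∘ (chartAt R7 x).symm =ᶠ[𝓝 (chartAt R7 x y)] f := by
  filter_upwards [(chartAt R7 x).open_target.mem_nhds ((chartAt R7 x).map_source hy)] with w hw
  rw [Function.comp_apply, hf _ ((chartAt R7 x).map_target hw), (chartAt R7 x).right_inv hw]

theorem differentiableAt_loc_ext {x y : M} (hy : y ∈ (chartAt R7 x).source) (w : T y) :
    DifferentiableAt ℝ (loc x (ext w)) (chartAt R7 x y) :=
  ((contMDiffAt_sec_iff hy _).1 (contMDiffAt_ext w)).differentiableAt (by simp)

theorem loc_ext {x y : M} (hy : y ∈ (chartAt R7 x).source) (w : T y) :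
    loc x (ext w) (chartAt R7 x y) = toE x y w := by
  rw [loc_apply hy, ext_self]

variable {α : OneForm M} {β : TwoForm M} {x : M} {a : R7 → R7 →L[ℝ] ℝ} {b : R7 → Bil}

theorem mvfderiv_oneForm
    (hα : ∀ y ∈ (chartAt R7 x).source, ∀ w, α y w = a (chartAt R7 x y) (toE x y w)) {y : M}
    (hy : y ∈ (chartAt R7 x).source) (ha : DifferentiableAt ℝ a (chartAt R7 x y)) (v w : T y) :
    mvfderiv (𝓡 7) (fun z => α z (ext w z)) y v =
      fderiv ℝ a (chartAt R7 x y) (toE x y v) (toE x y w) +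
        a (chartAt R7 x y) (fderiv ℝ (loc x (ext w)) (chartAt R7 x y) (toE x y v)) := by
  have h1 : (fun z => α z (ext w z)) ∘ (chartAt R7 x).symm =ᶠ[𝓝 (chartAt R7 x y)]
      fun u => a u (loc x (ext w) u) := by
    refine eventuallyEq_comp_chart_symm hy fun z hz => ?_
    rw [hα z hz, loc_apply hz]
  have h2 := (ha.hasFDerivAt.clm_apply (differentiableAt_loc_ext hy w).hasFDerivAt).fderiv
  rw [mvfderiv_chart hy, h1.fderiv_eq, h2]
  simp only [add_apply, ContinuousLinearMap.comp_apply, ContinuousLinearMap.flip_apply,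
    loc_ext hy]
  ring

theorem nabla1_chart (D : AffineConnection M)
    (hα : ∀ y ∈ (chartAt R7 x).source, ∀ w, α y w = a (chartAt R7 x y) (toE x y w)) {y : M}
    (hy : y ∈ (chartAt R7 x).source) (ha : DifferentiableAt ℝ a (chartAt R7 x y)) (v w : T y) :
    nabla1 D α y v w = nabMap (christoffel D x) a (chartAt R7 x y) (toE x y v) (toE x y w) := by
  rw [nabla1, mvfderiv_oneForm hα hy ha, hα y hy,
    toE_connection D hy ((contMDiffAt_ext w).mdifferentiableAt (by simp)), ext_self,
    nabMap_apply, map_add]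
  ring

theorem dOne_chart
    (hα : ∀ y ∈ (chartAt R7 x).source, ∀ w, α y w = a (chartAt R7 x y) (toE x y w)) {y : M}
    (hy : y ∈ (chartAt R7 x).source) (ha : DifferentiableAt ℝ a (chartAt R7 x y)) (v w : T y) :
    dOne α y v w = dMap a (chartAt R7 x y) (toE x y v) (toE x y w) := by
  rw [dOne, mvfderiv_oneForm hα hy ha, mvfderiv_oneForm hα hy ha, hα y hy,
    mlieBracket_chart hy ((contMDiffAt_ext v).mdifferentiableAt (n := ∞) (by simp))
      ((contMDiffAt_ext w).mdifferentiableAt (n := ∞) (by simp)), ext_self, ext_self,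
    dMap_apply, map_sub]
  ring

theorem nabla2_chart (D : AffineConnection M)
    (hβ : ∀ y ∈ (chartAt R7 x).source, ∀ v w,
      β y v w = b (chartAt R7 x y) (toE x y v) (toE x y w)) {y : M}
    (hy : y ∈ (chartAt R7 x).source) (hb : DifferentiableAt ℝ b (chartAt R7 x y))
    (v w z : T y) : nabla2 D β y v w z =
      nabMap2 (christoffel D x) b (chartAt R7 x y) (toE x y v) (toE x y w) (toE x y z) := by
  have h1 : (fun q => β q (ext w q) (ext z q)) ∘ (chartAt R7 x).symm =ᶠ[𝓝 (chartAt R7 x y)]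
      fun u => b u (loc x (ext w) u) (loc x (ext z) u) := by
    refine eventuallyEq_comp_chart_symm hy fun q hq => ?_
    rw [hβ q hq, loc_apply hq, loc_apply hq]
  have h2 := ((hb.hasFDerivAt.clm_apply (differentiableAt_loc_ext hy w).hasFDerivAt).clm_apply
    (differentiableAt_loc_ext hy z).hasFDerivAt).fderiv
  rw [nabla2, mvfderiv_chart hy, h1.fderiv_eq, h2, hβ y hy, hβ y hy,
    toE_connection D hy ((contMDiffAt_ext w).mdifferentiableAt (by simp)),
    toE_connection D hy ((contMDiffAt_ext z).mdifferentiableAt (by simp)), nabMap2_apply]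
  simp only [add_apply, ContinuousLinearMap.comp_apply, ContinuousLinearMap.flip_apply,
    loc_ext hy, ext_self, map_add]
  ring

theorem sharp_chart (σ : ThreeFormField M) {y : M} (hy : y ∈ (chartAt R7 x).source)
    {c : R7 →L[ℝ] ℝ} (hα : ∀ w, α y w = c (toE x y w)) :
    toE x y (sharp σ α y) = raiseE (locMetric σ x (chartAt R7 x y)) c := by
  rw [sharp, map_sum, raiseE, ← sum_frame σ hy]
  refine Finset.sum_congr rfl fun i _ => ?_
  rw [map_smul, hα]
  rfl

theorem flat_chart (σ : ThreeFormField M) (X : Field M) {y : M}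
    (hy : y ∈ (chartAt R7 x).source) (w : T y) :
    flat σ X y w = lowerE (locMetric σ x) (loc x X) (chartAt R7 x y) (toE x y w) := by
  rw [flat, metric_eq_locMetric σ hy, lowerE, loc_apply hy]

variable [T2Space M] {σ : ThreeFormField M}

theorem codiffE_congr {g : R7 → Bil} {Γ Γ' : R7 → R7 →L[ℝ] R7 →L[ℝ] R7} {u : R7}
    (h : Γ u = Γ' u) : codiffE g Γ a u = codiffE g Γ' a u := by
  simp only [codiffE, nabMap, h]

theorem coDiff1_chart (D0 : AffineConnection M) (hσ : IsG2Structure σ)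
    (hα : ∀ y ∈ (chartAt R7 x).source, ∀ w, α y w = a (chartAt R7 x y) (toE x y w)) {y : M}
    (hy : y ∈ (chartAt R7 x).source) (ha : DifferentiableAt ℝ a (chartAt R7 x y)) :
    coDiff1 σ (leviCivita D0 σ) α y =
      codiffE (locMetric σ x) (koszulMap (locMetric σ x)) a (chartAt R7 x y) := by
  rw [← codiffE_congr (christoffel_leviCivita D0 hσ ((chartAt R7 x).map_source hy)), coDiff1,
    codiffE, ← sum_frame σ hy]
  simp only [nabla1_chart _ hα hy ha]

theorem coDiff2_chart (D0 : AffineConnection M) (hσ : IsG2Structure σ)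
    (hβ : ∀ y ∈ (chartAt R7 x).source, ∀ v w,
      β y v w = b (chartAt R7 x y) (toE x y v) (toE x y w)) {y : M}
    (hy : y ∈ (chartAt R7 x).source) (hb : DifferentiableAt ℝ b (chartAt R7 x y)) (w : T y) :
    coDiff2 σ (leviCivita D0 σ) β y w = -trG (locMetric σ x (chartAt R7 x y))
      (nabMap2 (koszulMap (locMetric σ x)) b (chartAt R7 x y)) (toE x y w) := by
  have h : nabMap2 (koszulMap (locMetric σ x)) b (chartAt R7 x y) =
      nabMap2 (christoffel (leviCivita D0 σ) x) b (chartAt R7 x y) := by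
    simp only [nabMap2, christoffel_leviCivita D0 hσ ((chartAt R7 x).map_source hy)]
  rw [h, coDiff2, ← sum_frame σ hy, sum_apply]
  simp only [nabla2_chart _ hβ hy hb]

theorem hodgeLaplacian_chart (D0 : AffineConnection M) (hσ : IsG2Structure σ)
    (hα : ∀ y ∈ (chartAt R7 x).source, ∀ w, α y w = a (chartAt R7 x y) (toE x y w))
    (ha : ContDiffOn ℝ ∞ a (chartAt R7 x).target) {y : M} (hy : y ∈ (chartAt R7 x).source)
    (w : T y) : hodgeLaplacian D0 σ α y w =
      hodgeMap (locMetric σ x) (koszulMap (locMetric σ x)) a (chartAt R7 x y) (toE x y w) := by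
  have hd : ∀ z ∈ (chartAt R7 x).source, DifferentiableAt ℝ a (chartAt R7 x z) := fun z hz =>
    (ha.contDiffAt ((chartAt R7 x).open_target.mem_nhds
      ((chartAt R7 x).map_source hz))).differentiableAt (by simp)
  have hb : DifferentiableAt ℝ (dMap a) (chartAt R7 x y) :=
    ((contDiffOn_dMap (chartAt R7 x).open_target ha).contDiffAt
      ((chartAt R7 x).open_target.mem_nhds ((chartAt R7 x).map_source hy))).differentiableAt
        (by simp)
  have h1 := eventuallyEq_comp_chart_symm hy (fun z hz => coDiff1_chart D0 hσ hα hz (hd z hz))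
  rw [hodgeLaplacian, mvfderiv_chart hy, h1.fderiv_eq,
    coDiff2_chart D0 hσ (fun z hz v w => dOne_chart hα hz (hd z hz) v w) hy hb, hodgeMap, sub_apply,
    sub_eq_add_neg]

theorem toE_sharp_hodgeLaplacian_flat (D0 : AffineConnection M) (hσ : IsG2Structure σ)
    (X : SmoothField M) {y : M} (hy : y ∈ (chartAt R7 x).source) :
    toE x y (sharp σ (hodgeLaplacian D0 σ (flat σ X)) y) =
      laplE (locMetric σ x) (koszulMap (locMetric σ x)) (loc x X) (chartAt R7 x y) :=
  sharp_chart σ hy fun w => hodgeLaplacian_chart D0 hσ (fun _ hz v => flat_chart σ X hz v)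
    (contDiffOn_lowerE (contDiffOn_locMetric hσ x) (X.contDiffOn_loc x)) hy w

/-- The Hodge Laplacian as an operator on vector fields. -/
def hodgeOperator (D0 : AffineConnection M) (hσ : IsG2Structure σ) :
    SmoothField M →ₗ[ℝ] SmoothField M :=
  operatorOfCharts (fun X => sharp σ (hodgeLaplacian D0 σ (flat σ X)))
    (fun x => laplE (locMetric σ x) (koszulMap (locMetric σ x)))
    (fun X _ _ hy => toE_sharp_hodgeLaplacian_flat D0 hσ X hy)
    (fun x _ hY => contDiffOn_laplE (chartAt R7 x).open_target (contDiffOn_locMetric hσ x)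
      (fun _ hu => isUnit_det_gram_locMetric σ hu) (contDiffOn_koszulMap_locMetric hσ x) hY)
    (fun x _ _ hY hZ _ hu => laplE_add (chartAt R7 x).open_target (contDiffOn_locMetric hσ x)
      (fun _ hu => isUnit_det_gram_locMetric σ hu) (contDiffOn_koszulMap_locMetric hσ x) hY hZ hu)
    (fun _ r _ _ _ _ => laplE_smul r)

theorem hodgeOperator_apply (D0 : AffineConnection M) (hσ : IsG2Structure σ)
    (X : SmoothField M) (y : M) :
    hodgeOperator D0 hσ X y = sharp σ (hodgeLaplacian D0 σ (flat σ X)) y := rfl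

theorem toE_hodgeOperator (D0 : AffineConnection M) (hσ : IsG2Structure σ)
    (X : SmoothField M) {y : M} (hy : y ∈ (chartAt R7 x).source) :
    toE x y (hodgeOperator D0 hσ X y) =
      laplE (locMetric σ x) (koszulMap (locMetric σ x)) (loc x X) (chartAt R7 x y) :=
  toE_sharp_hodgeLaplacian_flat D0 hσ X hy

end G2Flow

end

noncomputable section
namespace G2Flow
open Bundle VectorField Filter
open scoped Topology

/-! ### Leading parts -/

section Jets

variable {g : R7 → Bil} {Γ Γ0 : R7 → R7 →L[ℝ] R7 →L[ℝ] R7} {s : Set R7} {u : R7}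

/-- The second-order part contains neither connection, only the metric trace of the second
derivatives. -/
theorem linE_of_jet {X : R7 → R7} (h0 : X u = 0) (h1 : fderiv ℝ X u = 0) :
    linE g Γ Γ0 X u = trG (g u) (fderiv ℝ (fderiv ℝ X) u) := by
  simp [linE, linTerm, trG, h0, h1]

theorem fderiv_smul_of_eq_zero {F : Type*} [NormedAddCommGroup F] [NormedSpace ℝ F] {c : R7 → ℝ}
    {f : R7 → F} (hc : DifferentiableAt ℝ c u) (hf : DifferentiableAt ℝ f u) (h0 : f u = 0) :
    HasFDerivAt (fun w => c w • f w) (c u • fderiv ℝ f u) u := by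
  have h := hc.hasFDerivAt.smul hf.hasFDerivAt
  rw [h0, ContinuousLinearMap.smulRight_zero, add_zero] at h
  exact h

theorem fderiv_clm_apply_of_eq_zero {E F : Type*} [NormedAddCommGroup E] [NormedSpace ℝ E]
    [NormedAddCommGroup F] [NormedSpace ℝ F] {c : R7 → E →L[ℝ] F}
    {f : R7 → E} (hc : DifferentiableAt ℝ c u) (hf : DifferentiableAt ℝ f u) (h0 : f u = 0)
    (v : R7) : fderiv ℝ (fun w => c w (f w)) u v = c u (fderiv ℝ f u v) := by
  rw [(hc.hasFDerivAt.clm_apply hf.hasFDerivAt).fderiv]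
  simp [h0]

theorem fderiv_apply_const {E F : Type*} [NormedAddCommGroup E] [NormedSpace ℝ E]
    [NormedAddCommGroup F] [NormedSpace ℝ F] {c : R7 → E →L[ℝ] F}
    (hc : DifferentiableAt ℝ c u) (v : R7) (x : E) :
    fderiv ℝ (fun w => c w x) u v = fderiv ℝ c u v x := by
  rw [(hc.hasFDerivAt.clm_apply (hasFDerivAt_const x u)).fderiv]
  simp

theorem differentiableAt_of_contDiffOn {F : Type*} [NormedAddCommGroup F] [NormedSpace ℝ F]
    {f : R7 → F} (hs : IsOpen s) (hf : ContDiffOn ℝ ∞ f s) (hu : u ∈ s) :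
    DifferentiableAt ℝ f u :=
  (hf.contDiffAt (hs.mem_nhds hu)).differentiableAt (by simp)

/-- Where `B` vanishes, the derivative of the inverse Gram matrix does not contribute. -/
theorem fderiv_trG_of_eq_zero {F : Type*} [NormedAddCommGroup F] [NormedSpace ℝ F]
    {B : R7 → R7 →L[ℝ] R7 →L[ℝ] F} (hs : IsOpen s) (hg : ContDiffOn ℝ ∞ g s)
    (hu : ∀ u ∈ s, IsUnit (gram (g u)).det) (hB : DifferentiableAt ℝ B u) (hus : u ∈ s)
    (h0 : B u = 0) (v : R7) :
    fderiv ℝ (fun w => trG (g w) (B w)) u v = trG (g u) (fderiv ℝ B u v) := by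
  have hBj : ∀ j k, DifferentiableAt ℝ (fun w => B w (e j) (e k)) u := fun j k =>
    (hB.clm_apply (differentiableAt_const _)).clm_apply (differentiableAt_const _)
  have h := HasFDerivAt.fun_sum (u := Finset.univ) fun j _ =>
    HasFDerivAt.fun_sum (u := Finset.univ) fun k _ => fderiv_smul_of_eq_zero (u := u)
      (differentiableAt_of_contDiffOn hs (contDiffOn_inv_gram hg hu j k) hus) (hBj j k)
      (by simp [h0])
  simp only [trG]
  rw [h.fderiv, sum_apply]
  refine Finset.sum_congr rfl fun j _ => ?_
  rw [sum_apply]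
  refine Finset.sum_congr rfl fun k _ => ?_
  rw [smul_apply, fderiv_apply_const (hB.clm_apply (differentiableAt_const _)),
    fderiv_apply_const hB]

theorem fderiv_lowerE_of_jet {X : R7 → R7} (hg : DifferentiableAt ℝ g u)
    (hX : DifferentiableAt ℝ X u) (h0 : X u = 0) (v w : R7) :
    fderiv ℝ (lowerE g X) u v w = g u (fderiv ℝ X u v) w := by
  rw [show lowerE g X = fun w => g w (X w) from rfl, fderiv_clm_apply_of_eq_zero hg hX h0]

theorem fderiv_fderiv_lowerE_of_jet {X : R7 → R7} (hs : IsOpen s) (hg : ContDiffOn ℝ ∞ g s)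
    (hX : ContDiffOn ℝ ∞ X s) (hus : u ∈ s) (h0 : X u = 0) (h1 : fderiv ℝ X u = 0) (v w z : R7) :
    fderiv ℝ (fderiv ℝ (lowerE g X)) u v w z = g u (fderiv ℝ (fderiv ℝ X) u v w) z := by
  have hn := hs.mem_nhds hus
  have hg1 := hg.fderiv_of_isOpen hs (m := ∞) (by simp)
  have hX1 := hX.fderiv_of_isOpen hs (m := ∞) (by simp)
  have ha1 := (contDiffOn_lowerE hg hX).fderiv_of_isOpen hs (m := ∞) (by simp)
  have hd1 := differentiableAt_of_contDiffOn hs ha1 hus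
  have h : (fun p => fderiv ℝ (lowerE g X) p w) =ᶠ[𝓝 u]
      (fun p => fderiv ℝ g p w (X p)) + fun p => g p (fderiv ℝ X p w) := by
    filter_upwards [hn] with p hp
    have := ((differentiableAt_of_contDiffOn hs hg hp).hasFDerivAt.clm_apply
      (differentiableAt_of_contDiffOn hs hX hp).hasFDerivAt).fderiv
    rw [show lowerE g X = fun w => g w (X w) from rfl, this]
    simp [add_comm]
  have hgw : DifferentiableAt ℝ (fun p => fderiv ℝ g p w) u :=
    (differentiableAt_of_contDiffOn hs hg1 hus).clm_apply (differentiableAt_const _)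
  have hXw : DifferentiableAt ℝ (fun p => fderiv ℝ X p w) u :=
    (differentiableAt_of_contDiffOn hs hX1 hus).clm_apply (differentiableAt_const _)
  have hgu := differentiableAt_of_contDiffOn hs hg hus
  have hXu := differentiableAt_of_contDiffOn hs hX hus
  rw [← fderiv_apply_const hd1, h.fderiv_eq, fderiv_add (hgw.clm_apply hXu) (hgu.clm_apply hXw),
    add_apply, fderiv_clm_apply_of_eq_zero hgw hXu h0,
    fderiv_clm_apply_of_eq_zero hgu hXw (by simp [h1]),
    fderiv_apply_const (differentiableAt_of_contDiffOn hs hX1 hus), h1]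
  simp

/-- All Christoffel terms are of lower order. The term `dd^*` leaves `-g^{jk} ∂_w ∂_j a_k`, the term
`d^*d` leaves `-g^{jk} (∂_j ∂_k a_w - ∂_j ∂_w a_k)`; the mixed derivatives cancel by symmetry. -/
theorem hodgeMap_of_jet {a : R7 → R7 →L[ℝ] ℝ} (hs : IsOpen s) (hg : ContDiffOn ℝ ∞ g s)
    (hu : ∀ u ∈ s, IsUnit (gram (g u)).det) (hΓ : ContDiffOn ℝ ∞ Γ s)
    (ha : ContDiffOn ℝ ∞ a s) (hus : u ∈ s) (h0 : a u = 0) (h1 : fderiv ℝ a u = 0) :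
    hodgeMap g Γ a u = -trG (g u) (fderiv ℝ (fderiv ℝ a) u) := by
  have ha1 := ha.fderiv_of_isOpen hs (m := ∞) (by simp)
  have hau := differentiableAt_of_contDiffOn hs ha hus
  have hau1 := differentiableAt_of_contDiffOn hs ha1 hus
  have hsymm : IsSymmSndFDerivAt ℝ a u :=
    (ha.contDiffAt (hs.mem_nhds hus)).isSymmSndFDerivAt (by simp [two_le_infty])
  have hΓu := differentiableAt_of_contDiffOn hs hΓ hus
  have hnab := differentiableAt_of_contDiffOn hs (contDiffOn_nabMap hs hΓ ha) hus
  have hd := differentiableAt_of_contDiffOn hs (contDiffOn_dMap hs ha) hus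
  have hn0 : nabMap Γ a u = 0 := by
    ext v w
    simp [nabMap_apply, h0, h1]
  have hd0 : dMap a u = 0 := by
    ext v w
    simp [dMap_apply, h1]
  have hn1 : ∀ v, fderiv ℝ (nabMap Γ a) u v = fderiv ℝ (fderiv ℝ a) u v := by
    intro v
    ext w z
    have hΓw : DifferentiableAt ℝ (fun p => Γ p z w) u :=
      (hΓu.clm_apply (differentiableAt_const _)).clm_apply (differentiableAt_const _)
    have h2 : fderiv ℝ (fun p => a p (Γ p z w)) u = 0 := by
      rw [(hau.hasFDerivAt.clm_apply hΓw.hasFDerivAt).fderiv, h0, h1]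
      ext; simp
    have haw : DifferentiableAt ℝ (fun p => fderiv ℝ a p w) u :=
      hau1.clm_apply (differentiableAt_const _)
    have hnw : DifferentiableAt ℝ (fun p => nabMap Γ a p w) u :=
      hnab.clm_apply (differentiableAt_const _)
    rw [← fderiv_apply_const hnab, ← fderiv_apply_const hnw]
    simp only [nabMap_apply]
    rw [fderiv_fun_sub (haw.clm_apply (differentiableAt_const _)) (hau.clm_apply hΓw), h2,
      sub_zero, fderiv_apply_const haw, fderiv_apply_const hau1]
  have hd1 : ∀ v w z, fderiv ℝ (dMap a) u v w z =
      fderiv ℝ (fderiv ℝ a) u v w z - fderiv ℝ (fderiv ℝ a) u v z w := by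
    intro v w z
    have haw : ∀ w, DifferentiableAt ℝ (fun p => fderiv ℝ a p w) u := fun w =>
      hau1.clm_apply (differentiableAt_const _)
    have hnw : DifferentiableAt ℝ (fun p => dMap a p w) u :=
      hd.clm_apply (differentiableAt_const _)
    rw [← fderiv_apply_const hd, ← fderiv_apply_const hnw]
    simp only [dMap_apply]
    rw [fderiv_fun_sub ((haw w).clm_apply (differentiableAt_const _))
      ((haw z).clm_apply (differentiableAt_const _)), sub_apply, fderiv_apply_const (haw w),
      fderiv_apply_const hau1, fderiv_apply_const (haw z), fderiv_apply_const hau1]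
  have hcod : ∀ v, fderiv ℝ (codiffE g Γ a) u v = -trG (g u) (fderiv ℝ (fderiv ℝ a) u v) := by
    intro v
    rw [show codiffE g Γ a = fun p => -trG (g p) (nabMap Γ a p) from rfl, fderiv_fun_neg,
      neg_apply, fderiv_trG_of_eq_zero hs hg hu hnab hus hn0, hn1]
  ext w
  rw [hodgeMap, sub_apply, hcod, neg_apply]
  simp only [trG, sum_apply, smul_apply, nabMap2_apply, hd0, hd1, zero_apply, sub_zero,
    ← Finset.sum_neg_distrib, ← Finset.sum_sub_distrib]
  refine Finset.sum_congr rfl fun j _ => Finset.sum_congr rfl fun k _ => ?_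
  rw [hsymm w (e j)]
  simp only [smul_eq_mul]
  ring

theorem raiseE_pullInner (c : R7 ≃L[ℝ] R7) (v : R7) :
    raiseE (pullInner (c : R7 →L[ℝ] R7)) (pullInner (c : R7 →L[ℝ] R7) v) = v := by
  rw [raiseE, trG_pullInner]
  exact sum_pullInner_smul c v

/-- Lowering the index commutes with the second derivatives on such jets, since derivatives of `g`
meet only the vanishing 1-jet of `X`. -/
theorem laplE_of_jet {X : R7 → R7} {c : R7 ≃L[ℝ] R7} (hs : IsOpen s) (hg : ContDiffOn ℝ ∞ g s)
    (hu : ∀ u ∈ s, IsUnit (gram (g u)).det) (hΓ : ContDiffOn ℝ ∞ Γ s)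
    (hX : ContDiffOn ℝ ∞ X s) (hus : u ∈ s) (hc : g u = pullInner (c : R7 →L[ℝ] R7))
    (h0 : X u = 0) (h1 : fderiv ℝ X u = 0) :
    laplE g Γ X u = -trG (g u) (fderiv ℝ (fderiv ℝ X) u) := by
  have h2 : trG (g u) (fderiv ℝ (fderiv ℝ (lowerE g X)) u) =
      g u (trG (g u) (fderiv ℝ (fderiv ℝ X) u)) := by
    ext z
    simp only [trG, map_sum, map_smul, sum_apply, smul_apply,
      fderiv_fderiv_lowerE_of_jet hs hg hX hus h0 h1]
  have ha0 : lowerE g X u = 0 := by simp [lowerE, h0]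
  have ha1 : fderiv ℝ (lowerE g X) u = 0 := by
    ext v w
    rw [fderiv_lowerE_of_jet (differentiableAt_of_contDiffOn hs hg hus)
      (differentiableAt_of_contDiffOn hs hX hus) h0, h1]
    simp
  rw [laplE, hodgeMap_of_jet hs hg hu hΓ (contDiffOn_lowerE hg hX) hus ha0 ha1, h2, ← map_neg]
  generalize -trG (g u) (fderiv ℝ (fderiv ℝ X) u) = Z
  rw [hc, raiseE_pullInner]

/-- The 2-jet of a vector field multiplied by two functions vanishing at a point. -/
theorem jet_mul_smul {h k : R7 → ℝ} {Z : R7 → R7} (hs : IsOpen s) (hh : ContDiffOn ℝ ∞ h s)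
    (hk : ContDiffOn ℝ ∞ k s) (hZ : ContDiffOn ℝ ∞ Z s) (hus : u ∈ s) (h0 : h u = 0)
    (k0 : k u = 0) :
    ((h * k) • Z) u = 0 ∧ fderiv ℝ ((h * k) • Z) u = 0 ∧
      ∀ a b, fderiv ℝ (fderiv ℝ ((h * k) • Z)) u a b =
        (fderiv ℝ h u a * fderiv ℝ k u b + fderiv ℝ h u b * fderiv ℝ k u a) • Z u := by
  have hD : ∀ p ∈ s, fderiv ℝ ((h * k) • Z) p =
      (h p * k p) • fderiv ℝ Z p + (h p • fderiv ℝ k p + k p • fderiv ℝ h p).smulRight (Z p) :=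
    fun p hp => ((((differentiableAt_of_contDiffOn hs hh hp).hasFDerivAt.mul
      (differentiableAt_of_contDiffOn hs hk hp).hasFDerivAt)).smul
      (differentiableAt_of_contDiffOn hs hZ hp).hasFDerivAt).fderiv
  refine ⟨by simp [h0], by simp [hD u hus, h0, k0], fun a b => ?_⟩
  have hd1 : ∀ {F : Type} [NormedAddCommGroup F] [NormedSpace ℝ F] {f : R7 → F},
      ContDiffOn ℝ ∞ f s → DifferentiableAt ℝ (fun p => fderiv ℝ f p b) u := fun hf =>
    (differentiableAt_of_contDiffOn hs (hf.fderiv_of_isOpen hs (m := ∞) (by simp)) hus).clm_apply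
      (differentiableAt_const _)
  have hhu := differentiableAt_of_contDiffOn hs hh hus
  have hku := differentiableAt_of_contDiffOn hs hk hus
  have hZu := differentiableAt_of_contDiffOn hs hZ hus
  have hW : DifferentiableAt ℝ (fderiv ℝ ((h * k) • Z)) u := differentiableAt_of_contDiffOn hs
    (((hh.mul hk).smul hZ).fderiv_of_isOpen hs (m := ∞) (by simp)) hus
  have hev : (fun p => fderiv ℝ ((h * k) • Z) p b) =ᶠ[𝓝 u]
      fun p => (h p * k p) • fderiv ℝ Z p b + (h p * fderiv ℝ k p b + k p * fderiv ℝ h p b) • Z p := by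
    filter_upwards [hs.mem_nhds hus] with p hp
    rw [hD p hp]
    rfl
  have h1 := ((hhu.hasFDerivAt.mul hku.hasFDerivAt).smul (hd1 hZ).hasFDerivAt).add
    (((hhu.hasFDerivAt.mul (hd1 hk).hasFDerivAt).add
      (hku.hasFDerivAt.mul (hd1 hh).hasFDerivAt)).smul hZu.hasFDerivAt)
  rw [← fderiv_apply_const hW, hev.fderiv_eq]
  refine (DFunLike.congr_fun h1.fderiv a).trans ?_
  simp [h0, k0]
  ring_nf

end Jets

/-! ### Order and symbol of the operators on `M`. -/

variable {M : Type*} [TopologicalSpace M] [ChartedSpace R7 M] [IsManifold (𝓡 7) ∞ M]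

theorem SmoothFunction.contDiffOn_chart (f : SmoothFunction M) (x : M) :
    ContDiffOn ℝ ∞ (f ∘ (chartAt R7 x).symm) (chartAt R7 x).target := by
  intro u hu
  have h := (contMDiffAt_iff_chart ((chartAt R7 x).map_target hu) f).1 f.contMDiff.contMDiffAt
  rw [(chartAt R7 x).right_inv hu] at h
  exact h.contDiffWithinAt

theorem loc_smulField (f : SmoothFunction M) (X : SmoothField M) (x : M) :
    loc x (smulField f X) = (f ∘ (chartAt R7 x).symm) • loc x X := by
  ext1 u
  exact map_smul (toE x _) _ _

theorem jet_smulField (f k : SmoothFunction M) (X : SmoothField M) {x : M} (hf : f x = 0)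
    (hk : k x = 0) :
    loc x (smulField (f * k) X) (chartAt R7 x x) = 0 ∧
      fderiv ℝ (loc x (smulField (f * k) X)) (chartAt R7 x x) = 0 ∧
      ∀ a b : T x, fderiv ℝ (fderiv ℝ (loc x (smulField (f * k) X))) (chartAt R7 x x)
        (toE x x a) (toE x x b) =
        (mvfderiv (𝓡 7) f x a * mvfderiv (𝓡 7) k x b +
          mvfderiv (𝓡 7) f x b * mvfderiv (𝓡 7) k x a) • toE x x (X x) := by
  have hx := mem_chart_source R7 x
  have h := jet_mul_smul (chartAt R7 x).open_target (SmoothFunction.contDiffOn_chart f x)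
    (SmoothFunction.contDiffOn_chart k x) (X.contDiffOn_loc x) (mem_chart_target R7 x)
    (by rw [Function.comp_apply, (chartAt R7 x).left_inv hx, hf])
    (by rw [Function.comp_apply, (chartAt R7 x).left_inv hx, hk])
  rw [show loc x (smulField (f * k) X) =
    ((f ∘ (chartAt R7 x).symm) * (k ∘ (chartAt R7 x).symm)) • loc x X from loc_smulField _ X x]
  refine ⟨h.1, h.2.1, fun a b => ?_⟩
  rw [h.2.2, loc_apply hx]
  simp only [mvfderiv_chart hx]

variable [T2Space M] {σ : ThreeFormField M} {D0 : AffineConnection M}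

/-- Polarized symbol. One identity yields both the order bound and, with `k = f` and the factor 1/2,
the symbol `|df|²` times the identity. -/
theorem linearizedOperator_smulField (hσ : IsG2Structure σ)
    (hD0 : CovariantDerivative.ContMDiffCovariantDerivative D0 ∞) (f k : SmoothFunction M)
    (X : SmoothField M) {x : M} (hf : f x = 0) (hk : k x = 0) :
    linearizedOperator hσ hD0 (smulField (f * k) X) x =
      (2 * ∑ i, mvfderiv (𝓡 7) f x (frame σ x i) * mvfderiv (𝓡 7) k x (frame σ x i)) • X x := by
  have hx := mem_chart_source R7 x
  obtain ⟨h0, h1, h2⟩ := jet_smulField f k X hf hk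
  apply toE_injective hx
  rw [toE_linearizedOperator hσ hD0 _ hx, locLinearized, linE_of_jet h0 h1, ← sum_frame σ hx,
    map_smul, Finset.mul_sum, Finset.sum_smul]
  refine Finset.sum_congr rfl fun i _ => ?_
  rw [h2, ← two_mul]

theorem linearizedOperator_add_hodgeOperator_smulField (hσ : IsG2Structure σ)
    (hD0 : CovariantDerivative.ContMDiffCovariantDerivative D0 ∞) (f k : SmoothFunction M)
    (X : SmoothField M) {x : M} (hf : f x = 0) (hk : k x = 0) :
    (linearizedOperator hσ hD0 + hodgeOperator D0 hσ) (smulField (f * k) X) x = 0 := by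
  have hx := mem_chart_source R7 x
  obtain ⟨h0, h1, -⟩ := jet_smulField f k X hf hk
  apply toE_injective hx
  have h : toE x x ((linearizedOperator hσ hD0 + hodgeOperator D0 hσ) (smulField (f * k) X) x) =
      toE x x (linearizedOperator hσ hD0 (smulField (f * k) X) x) +
        toE x x (hodgeOperator D0 hσ (smulField (f * k) X) x) := map_add _ _ _
  rw [h, toE_linearizedOperator hσ hD0 _ hx, toE_hodgeOperator D0 hσ _ hx, locLinearized,
    linE_of_jet h0 h1, laplE_of_jet (chartAt R7 x).open_target (contDiffOn_locMetric hσ x)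
      (fun _ hu => isUnit_det_gram_locMetric σ hu) (contDiffOn_koszulMap_locMetric hσ x)
      (SmoothField.contDiffOn_loc _ x) (mem_chart_target R7 x)
      (locMetric_eq_pullInner σ (mem_chart_target R7 x)) h0 h1, add_neg_cancel, map_zero]

theorem isDiffOp_linearizedOperator (hσ : IsG2Structure σ)
    (hD0 : CovariantDerivative.ContMDiffCovariantDerivative D0 ∞) :
    IsDiffOp 2 (linearizedOperator hσ hD0) := by
  intro x f hf X
  -- Two factors saturate the second-order jet; the third makes the remaining field vanish at `x`.
  have h : smulField (∏ i, f i) X = smulField (f 0 * f 1) (smulField (f 2) X) := by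
    ext1 y
    change (∏ i, f i : SmoothFunction M) y • X y = (f 0 y * f 1 y) • f 2 y • X y
    rw [Fin.prod_univ_three, smul_smul]
    rfl
  have h0 : smulField (f 2) X x = 0 := by
    change f 2 x • X x = 0
    rw [hf, zero_smul]
  rw [h, linearizedOperator_smulField hσ hD0 _ _ _ (hf 0) (hf 1), h0, smul_zero]

theorem isDiffOp_linearizedOperator_add_hodgeOperator (hσ : IsG2Structure σ)
    (hD0 : CovariantDerivative.ContMDiffCovariantDerivative D0 ∞) :
    IsDiffOp 1 (linearizedOperator hσ hD0 + hodgeOperator D0 hσ) := by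
  intro x f hf X
  rw [Fin.prod_univ_two]
  exact linearizedOperator_add_hodgeOperator_smulField hσ hD0 _ _ X (hf 0) (hf 1)

theorem isStrictlyParabolic_linearizedOperator (hσ : IsG2Structure σ)
    (hD0 : CovariantDerivative.ContMDiffCovariantDerivative D0 ∞) :
    IsStrictlyParabolic σ (linearizedOperator hσ hD0) := by
  -- The constant 1 is attained: the symbol is exactly `|ξ|²` times the identity, so the inequality
  -- is an equality.
  refine ⟨isDiffOp_linearizedOperator hσ hD0, 1, one_pos, fun x f X hf => le_of_eq ?_⟩
  rw [linearizedOperator_smulField hσ hD0 f f X hf hf, smul_smul, metric, metric, map_smul,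
    real_inner_smul_left]
  simp only [pow_two]
  ring

end G2Flow

end

/-! ### Assembly of the proposition. -/

theorem mainTheorem4 {M : Type*} [TopologicalSpace M] [T2Space M] [SecondCountableTopology M]
    [ChartedSpace G2Flow.R7 M] [IsManifold (𝓡 7) ∞ M]
    (D0 : G2Flow.AffineConnection M) (hD0 : D0.torsion = 0)
    (hD0_smooth : CovariantDerivative.ContMDiffCovariantDerivative D0 ∞)
    (J : Set ℝ) (σ : ℝ → G2Flow.ThreeFormField M)
    (hσ : ∀ t ∈ J, G2Flow.IsG2Structure (σ t)) :
    (∃ A : ℝ, A ≠ 0 ∧ G2Flow.IsDivConstant A) ∧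
    ∀ A : ℝ, G2Flow.IsDivConstant A → ∀ t ∈ J, ∀ f : G2Flow.Diffeo M,
      ∃ P : G2Flow.SmoothField M →ₗ[ℝ] G2Flow.SmoothField M,
        G2Flow.IsLinearizationAt (G2Flow.flowField A D0 (σ t)) f P ∧
        G2Flow.IsStrictlyParabolic (G2Flow.pushForm f (σ t)) P ∧
        ∃ R : G2Flow.SmoothField M →ₗ[ℝ] G2Flow.SmoothField M,
          G2Flow.IsDiffOp 1 R ∧
          ∀ (X : G2Flow.SmoothField M) (x : M),
            P X x =
              -G2Flow.sharp (G2Flow.pushForm f (σ t))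
                (G2Flow.hodgeLaplacian D0 (G2Flow.pushForm f (σ t))
                  (G2Flow.flat (G2Flow.pushForm f (σ t)) X)) x + R X x := by 
  refine ⟨⟨-1 / 2, by norm_num, G2Flow.isDivConstant_neg_half⟩, fun A hA t ht f => ?_⟩
  obtain rfl := G2Flow.isDivConstant_unique hA
  have hf := (hσ t ht).pushForm f
  -- The remainder `R` is `P + Δ`, whose second-order parts cancel; the last claim is then the
  -- identity `P = -Δ + (P + Δ)`.
  refine ⟨G2Flow.linearizedOperator hf hD0_smooth,
    G2Flow.isLinearizationAt_linearizedOperator (hσ t ht) hD0_smooth f,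
    G2Flow.isStrictlyParabolic_linearizedOperator hf hD0_smooth,
    G2Flow.linearizedOperator hf hD0_smooth + G2Flow.hodgeOperator D0 hf,
    G2Flow.isDiffOp_linearizedOperator_add_hodgeOperator hf hD0_smooth, fun X x => ?_⟩
  rw [← G2Flow.hodgeOperator_apply D0 hf X x]
  exact (neg_add_cancel_comm_assoc _ _).symm
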